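/- **Definitions.** In a finite monoid $M$, $x^\omega$ denotes the unique idempotent among the powers $x^k$, $k>1$. Terms are built from variables $x_1,x_2,\dots$ by concatenation and the unary operation $t\mapsto t^\omega$; $M$ satisfies $s=t$ if $s$ and $t$ take the same value under every valuation of the variables in $M$. Put $u_1=(x_1x_2)^\omega$, $v_1=(x_2x_1)^\omega$ and, for $n\ge 1$, $$u_{n+1}=(x_1\cdots x_{2n}x_{2n+1})^\omega\, u_n\, (x_{2n+2}x_1\cdots x_{2n})^\omega,\qquad v_{n+1}=(x_1\cdots x_{2n}x_{2n+1})^\omega\, v_n\, (x_{2n+2}x_1\cdots x_{2n})^\omega .$$ For a homomorphism $\psi:A^*\to N$ let $\tau_\psi:A^*\to (N\times A\times N)^*$ be the map sending $a_1\cdots a_k$ to the word with $i$-th letter $(\psi(a_1\cdots a_{i-1}),a_i,\psi(a_{i+1}\cdots a_k))$. For classes $\mathbf V,\mathbf W$ of finite monoids, a finite monoid $M$ is in $\mathbf V\mathbin{**}\mathbf W$ if, for some finite alphabet $A$ and some surjective homomorphism $\varphi:A^*\to M$ (equivalently, for all such), there are homomorphisms $\psi:A^*\to N\in\mathbf W$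 and $h:(N\times A\times N)^*\to K\in\mathbf V$ such that $\psi(v)=\psi(w)$ and $h(\tau_\psi(v))=h(\tau_\psi(w))$ imply $\varphi(v)=\varphi(w)$. Let $\mathbf J$ be the class of finite monoids in which $MsM=MtM$ implies $s=t$, and let $\mathbf V_1=\mathbf J$, $\mathbf V_{n+1}=\mathbf V_n\mathbin{**}\mathbf J$ for $n\ge1$. For $n\ge1$, the $n$-th level of the quantifier alternation hierarchy of $\mathrm{FO}^2[<]$ consists of the languages of finite words over a finite alphabet that are defined by a first-order sentence over $<$, $=$ and the letter predicates, using only two variables (which may be requantified), in negation normal form, and with at most $n$ blocks of equal quantifiers on each path of its parse tree. **Theorem.** 1. For every $n\ge 1$, a finite monoid $M$ is in $\mathbf V_n$ if and only if $M$ satisfies $x^\omega=xx^\omega$ and $u_n=v_n$. 2. There is an algorithm which decides, given $n\geq 1$ and a finite table, whether it is the multiplication table of a monoid in $\mathbf V_n$. 3. There is an algorithm which decides, given $n\ge 1$ and a deterministic finite automaton, whether the language that it accepts is in the $n$-th level of the quantifier alternation hierarchy of $\mathrm{FO}^2[<]$. In particular, every level of this hierarchy is decidable. -/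

import Mathlib

universe u

namespace TwoVarHierarchy

/-! ### Omega-terms and identities -/

/-- In a finite monoid, every element has an idempotent power with exponent greater than `1`. -/
theorem exists_idempotent_pow {M : Type u} [Monoid M] [Finite M] (x : M) :
    ∃ k : ℕ, 1 < k ∧ IsIdempotentElem (x ^ k) := by
  obtain ⟨i, j, hij, h⟩ := Finite.exists_ne_map_eq_of_infinite (fun k : ℕ => x ^ k)
  wlog hlt : i < j generalizing i j with H
  · exact H j i hij.symm h.symm (lt_of_le_of_ne (not_lt.mp hlt) hij.symm)
  obtain ⟨d, rfl⟩ := Nat.exists_eq_add_of_lt hlt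
  have step : ∀ m, x ^ (i + m * (d + 1)) = x ^ i := by
    intro m
    induction m with
    | zero => simp
    | succ m ih =>
      have e : i + (m + 1) * (d + 1) = (i + m * (d + 1)) + (d + 1) := by ring
      rw [e, pow_add, ih, ← pow_add, ← add_assoc, ← h]
  have step2 : ∀ m r, x ^ (i + r + m * (d + 1)) = x ^ (i + r) := by
    intro m r
    have e : i + r + m * (d + 1) = (i + m * (d + 1)) + r := by ring
    rw [e, pow_add, step, ← pow_add]
  refine ⟨(i + 2) * (d + 1), by nlinarith, ?_⟩
  have hge : i ≤ (i + 2) * (d + 1) := by nlinarith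
  obtain ⟨r, hr⟩ := Nat.exists_eq_add_of_le hge
  unfold IsIdempotentElem
  rw [← pow_add]
  conv_lhs => rw [hr]
  rw [show i + r + (i + r) = i + r + (i + 2) * (d + 1) by rw [hr], step2, ← hr]

/-- Two idempotent powers (with positive exponents) of the same element are equal. -/
theorem idempotent_pow_unique {M : Type u} [Monoid M] (x : M) {k l : ℕ} (hk : 1 < k) (hl : 1 < l)
    (h : IsIdempotentElem (x ^ k)) (h' : IsIdempotentElem (x ^ l)) : x ^ k = x ^ l := by
  rw [← h.pow_eq (n := l) (by omega), ← h'.pow_eq (n := k) (by omega), ← pow_mul, ← pow_mul,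
    mul_comm]

open Classical in
/-- `x ^ ω`: the idempotent in `{x ^ k : k > 1}`. In a finite monoid it exists and is unique;
the value `1` is used when there is none. -/
noncomputable def omegaPow {M : Type u} [Monoid M] (x : M) : M :=
  if h : ∃ k : ℕ, 1 < k ∧ IsIdempotentElem (x ^ k) then x ^ h.choose else 1

theorem omegaPow_eq {M : Type u} [Monoid M] (x : M) {k : ℕ} (hk : 1 < k)
    (h : IsIdempotentElem (x ^ k)) : omegaPow x = x ^ k := by
  have hex : ∃ k : ℕ, 1 < k ∧ IsIdempotentElem (x ^ k) := ⟨k, hk, h⟩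
  rw [omegaPow, dif_pos hex]
  exact idempotent_pow_unique x hex.choose_spec.1 hk hex.choose_spec.2 h

/-- Terms over the variables `x 0, x 1, x 2, …` built by concatenation and the unary `ω`. -/
inductive OmegaTerm : Type
  | x (i : ℕ) : OmegaTerm
  | mul (s t : OmegaTerm) : OmegaTerm
  | omega (t : OmegaTerm) : OmegaTerm

/-- The value of a term under a valuation of the variables in a monoid. -/
noncomputable def OmegaTerm.eval {M : Type u} [Monoid M] (ρ : ℕ → M) : OmegaTerm → M
  | .x i => ρ i
  | .mul s t => s.eval ρ * t.eval ρ
  | .omega t => omegaPow (t.eval ρ)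

/-- `M ⊨ (s = t)`: both terms have the same value under every valuation in `M`. -/
def Satisfies (M : Type u) [Monoid M] (s t : OmegaTerm) : Prop :=
  ∀ ρ : ℕ → M, s.eval ρ = t.eval ρ

/-- The term `x₁ x₂ ⋯ xₖ` for `k ≥ 1` (the value at `k = 0` is not used). -/
def prodVars : ℕ → OmegaTerm
  | 0 => .x 1
  | 1 => .x 1
  | k + 2 => .mul (prodVars (k + 1)) (.x (k + 2))

/-- `(x₁ ⋯ x₂ₙ x₂ₙ₊₁)^ω · t · (x₂ₙ₊₂ x₁ ⋯ x₂ₙ)^ω`. -/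
def wrap (n : ℕ) (t : OmegaTerm) : OmegaTerm :=
  .mul (.mul (.omega (.mul (prodVars (2 * n)) (.x (2 * n + 1)))) t)
    (.omega (.mul (.x (2 * n + 2)) (prodVars (2 * n))))

/-- `u₁ = (x₁x₂)^ω` and `uₙ₊₁ = (x₁ ⋯ x₂ₙ x₂ₙ₊₁)^ω uₙ (x₂ₙ₊₂ x₁ ⋯ x₂ₙ)^ω` for `n ≥ 1`
(the value at `0` is not used). -/
def uTerm : ℕ → OmegaTerm
  | 0 => .x 1
  | 1 => .omega (.mul (.x 1) (.x 2))
  | n + 2 => wrap (n + 1) (uTerm (n + 1))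

/-- `v₁ = (x₂x₁)^ω` and `vₙ₊₁ = (x₁ ⋯ x₂ₙ x₂ₙ₊₁)^ω vₙ (x₂ₙ₊₂ x₁ ⋯ x₂ₙ)^ω` for `n ≥ 1`
(the value at `0` is not used). -/
def vTerm : ℕ → OmegaTerm
  | 0 => .x 1
  | 1 => .omega (.mul (.x 2) (.x 1))
  | n + 2 => wrap (n + 1) (vTerm (n + 1))

/-- The identity `x^ω = x x^ω` defining aperiodicity. -/
def Aperiodic (M : Type u) [Monoid M] : Prop :=
  Satisfies M (.omega (.x 1)) (.mul (.x 1) (.omega (.x 1)))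

/-! ### Two-sided semidirect products of classes of finite monoids -/

/-- A class of monoids. -/
abbrev MonoidClass : Type (u + 1) := (M : Type u) → [Monoid M] → Prop

/-- The class `J` of finite `𝒥`-trivial monoids: `MsM = MtM` implies `s = t`. -/
def classJ : MonoidClass.{u} := fun M _ =>
  Finite M ∧ ∀ s t : M, {m : M | ∃ a b, m = a * s * b} = {m : M | ∃ a b, m = a * t * b} → s = t

/-- Auxiliary transduction: `transduceFrom ψ p (a₁ ⋯ aₖ)` is the word whose `i`-th letter is
`(p * ψ (a₁ ⋯ aᵢ₋₁), aᵢ, ψ (aᵢ₊₁ ⋯ aₖ))`. -/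
def transduceFrom {A N : Type u} [Monoid N] (ψ : FreeMonoid A →* N) :
    N → List A → List (N × A × N)
  | _, [] => []
  | p, a :: w =>
    (p, a, ψ (FreeMonoid.ofList w)) :: transduceFrom ψ (p * ψ (FreeMonoid.of a)) w

/-- The length-preserving transduction `τ_ψ : A* → (N × A × N)*`, which sends `a₁ ⋯ aₖ` to the word
whose `i`-th letter is `(ψ (a₁ ⋯ aᵢ₋₁), aᵢ, ψ (aᵢ₊₁ ⋯ aₖ))`. -/
def transduce {A N : Type u} [Monoid N] (ψ : FreeMonoid A →* N) (w : FreeMonoid A) :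
    FreeMonoid (N × A × N) :=
  FreeMonoid.ofList (transduceFrom ψ 1 w.toList)

/-- There are homomorphisms `ψ : A* → N ∈ W` and `h : (N × A × N)* → K ∈ V` such that `φ` factors
through `(h ∘ τ_ψ, ψ)`. -/
def FactorsThrough (V W : MonoidClass.{u}) {A M : Type u} [Monoid M] (φ : FreeMonoid A →* M) :
    Prop :=
  ∃ (N : Type u) (_ : Monoid N) (K : Type u) (_ : Monoid K), Finite N ∧ Finite K ∧ W N ∧ V K ∧
    ∃ (ψ : FreeMonoid A →* N) (h : FreeMonoid (N × A × N) →* K),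
      ∀ v w : FreeMonoid A, ψ v = ψ w → h (transduce ψ v) = h (transduce ψ w) → φ v = φ w

/-- The two-sided semidirect product `V ** W`. By `FactorsThrough.of_surjective` below, the choice
of the finite alphabet `A` and of the surjective homomorphism `φ : A* → M` does not matter. -/
def twoSidedProduct (V W : MonoidClass.{u}) : MonoidClass.{u} := fun M _ =>
  Finite M ∧ ∃ (A : Type u) (_ : Finite A) (φ : FreeMonoid A →* M),
    Function.Surjective φ ∧ FactorsThrough V W φ

/-- `V₁ = J` and `Vₙ₊₁ = Vₙ ** J` for `n ≥ 1` (the value at `0` is not used). -/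
def levelV : ℕ → MonoidClass.{u}
  | 0 => classJ
  | 1 => classJ
  | n + 2 => twoSidedProduct (levelV (n + 1)) classJ

/-- The two-sided translate `(n, a, n') ↦ (p * n, a, n' * s)` on letters. -/
def translate {A N : Type u} [Monoid N] (p s : N) (σ : N × A × N) : N × A × N :=
  (p * σ.1, σ.2.1, σ.2.2 * s)

theorem transduceFrom_append {A N : Type u} [Monoid N] (ψ : FreeMonoid A →* N) (p : N)
    (v w : List A) :
    transduceFrom ψ p (v ++ w) =
      (transduceFrom ψ p v).map (translate 1 (ψ (FreeMonoid.ofList w))) ++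
        transduceFrom ψ (p * ψ (FreeMonoid.ofList v)) w := by
  induction v generalizing p with
  | nil => simp [transduceFrom]
  | cons a v ih =>
    have e : FreeMonoid.ofList (a :: v) = FreeMonoid.of a * FreeMonoid.ofList v := rfl
    simp only [List.cons_append, transduceFrom, List.map_cons, ih, e, map_mul, mul_assoc,
      FreeMonoid.ofList_append, translate, one_mul]

theorem transduceFrom_translate {A N : Type u} [Monoid N] (ψ : FreeMonoid A →* N) (p q s : N)
    (w : List A) :
    (transduceFrom ψ q w).map (translate p s) =
      (transduceFrom ψ (p * q) w).map (translate 1 s) := by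
  induction w generalizing q with
  | nil => rfl
  | cons a w ih => simp [transduceFrom, translate, ih, mul_assoc]

/-- Membership in `V ** W` may be tested with any surjective homomorphism `φ' : B* → M`. -/
theorem FactorsThrough.of_surjective {V W : MonoidClass.{u}} {A B M : Type u} [Monoid M]
    {φ : FreeMonoid A →* M} (hφ : Function.Surjective φ) (H : FactorsThrough V W φ)
    (φ' : FreeMonoid B →* M) : FactorsThrough V W φ' := by
  obtain ⟨N, _, K, _, hN, hK, hW, hV, ψ, h, hh⟩ := H
  choose g hg using fun b : B => hφ (φ' (FreeMonoid.of b))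
  let θ : FreeMonoid B →* FreeMonoid A := FreeMonoid.lift g
  have hθ : ∀ w, φ (θ w) = φ' w := by
    intro w
    have : φ.comp θ = φ' := by
      apply FreeMonoid.hom_eq
      intro b
      simp [θ, hg]
    exact DFunLike.congr_fun this w
  let h' : FreeMonoid (N × B × N) →* K := FreeMonoid.lift fun σ =>
    h (FreeMonoid.ofList ((transduceFrom ψ 1 (g σ.2.1).toList).map (translate σ.1 σ.2.2)))
  have key : ∀ (w : List B) (p : N),
      h' (FreeMonoid.ofList (transduceFrom (ψ.comp θ) p w)) =
        h (FreeMonoid.ofList (transduceFrom ψ p (θ (FreeMonoid.ofList w)).toList)) := by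
    intro w
    induction w with
    | nil => intro p; simp [transduceFrom]
    | cons b w ih =>
      intro p
      have e : FreeMonoid.ofList (b :: w) = FreeMonoid.of b * FreeMonoid.ofList w := rfl
      have e2 : θ (FreeMonoid.of b) = g b := by simp [θ]
      rw [e, map_mul, e2, FreeMonoid.toList_mul, transduceFrom_append, transduceFrom,
        FreeMonoid.ofList_cons, map_mul, ih, FreeMonoid.ofList_append, map_mul]
      have e3 : h' (FreeMonoid.of (p, b, (ψ.comp θ) (FreeMonoid.ofList w))) =
          h (FreeMonoid.ofList ((transduceFrom ψ 1 (g b).toList).map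
            (translate p ((ψ.comp θ) (FreeMonoid.ofList w))))) := by
        simp [h']
      rw [e3, transduceFrom_translate]
      simp [e2]
  refine ⟨N, _, K, _, hN, hK, hW, hV, ψ.comp θ, h', fun v w h1 h2 => ?_⟩
  rw [← hθ, ← hθ]
  refine hh _ _ h1 ?_
  have k1 := key v.toList 1
  have k2 := key w.toList 1
  simp only [FreeMonoid.ofList_toList] at k1 k2
  unfold transduce at h2 ⊢
  rw [← k1, ← k2]
  exact h2

/-! ### Two-variable first-order logic over finite words -/

/-- Formulas of `FO²[<]` over the alphabet `A`, in negation normal form. The two variables are the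
elements of `Fin 2`. The Boolean argument of a literal is its sign. -/
inductive FO2 (A : Type) : Type
  | tru : FO2 A
  | fls : FO2 A
  | letter (sign : Bool) (a : A) (x : Fin 2) : FO2 A
  | less (sign : Bool) (x y : Fin 2) : FO2 A
  | equal (sign : Bool) (x y : Fin 2) : FO2 A
  | and (α β : FO2 A) : FO2 A
  | or (α β : FO2 A) : FO2 A
  | ex (x : Fin 2) (α : FO2 A) : FO2 A
  | all (x : Fin 2) (α : FO2 A) : FO2 A

namespace FO2

variable {A : Type}

/-- The set of free variables. -/
def free : FO2 A → Set (Fin 2)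
  | tru => ∅
  | fls => ∅
  | letter _ _ x => {x}
  | less _ x y => {x, y}
  | equal _ x y => {x, y}
  | and α β => α.free ∪ β.free
  | or α β => α.free ∪ β.free
  | ex x α => α.free \ {x}
  | all x α => α.free \ {x}

/-- Satisfaction in the word `w`. Variables stand for positions `0, …, |w| - 1`, and quantifiers
range over these positions. -/
def Sat (w : List A) : (Fin 2 → ℕ) → FO2 A → Prop
  | _, tru => True
  | _, fls => False
  | ν, letter sign a x => (w[ν x]? = some a ↔ sign = true)
  | ν, less sign x y => (ν x < ν y ↔ sign = true)
  | ν, equal sign x y => (ν x = ν y ↔ sign = true)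
  | ν, and α β => Sat w ν α ∧ Sat w ν β
  | ν, or α β => Sat w ν α ∨ Sat w ν β
  | ν, ex x α => ∃ i < w.length, Sat w (Function.update ν x i) α
  | ν, all x α => ∀ i < w.length, Sat w (Function.update ν x i) α

/-- `blocksFrom q α` is the maximal number of new blocks of equal quantifiers on a path of the parse
tree of `α`, when the last quantifier above `α` is `q` (`true` for `∃`, `false` for `∀`, `none` if
there is no quantifier above). -/
def blocksFrom : Option Bool → FO2 A → ℕ
  | _, tru => 0
  | _, fls => 0
  | _, letter _ _ _ => 0
  | _, less _ _ _ => 0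
  | _, equal _ _ _ => 0
  | q, and α β => max (blocksFrom q α) (blocksFrom q β)
  | q, or α β => max (blocksFrom q α) (blocksFrom q β)
  | q, ex _ α => (if q = some true then 0 else 1) + blocksFrom (some true) α
  | q, all _ α => (if q = some false then 0 else 1) + blocksFrom (some false) α

/-- The maximal number of quantifier blocks on a path of the parse tree. -/
def blocks (α : FO2 A) : ℕ := blocksFrom none α

end FO2

/-- The `n`-th level of the quantifier alternation hierarchy of `FO²[<]`: languages defined by a
sentence with at most `n` quantifier blocks on every path of its parse tree. The valuation used for
evaluating a sentence is immaterial. -/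
def InAlternationLevel {A : Type} (n : ℕ) (L : Language A) : Prop :=
  ∃ α : FO2 A, α.free = ∅ ∧ α.blocks ≤ n ∧ ∀ w : List A, w ∈ L ↔ α.Sat w (fun _ => 0)

/-! ### Finite inputs of the decision problems -/

/-- `T` is a multiplication table of the monoid `M`, for a numbering of its elements by
`0, …, |T| - 1`. -/
def IsTable (T : List (List ℕ)) (M : Type) [Monoid M] : Prop :=
  ∃ e : M ≃ Fin T.length, ∀ x y : M, (T.getD (e x) []).getD (e y) 0 = (e (x * y) : ℕ)

/-- The automaton over the alphabet `{0, …, k - 1}` with transition table `T`, initial state `0` and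
list `F` of accepting states. Only `0` and the finitely many entries of `T` are reachable. -/
def tableDFA (k : ℕ) (T : List (List ℕ)) (F : List ℕ) : DFA (Fin k) ℕ where
  step q a := (T.getD q []).getD a 0
  start := 0
  accept := {q | q ∈ F}

end TwoVarHierarchy

open TwoVarHierarchy

namespace TwoVarHierarchy

/-! ### Omega powers and evaluation of terms -/

section Omega

variable {M : Type u} [Monoid M]

/-! The equational description is proved by induction on `n`, through two inclusions between `Vₙ **
J` and the identities of level `n + 1`.

From the product to the identities (`levelIdentities_of_twoSidedProduct`): in a `𝒥`-trivial monoid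
`N` an idempotent absorbs everything `𝒥`-above it. Hence the two outer `ω`-powers of `uₙ₊₁` freeze
the `N`-coordinates while the inner term, whose variables `x₁, …, x₂ₙ` occur in both powers, is
being read. On such frozen stretches the value of the transduction in `K` is multiplicative
(`localHom`), so `uₙ = vₙ` in `K` makes the two sides indistinguishable.

From the identities to the product (`factorsThrough_of_levelIdentities`): the identities force `M`
into `DA`. Take for `N` the words modulo their subwords of length at most `|M| + 1`. A transduced
letter is a loop if neither of its `N`-coordinates notices the letter. Non-loops never repeat, so
their sequence is recovered from subwords of length `2`. The loops between two consecutive non-loops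
share one pair of coordinates; by `exists_idem_right` and its dual, the values of the surrounding
words absorb idempotents `e` and `f` that lie `𝒥`-below all these loop letters. Substituting `e` and
`f` for the last two variables of `uₙ₊₁ = vₙ₊₁` yields `e uₙ f = e vₙ f` (`idem_mul_eval_mul_idem`).
Thus the local monoids between `e` and `f` satisfy the identities of level `n` and can serve in `K`.

The bridge to logic is that level `n` consists of the languages recognized by `Vₙ`
(`inAlternationLevel_iff`). A single quantifier block sees only subwords of bounded length, so the
innermost blocks can be traded for letters of a word transduced by a subword congruence
(`FO2.reducible`). Conversely, Simon's theorem (`prod_eq_of_subEq`) makes each letter of a word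
transduced by a `𝒥`-trivial monoid definable with one block (`definable_transduce`).

For decidability, recognition by `Vₙ` becomes a pair of identities in the syntactic monoid. An
automaton with `S` states has at most `S ^ S` transformations, each induced by a word of length at
most `S ^ S`. So finitely many words have to be tested, with an explicit exponent in place of `ω`
(`testAll_iff`), and the test is primitive recursive. -/

theorem exists_omegaPow_eq_pow [Finite M] (x : M) :
    ∃ k : ℕ, omegaPow x = x ^ (k + 2) ∧ IsIdempotentElem (omegaPow x) := by
  obtain ⟨k, hk, h⟩ := exists_idempotent_pow x
  obtain ⟨j, rfl⟩ := Nat.exists_eq_add_of_le' (show 2 ≤ k from hk)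
  exact ⟨j, omegaPow_eq x hk h, by rwa [omegaPow_eq x hk h]⟩

theorem omegaPow_idem [Finite M] (x : M) : omegaPow x * omegaPow x = omegaPow x :=
  (exists_omegaPow_eq_pow x).choose_spec.2

theorem omegaPow_of_idem {e : M} (he : e * e = e) : omegaPow e = e := by
  have he' : IsIdempotentElem e := he
  rw [omegaPow_eq e (k := 2) (by norm_num) (by rw [he'.pow_eq (by norm_num)]; exact he'),
    he'.pow_eq (by norm_num)]

theorem map_omegaPow {N : Type*} [Monoid N] [Finite M] (f : M →* N) (x : M) :
    f (omegaPow x) = omegaPow (f x) := by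
  obtain ⟨k, h1, h2⟩ := exists_omegaPow_eq_pow x
  rw [h1, map_pow]
  refine (omegaPow_eq _ (by omega) ?_).symm
  rw [← map_pow, ← h1]
  exact h2.map f

theorem map_eval {N : Type*} [Monoid N] [Finite M] (f : M →* N) (ρ : ℕ → M) (t : OmegaTerm) :
    f (t.eval ρ) = t.eval (fun i => f (ρ i)) := by
  induction t with
  | x i => rfl
  | mul s t hs ht => simp only [OmegaTerm.eval, map_mul, hs, ht]
  | omega t ht => simp only [OmegaTerm.eval, map_omegaPow, ht]

/-- `E` is an exponent such that `x ^ E` is idempotent for every `x`. -/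
def IsExponent (M : Type*) [Monoid M] (E : ℕ) : Prop := 1 < E ∧ ∀ x : M, x ^ E * x ^ E = x ^ E

theorem IsExponent.omegaPow_eq {E : ℕ} (h : IsExponent M E) (x : M) : omegaPow x = x ^ E :=
  TwoVarHierarchy.omegaPow_eq x h.1 (h.2 x)

/-- By pigeonhole on `x^0, …, x^c`, index and period of `x` are at most `c`; the factorial exceeds
the index and is a multiple of the period. Since only a bound on the cardinality enters, one
exponent serves several monoids at once and can be computed from an automaton. -/
theorem isExponent_factorial [Finite M] {c : ℕ} (hc : Nat.card M ≤ c) :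
    IsExponent M (c + 2).factorial := by
  refine ⟨lt_of_lt_of_le (show 1 < c + 2 by have := Nat.card_pos (α := M); omega)
    (Nat.self_le_factorial (c + 2)), ?_⟩
  intro x
  have hni : ¬ Function.Injective (fun k : Fin (c + 1) => x ^ (k : ℕ)) := by
    intro hinj
    have := Nat.card_le_card_of_injective _ hinj
    simp at this
    omega
  simp only [Function.Injective, not_forall] at hni
  obtain ⟨i, j, h, hij⟩ := hni
  wlog hlt : i < j generalizing i j with H
  · exact H j i h.symm (Ne.symm hij) (lt_of_le_of_ne (not_lt.mp hlt) (Ne.symm hij))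
  have hi := i.2
  have hj := j.2
  have hlt' : (i : ℕ) < j := hlt
  generalize (i : ℕ) = a at *
  generalize (j : ℕ) = b at *
  obtain ⟨d, rfl⟩ := Nat.exists_eq_add_of_lt hlt'
  have step : ∀ m, x ^ (a + m * (d + 1)) = x ^ a := by
    intro m
    induction m with
    | zero => simp
    | succ m ih =>
      have e : a + (m + 1) * (d + 1) = (a + m * (d + 1)) + (d + 1) := by ring
      rw [e, pow_add, ih, ← pow_add, ← add_assoc, ← h]
  obtain ⟨m, hm⟩ : (d + 1) ∣ (c + 2).factorial := Nat.dvd_factorial (by omega) (by omega)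
  obtain ⟨r, hr⟩ : ∃ r, (c + 2).factorial = a + r := Nat.exists_eq_add_of_le
    ((Nat.self_le_factorial (c + 2)).trans' (by omega))
  rw [← pow_add]
  nth_rw 1 [hr]
  rw [hm, show a + r + (d + 1) * m = a + m * (d + 1) + r by ring, pow_add, step, ← pow_add, ← hr, hm]

/-- The value of a term when `ω` is replaced by the exponent `E`. -/
def OmegaTerm.evalPow {M : Type*} [Monoid M] (E : ℕ) (ρ : ℕ → M) : OmegaTerm → M
  | .x i => ρ i
  | .mul s t => s.evalPow E ρ * t.evalPow E ρ
  | .omega t => (t.evalPow E ρ) ^ E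

/-- Free monoids have no useful `ω`, but they do have `E`-th powers. Terms can therefore be
evaluated on words first and mapped to finite monoids afterwards. -/
theorem IsExponent.eval_eq {E : ℕ} (h : IsExponent M E) (ρ : ℕ → M) (t : OmegaTerm) :
    t.eval ρ = t.evalPow E ρ := by
  induction t with
  | x i => rfl
  | mul s t hs ht => simp only [OmegaTerm.eval, OmegaTerm.evalPow, hs, ht]
  | omega t ht => simp only [OmegaTerm.eval, OmegaTerm.evalPow, ht, h.omegaPow_eq]

theorem map_evalPow {N : Type*} [Monoid N] (f : M →* N) (E : ℕ) (ρ : ℕ → M) (t : OmegaTerm) :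
    f (t.evalPow E ρ) = t.evalPow E (fun i => f (ρ i)) := by
  induction t with
  | x i => rfl
  | mul s t hs ht => simp only [OmegaTerm.evalPow, map_mul, hs, ht]
  | omega t ht => simp only [OmegaTerm.evalPow, map_pow, ht]

end Omega

/-! ### Variables occurring in the terms -/

/-- All variables of the term are among `x 1, …, x m`. -/
def OmegaTerm.VarsLE (m : ℕ) : OmegaTerm → Prop
  | .x i => 1 ≤ i ∧ i ≤ m
  | .mul s t => s.VarsLE m ∧ t.VarsLE m
  | .omega t => t.VarsLE m

theorem OmegaTerm.VarsLE.mono {m m' : ℕ} (hm : m ≤ m') :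
    ∀ {t : OmegaTerm}, t.VarsLE m → t.VarsLE m'
  | .x _, h => ⟨h.1, h.2.trans hm⟩
  | .mul _ _, h => ⟨h.1.mono hm, h.2.mono hm⟩
  | .omega t, h => OmegaTerm.VarsLE.mono (t := t) hm h

theorem prodVars_varsLE : ∀ {k : ℕ}, 1 ≤ k → (prodVars k).VarsLE k
  | 1, _ => ⟨le_rfl, le_rfl⟩
  | k + 2, _ => ⟨(prodVars_varsLE (k := k + 1) (by omega)).mono (by omega), by omega, le_rfl⟩

theorem wrap_varsLE {n : ℕ} (hn : 1 ≤ n) {t : OmegaTerm} (ht : t.VarsLE (2 * n)) :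
    (wrap n t).VarsLE (2 * (n + 1)) := by
  have h := prodVars_varsLE (k := 2 * n) (by omega)
  exact ⟨⟨⟨h.mono (by omega), by omega, by omega⟩, ht.mono (by omega)⟩, ⟨by omega, by omega⟩,
    h.mono (by omega)⟩

theorem uTerm_varsLE : ∀ {n : ℕ}, 1 ≤ n → (uTerm n).VarsLE (2 * n)
  | 1, _ => by simp [uTerm, OmegaTerm.VarsLE]
  | n + 2, _ => wrap_varsLE (by omega) (uTerm_varsLE (by omega))

theorem vTerm_varsLE : ∀ {n : ℕ}, 1 ≤ n → (vTerm n).VarsLE (2 * n)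
  | 1, _ => by simp [vTerm, OmegaTerm.VarsLE]
  | n + 2, _ => wrap_varsLE (by omega) (vTerm_varsLE (by omega))

theorem eval_congr {M : Type*} [Monoid M] {m : ℕ} {ρ ρ' : ℕ → M}
    (h : ∀ i, 1 ≤ i → i ≤ m → ρ i = ρ' i) {t : OmegaTerm} (ht : t.VarsLE m) :
    t.eval ρ = t.eval ρ' := by
  induction t with
  | x i => exact h i ht.1 ht.2
  | mul s t hs ht' => simp only [OmegaTerm.eval, hs ht.1, ht' ht.2]
  | omega t ht' => simp only [OmegaTerm.eval, ht' ht]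

theorem evalPow_congr {M : Type*} [Monoid M] {m E : ℕ} {ρ ρ' : ℕ → M}
    (h : ∀ i, 1 ≤ i → i ≤ m → ρ i = ρ' i) {t : OmegaTerm} (ht : t.VarsLE m) :
    t.evalPow E ρ = t.evalPow E ρ' := by
  induction t with
  | x i => exact h i ht.1 ht.2
  | mul s t hs ht' => simp only [OmegaTerm.evalPow, hs ht.1, ht' ht.2]
  | omega t ht' => simp only [OmegaTerm.evalPow, ht' ht]

/-! ### Aperiodicity and the class `DA` -/

section DA

variable {M : Type u} [Monoid M]

theorem Aperiodic.mul_omegaPow (h : Aperiodic M) (x : M) : x * omegaPow x = omegaPow x :=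
  (h fun _ => x).symm

theorem omegaPow_mul_comm [Finite M] (x : M) : omegaPow x * x = x * omegaPow x := by
  obtain ⟨k, h, -⟩ := exists_omegaPow_eq_pow x
  rw [h, ← pow_succ, ← pow_succ']

theorem Aperiodic.omegaPow_mul [Finite M] (h : Aperiodic M) (x : M) :
    omegaPow x * x = omegaPow x := by rw [omegaPow_mul_comm, h.mul_omegaPow]

theorem aperiodic_iff : Aperiodic M ↔ ∀ x : M, x * omegaPow x = omegaPow x :=
  ⟨fun h => h.mul_omegaPow, fun h ρ => (h (ρ 1)).symm⟩

/-- The element `x` is `𝒥`-above `e`. -/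
def Above (e x : M) : Prop := ∃ a b, e = a * x * b

/-- The class `DA` of finite monoids whose regular `𝒥`-classes are aperiodic semigroups. -/
def IsDA (M : Type*) [Monoid M] : Prop :=
  ∀ e x : M, e * e = e → Above e x → e * x * e = e

/-- For an idempotent `e = xy` the hypothesis reads `e (yx)^ω e = e`. This forces `e x e` to be left
invertible relative to `e` whenever `x` is `𝒥`-above `e`, and aperiodicity then gives `e x e = e`.
-/
theorem isDA_of_conjugates [Finite M] (hap : Aperiodic M)
    (hc : ∀ x y : M, omegaPow (x * y) * omegaPow (y * x) * omegaPow (x * y) = omegaPow (x * y)) :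
    IsDA M := by
  have key : ∀ e x y : M, e * e = e → e = x * y → ∃ k, e * (y * x) ^ (k + 2) * e = e := by
    intro e x y he hxy
    obtain ⟨k, hk, -⟩ := exists_omegaPow_eq_pow (y * x)
    refine ⟨k, ?_⟩
    have := hc x y
    rwa [← hxy, omegaPow_of_idem he, hk] at this
  rintro e x he ⟨a, b, hab⟩
  -- The factorization `e = a · xb` puts `e` into `e x M`, say `e = e x z`; the factorization `e =
  -- ex · ze` then puts `e` into `M · e x e`.
  obtain ⟨k, hk⟩ := key e a (x * b) he (by rw [hab, mul_assoc])
  obtain ⟨z, hz⟩ : ∃ z, e = e * x * z := by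
    refine ⟨b * a * (x * b * a) ^ (k + 1) * e, ?_⟩
    rw [pow_succ'] at hk
    simpa only [mul_assoc] using hk.symm
  obtain ⟨l, hl⟩ := key e (e * x) (z * e) he (by
    rw [← mul_assoc, ← hz, he])
  obtain ⟨w, hw⟩ : ∃ w, e = w * (e * x * e) := by
    refine ⟨e * (z * e * (e * x)) ^ (l + 1) * z * e, ?_⟩
    rw [pow_succ] at hl
    simpa only [mul_assoc] using hl.symm
  obtain ⟨N, hN, -⟩ := exists_omegaPow_eq_pow (e * x * e)
  have hc' := hap.omegaPow_mul (e * x * e)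
  set c := e * x * e with hcdef
  have hcl : e * c = c := by rw [hcdef, ← mul_assoc, ← mul_assoc, he]
  -- Iterating `e = w c` writes `e` with any power of `c` on its right; the idempotent power
  -- swallows one more `c`, so `c = e c = e`.
  have hpow : ∀ m, e = w ^ m * e * c ^ m := by
    intro m
    induction m with
    | zero => simp
    | succ m ih =>
      calc e = w * c := hw
        _ = w * (e * c) := by rw [hcl]
        _ = w * (w ^ m * e * c ^ m * c) := by rw [← ih]
        _ = w ^ (m + 1) * e * c ^ (m + 1) := by rw [pow_succ', pow_succ]; simp only [mul_assoc]
  have h2 := hpow (N + 2)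
  rw [hN] at hc'
  calc c = e * c := hcl.symm
    _ = w ^ (N + 2) * e * c ^ (N + 2) * c := congrArg (· * c) h2
    _ = w ^ (N + 2) * e * (c ^ (N + 2) * c) := mul_assoc _ _ _
    _ = e := by rw [hc', ← h2]

theorem eval_prodVars_two {x y : M} : ∀ {k : ℕ}, 2 ≤ k →
    (prodVars k).eval (fun i => if i = 1 then x else if i = 2 then y else 1) = x * y
  | 2, _ => by simp [prodVars, OmegaTerm.eval]
  | k + 3, _ => by
    rw [prodVars, OmegaTerm.eval, eval_prodVars_two (k := k + 2) (by omega)]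
    simp [OmegaTerm.eval]

theorem eval_uTerm_two [Finite M] {x y : M} : ∀ {n : ℕ}, 1 ≤ n →
    (uTerm n).eval (fun i => if i = 1 then x else if i = 2 then y else 1) = omegaPow (x * y)
  | 1, _ => by simp [uTerm, OmegaTerm.eval]
  | n + 2, _ => by
    simp only [uTerm, wrap, OmegaTerm.eval, eval_uTerm_two (n := n + 1) (by omega),
      eval_prodVars_two (k := 2 * (n + 1)) (by omega)]
    simp [omegaPow_idem]

/-- With all variables except `x₁, x₂` set to `1`, every wrapping layer is `(xy)^ω` on both sides,
and all layers beyond the innermost are absorbed by idempotency. -/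
theorem eval_vTerm_two [Finite M] {x y : M} : ∀ {n : ℕ}, 2 ≤ n →
    (vTerm n).eval (fun i => if i = 1 then x else if i = 2 then y else 1) =
      omegaPow (x * y) * omegaPow (y * x) * omegaPow (x * y)
  | 2, _ => by
    simp only [vTerm, wrap, OmegaTerm.eval, eval_prodVars_two (k := 2 * (0 + 1)) (by omega)]
    simp
  | n + 3, _ => by
    rw [vTerm, wrap]
    simp only [OmegaTerm.eval, eval_vTerm_two (n := n + 2) (by omega),
      eval_prodVars_two (k := 2 * (n + 1 + 1)) (by omega)]
    simp only [show (2 * (n + 1 + 1) + 1 = 1) = False by simp,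
      show (2 * (n + 1 + 1) + 1 = 2) = False by simp,
      show (2 * (n + 1 + 1) + 2 = 1) = False by simp,
      show (2 * (n + 1 + 1) + 2 = 2) = False by simp, if_false, mul_one, one_mul]
    simp only [← mul_assoc, omegaPow_idem]
    simp only [mul_assoc, omegaPow_idem]

theorem isDA_of_satisfies [Finite M] (hap : Aperiodic M) {n : ℕ} (hn : 1 ≤ n)
    (h : Satisfies M (uTerm n) (vTerm n)) : IsDA M := by
  refine isDA_of_conjugates hap fun x y => ?_
  have h1 := h fun i => if i = 1 then x else if i = 2 then y else 1
  rw [eval_uTerm_two hn] at h1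
  rcases Nat.lt_or_ge n 2 with h2 | h2
  · obtain rfl : n = 1 := by omega
    have h3 : omegaPow (x * y) = omegaPow (y * x) := by
      simpa [vTerm, OmegaTerm.eval] using h1
    rw [← h3, omegaPow_idem, omegaPow_idem]
  · rw [← eval_vTerm_two h2, ← h1]

/-- As `e x e = e`, the element `e x` is idempotent and `y` is `𝒥`-above it too, so `ex · y · ex =
ex`. Multiplying by `e` on the right leaves `e x y e = e`. -/
theorem IsDA.above_mul (h : IsDA M) {e x y : M} (he : e * e = e) (hx : Above e x)
    (hy : Above e y) : Above e (x * y) := by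
  have h1 := h e x he hx
  have h2 : e * x * (e * x) = e * x := by rw [← mul_assoc, h1]
  have h3 : Above (e * x) y := by
    obtain ⟨a, b, hab⟩ := hy
    exact ⟨a, b * x, by rw [← mul_assoc, ← hab]⟩
  refine ⟨e, e, ?_⟩
  have h4 := congrArg (· * e) (h (e * x) y h2 h3)
  simp only [mul_assoc] at h4 h1 ⊢
  rw [h1] at h4
  exact h4.symm

/-- The submonoid of all elements `𝒥`-above an idempotent in a monoid in `DA`. -/
def aboveSubmonoid (h : IsDA M) {e : M} (he : e * e = e) : Submonoid M where
  carrier := {x | Above e x}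
  one_mem' := ⟨e, 1, by simp⟩
  mul_mem' := h.above_mul he

theorem above_prodVars (h : IsDA M) {e : M} (he : e * e = e) {ρ : ℕ → M} : ∀ {k : ℕ}, 1 ≤ k →
    (∀ i, 1 ≤ i → i ≤ k → Above e (ρ i)) → Above e ((prodVars k).eval ρ)
  | 1, _, hρ => hρ 1 le_rfl le_rfl
  | k + 2, _, hρ => h.above_mul he
      (above_prodVars h he (k := k + 1) (by omega) fun i h1 h2 => hρ i h1 (by omega))
      (hρ _ (by omega) le_rfl)

/-- Substitute `e` and `f` for the two outermost variables. With `P = x₁ ⋯ x₂ₙ`, membership in `DA`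
gives `e P e = e` and `f P f = f`, so `P e` and `f P` are idempotent and the outer `ω`-powers
disappear; multiplying by `e` and `f` removes `P`. This is the passage from level `n + 1` of `M` to
level `n` of its local monoids. -/
theorem idem_mul_eval_mul_idem [Finite M] (hDA : IsDA M) {n : ℕ} (hn : 1 ≤ n)
    (h : Satisfies M (uTerm (n + 1)) (vTerm (n + 1))) {e f : M} (he : e * e = e) (hf : f * f = f)
    (ρ : ℕ → M) (hρ : ∀ i, 1 ≤ i → i ≤ 2 * n → Above e (ρ i) ∧ Above f (ρ i)) :
    e * (uTerm n).eval ρ * f = e * (vTerm n).eval ρ * f := by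
  obtain ⟨m, rfl⟩ := Nat.exists_eq_add_of_le' hn
  set ρ' : ℕ → M := fun i => if i = 2 * (m + 1) + 1 then e else if i = 2 * (m + 1) + 2 then f
    else ρ i with hρ'
  have hag : ∀ i, 1 ≤ i → i ≤ 2 * (m + 1) → ρ' i = ρ i := by
    intro i h1 h2
    simp only [hρ']
    rw [if_neg (by omega), if_neg (by omega)]
  have hP := eval_congr hag (prodVars_varsLE (k := 2 * (m + 1)) (by omega))
  have h1 := h ρ'
  simp only [uTerm, vTerm, wrap, OmegaTerm.eval] at h1
  rw [eval_congr hag (uTerm_varsLE hn), eval_congr hag (vTerm_varsLE hn), hP] at h1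
  have e1 : ρ' (2 * (m + 1) + 1) = e := by simp [hρ']
  have e2 : ρ' (2 * (m + 1) + 2) = f := by simp [hρ']
  rw [e1, e2] at h1
  set P := (prodVars (2 * (m + 1))).eval ρ
  have hPe := hDA e P he (above_prodVars hDA he (by omega) fun i h1 h2 => (hρ i h1 h2).1)
  have hPf := hDA f P hf (above_prodVars hDA hf (by omega) fun i h1 h2 => (hρ i h1 h2).2)
  rw [omegaPow_of_idem (e := P * e) (by rw [mul_assoc, ← mul_assoc e, hPe]),
    omegaPow_of_idem (e := f * P) (by rw [← mul_assoc, hPf])] at h1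
  have h2 := congrArg (fun z => e * z * f) h1
  simp only [← mul_assoc, hPe] at h2
  simp only [mul_assoc] at h2 hPf
  rw [hPf] at h2
  simpa only [mul_assoc] using h2

end DA

/-! ### The class `J` -/

theorem satisfies_of_le {M : Type u} [Monoid M] {n m : ℕ} (hn : 1 ≤ n) (hnm : n ≤ m)
    (h : Satisfies M (uTerm n) (vTerm n)) : Satisfies M (uTerm m) (vTerm m) := by
  induction m, hnm using Nat.le_induction with
  | base => exact h
  | succ m hm ih =>
    obtain ⟨k, rfl⟩ := Nat.exists_eq_add_of_le' (hn.trans hm)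
    intro ρ
    simp only [uTerm, vTerm, wrap, OmegaTerm.eval, ih ρ]

theorem eq_of_ideal_eq {M : Type u} [Monoid M] (h : classJ M) {s t a b c d : M}
    (h1 : s = a * t * b) (h2 : t = c * s * d) : s = t := by
  refine h.2 s t (Set.ext fun m => ⟨?_, ?_⟩)
  · rintro ⟨p, q, rfl⟩
    exact ⟨p * a, b * q, by rw [h1]; simp only [mul_assoc]⟩
  · rintro ⟨p, q, rfl⟩
    exact ⟨p * c, d * q, by rw [h2]; simp only [mul_assoc]⟩

theorem classJ.aperiodic {M : Type u} [Monoid M] (h : classJ M) : Aperiodic M := by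
  have := h.1
  rw [aperiodic_iff]
  intro x
  obtain ⟨k, hk, hi⟩ := exists_omegaPow_eq_pow x
  refine eq_of_ideal_eq h (a := x) (b := 1) (c := x ^ (k + 1)) (d := 1) (by simp) ?_
  have hi' : omegaPow x * omegaPow x = omegaPow x := hi
  nth_rw 1 [← hi']
  nth_rw 1 [hk]
  rw [pow_succ]
  simp [mul_assoc]

/-- It suffices to treat level `1`: `(xy)^ω` and `(yx)^ω` are factors of each other because
`(xy)^(m+1) = x (yx)^m y`. -/
theorem classJ.satisfies {M : Type u} [Monoid M] (h : classJ M) {n : ℕ} (hn : 1 ≤ n) :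
    Satisfies M (uTerm n) (vTerm n) := by
  refine satisfies_of_le le_rfl hn ?_
  have := h.1
  have key : ∀ x y : M, ∃ a b, omegaPow (x * y) = a * omegaPow (y * x) * b := by
    intro x y
    obtain ⟨l, hl, hi⟩ := exists_omegaPow_eq_pow (x * y)
    have hi' : omegaPow (x * y) * omegaPow (x * y) = omegaPow (x * y) := hi
    obtain ⟨k, hk, -⟩ := exists_omegaPow_eq_pow (y * x)
    have h3 : ∀ m, (x * y) ^ (m + 1) = x * (y * x) ^ m * y := by
      intro m
      induction m with
      | zero => simp
      | succ m ih => rw [pow_succ', ih, pow_succ' _ m]; simp only [mul_assoc]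
    have h4 : omegaPow (x * y) = (x * y) ^ (k + 2 + 1) * omegaPow (x * y) := by
      have : ∀ m, omegaPow (x * y) = (x * y) ^ m * omegaPow (x * y) := by
        intro m
        induction m with
        | zero => simp
        | succ m ih => rw [pow_succ, mul_assoc, h.aperiodic.mul_omegaPow, ← ih]
      exact this _
    refine ⟨x, y * omegaPow (x * y), ?_⟩
    nth_rw 1 [h4]
    rw [h3, hk, mul_assoc _ y]
  intro ρ
  obtain ⟨a, b, h1⟩ := key (ρ 1) (ρ 2)
  obtain ⟨c, d, h2⟩ := key (ρ 2) (ρ 1)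
  exact eq_of_ideal_eq h h1 h2

/-- If `s = a t b` and `t = c s d`, then `s = (ac)^ω s (db)^ω`. Since `(ac)^ω` absorbs `c` and
`(db)^ω = (bd)^ω` absorbs `d`, it follows that `t = c s d = s`. -/
theorem classJ_of_satisfies {M : Type u} [Monoid M] [Finite M] (hap : Aperiodic M)
    (h : Satisfies M (uTerm 1) (vTerm 1)) : classJ M := by
  have h' : ∀ x y : M, omegaPow (x * y) = omegaPow (y * x) := fun x y => by
    simpa [uTerm, vTerm, OmegaTerm.eval] using h fun i => if i = 1 then x else y
  -- With `e = (ac)^ω = (ca)^ω`, the shift `c (ac)^ω = (ca)^ω c` says that `c` commutes with `e`,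
  -- and `e c a = e` by aperiodicity. Hence `e = (ec)^m e a^m` for all `m`, and aperiodicity of `ec`
  -- yields `e c = e`.
  have abs : ∀ a c : M, c * omegaPow (a * c) = omegaPow (a * c) ∧
      omegaPow (a * c) * c = omegaPow (a * c) := by
    intro a c
    have hi := omegaPow_idem (a * c)
    have h3 : c * omegaPow (a * c) = omegaPow (c * a) * c := by
      have hE := isExponent_factorial (M := M) le_rfl
      rw [hE.omegaPow_eq, hE.omegaPow_eq]
      generalize (Nat.card M + 2).factorial = E
      induction E with
      | zero => simp
      | succ m ih => rw [pow_succ, ← mul_assoc, ih, pow_succ]; simp only [mul_assoc]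
    have h4 := hap.omegaPow_mul (c * a)
    rw [← h' a c] at h3 h4
    set e := omegaPow (a * c)
    have hecc : e * c * e = e * c := by rw [mul_assoc, h3, ← mul_assoc, hi]
    have hpow : ∀ m, e = (e * c) ^ m * e * a ^ m := by
      intro m
      induction m with
      | zero => simp
      | succ m ih =>
        calc e = e * (c * a) := h4.symm
          _ = e * c * a := by rw [mul_assoc]
          _ = c * e * a := by rw [h3]
          _ = c * ((e * c) ^ m * e * a ^ m) * a := by rw [← ih]
          _ = (e * c) ^ (m + 1) * e * a ^ (m + 1) := by
            have h5 : c * ((e * c) ^ m * e) = (e * c) ^ (m + 1) * e := by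
              have h6 : ∀ j, (e * c) ^ j * e = e * ((e * c) ^ j * e) := by
                intro j
                cases j with
                | zero => simp [hi]
                | succ j => rw [pow_succ']; simp only [← mul_assoc, hi]
              rw [h6, ← mul_assoc, h3, pow_succ', mul_assoc (e * c)]
            rw [pow_succ a, ← h5]
            simp only [mul_assoc]
    have hec : e * c = e := by
      obtain ⟨N, hN, -⟩ := exists_omegaPow_eq_pow (e * c)
      have h7 := hap.mul_omegaPow (e * c)
      rw [hN] at h7
      calc e * c = e * c * e := hecc.symm
        _ = (e * c) * ((e * c) ^ (N + 2) * e * a ^ (N + 2)) := by rw [← hpow]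
        _ = ((e * c) * (e * c) ^ (N + 2)) * e * a ^ (N + 2) := by simp only [mul_assoc]
        _ = e := by rw [h7, ← hpow]
    exact ⟨h3.trans hec, hec⟩
  refine ⟨inferInstance, fun s t hst => ?_⟩
  obtain ⟨a, b, h1⟩ : ∃ a b, s = a * t * b := by
    have : s ∈ {m : M | ∃ a b, m = a * s * b} := ⟨1, 1, by simp⟩
    rwa [hst] at this
  obtain ⟨c, d, h2⟩ : ∃ a b, t = a * s * b := by
    have : t ∈ {m : M | ∃ a b, m = a * t * b} := ⟨1, 1, by simp⟩
    rwa [← hst] at this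
  have h3 : ∀ m, s = (a * c) ^ m * s * (d * b) ^ m := by
    intro m
    induction m with
    | zero => simp
    | succ m ih =>
      rw [pow_succ (a * c), pow_succ' (d * b)]
      calc s = (a * c) ^ m * s * (d * b) ^ m := ih
        _ = (a * c) ^ m * (a * (c * s * d) * b) * (d * b) ^ m := by rw [← h2, ← h1]
        _ = _ := by simp only [mul_assoc]
  have hE := isExponent_factorial (M := M) le_rfl
  have h4 := h3 (Nat.card M + 2).factorial
  rw [← hE.omegaPow_eq, ← hE.omegaPow_eq] at h4
  have h5 := (abs a c).1
  have h6 := (abs b d).2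
  rw [h' b d] at h6
  calc s = omegaPow (a * c) * s * omegaPow (d * b) := h4
    _ = c * (omegaPow (a * c) * s * omegaPow (d * b)) * d := by
      rw [← mul_assoc, ← mul_assoc, h5, mul_assoc _ _ d, h6]
    _ = t := by rw [← h4, ← h2]

/-! ### Closure properties of identities -/

section Closure

theorem Satisfies.of_injective {M N : Type*} [Monoid M] [Monoid N] [Finite M] {s t : OmegaTerm}
    (h : Satisfies N s t) (f : M →* N) (hf : Function.Injective f) : Satisfies M s t := by
  intro ρ
  apply hf
  rw [map_eval, map_eval, h]

theorem Satisfies.of_surjective {M N : Type*} [Monoid M] [Monoid N] [Finite M] {s t : OmegaTerm}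
    (h : Satisfies M s t) (f : M →* N) (hf : Function.Surjective f) : Satisfies N s t := by
  intro ρ
  choose g hg using fun i => hf (ρ i)
  obtain rfl : (fun i => f (g i)) = ρ := funext hg
  rw [← map_eval, ← map_eval, h]

theorem Satisfies.pi {ι : Type*} {M : ι → Type*} [∀ i, Monoid (M i)] [Finite (∀ i, M i)]
    {s t : OmegaTerm} (h : ∀ i, Satisfies (M i) s t) : Satisfies (∀ i, M i) s t := by
  intro ρ
  funext i
  have h1 := map_eval (Pi.evalMonoidHom M i) ρ s
  have h2 := map_eval (Pi.evalMonoidHom M i) ρ t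
  simp only [Pi.evalMonoidHom_apply] at h1 h2
  rw [h1, h2, h i]

theorem Satisfies.prod {M N : Type*} [Monoid M] [Monoid N] [Finite M] [Finite N]
    {s t : OmegaTerm} (hM : Satisfies M s t) (hN : Satisfies N s t) : Satisfies (M × N) s t := by
  intro ρ
  have h1 := map_eval (MonoidHom.fst M N) ρ s
  have h2 := map_eval (MonoidHom.fst M N) ρ t
  have h3 := map_eval (MonoidHom.snd M N) ρ s
  have h4 := map_eval (MonoidHom.snd M N) ρ t
  simp only [MonoidHom.coe_fst, MonoidHom.coe_snd] at h1 h2 h3 h4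
  exact Prod.ext (by rw [h1, h2, hM]) (by rw [h3, h4, hN])

/-- The pair of identities `x^ω = x x^ω` and `uₙ = vₙ`. -/
def LevelIdentities (n : ℕ) (M : Type*) [Monoid M] : Prop :=
  Aperiodic M ∧ Satisfies M (uTerm n) (vTerm n)

variable {n : ℕ}

theorem LevelIdentities.of_injective {M N : Type*} [Monoid M] [Monoid N] [Finite M]
    (h : LevelIdentities n N) (f : M →* N) (hf : Function.Injective f) : LevelIdentities n M :=
  ⟨Satisfies.of_injective h.1 f hf, h.2.of_injective f hf⟩

theorem LevelIdentities.of_surjective {M N : Type*} [Monoid M] [Monoid N] [Finite M]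
    (h : LevelIdentities n M) (f : M →* N) (hf : Function.Surjective f) : LevelIdentities n N :=
  ⟨Satisfies.of_surjective h.1 f hf, h.2.of_surjective f hf⟩

theorem LevelIdentities.pi {ι : Type*} {M : ι → Type*} [∀ i, Monoid (M i)] [Finite (∀ i, M i)]
    (h : ∀ i, LevelIdentities n (M i)) : LevelIdentities n (∀ i, M i) :=
  ⟨Satisfies.pi fun i => (h i).1, Satisfies.pi fun i => (h i).2⟩

theorem LevelIdentities.prod {M N : Type*} [Monoid M] [Monoid N] [Finite M] [Finite N]
    (hM : LevelIdentities n M) (hN : LevelIdentities n N) : LevelIdentities n (M × N) :=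
  ⟨Satisfies.prod hM.1 hN.1, hM.2.prod hN.2⟩

theorem LevelIdentities.isDA {M : Type*} [Monoid M] [Finite M] (hn : 1 ≤ n)
    (h : LevelIdentities n M) : IsDA M := isDA_of_satisfies h.1 hn h.2

theorem classJ.levelIdentities {M : Type u} [Monoid M] (h : classJ M) (hn : 1 ≤ n) :
    LevelIdentities n M := ⟨h.aperiodic, h.satisfies hn⟩

end Closure

/-! ### Values of the transduction in context -/

section Transduction

variable {A N K : Type u} [Monoid N] [Monoid K]

/-- The transduction of `w` when it is read between words of values `p` and `q`. -/
def transduceIn (ψ : FreeMonoid A →* N) (p q : N) (w : FreeMonoid A) : FreeMonoid (N × A × N) :=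
  FreeMonoid.ofList ((transduceFrom ψ p w.toList).map (translate 1 q))

theorem translate_comp (q r : N) :
    (translate 1 q : N × A × N → N × A × N) ∘ translate 1 r = translate 1 (r * q) := by
  funext σ
  simp [translate, mul_assoc]

theorem translate_one_one : (translate 1 1 : N × A × N → N × A × N) = id := by
  funext σ
  simp [translate]

theorem transduceIn_one (ψ : FreeMonoid A →* N) (p q : N) : transduceIn ψ p q 1 = 1 := rfl

theorem transduceIn_mul (ψ : FreeMonoid A →* N) (p q : N) (v w : FreeMonoid A) :
    transduceIn ψ p q (v * w) = transduceIn ψ p (ψ w * q) v * transduceIn ψ (p * ψ v) q w := by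
  rw [transduceIn, FreeMonoid.toList_mul, transduceFrom_append, List.map_append, List.map_map,
    translate_comp]
  rfl

theorem transduceIn_of (ψ : FreeMonoid A →* N) (p q : N) (a : A) :
    transduceIn ψ p q (FreeMonoid.of a) = FreeMonoid.of (p, a, q) := by
  simp [transduceIn, transduceFrom, translate]

theorem transduce_eq_transduceIn (ψ : FreeMonoid A →* N) (w : FreeMonoid A) :
    transduce ψ w = transduceIn ψ 1 1 w := by
  rw [transduceIn, translate_one_one, List.map_id]
  rfl

/-- The words which are absorbed by `p` on the left and by `q` on the right. -/
def absorbed (ψ : FreeMonoid A →* N) (p q : N) : Submonoid (FreeMonoid A) where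
  carrier := {w | p * ψ w = p ∧ ψ w * q = q}
  one_mem' := by simp
  mul_mem' := by
    rintro v w ⟨h1, h2⟩ ⟨h3, h4⟩
    exact ⟨by rw [map_mul, ← mul_assoc, h1, h3], by rw [map_mul, mul_assoc, h4, h2]⟩

/-- On absorbed words, the value of the transduction is multiplicative. -/
def localHom (ψ : FreeMonoid A →* N) (h : FreeMonoid (N × A × N) →* K) (p q : N) :
    absorbed ψ p q →* K where
  toFun w := h (transduceIn ψ p q w)
  map_one' := by simp [transduceIn_one]
  map_mul' v w := by
    rw [Submonoid.coe_mul, transduceIn_mul, map_mul, w.2.2, v.2.1]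

theorem transduceIn_context {ψ : FreeMonoid A →* N} {p q : N} {X Y : FreeMonoid A} (hX : ψ X = p)
    (hY : ψ Y = q) (m : absorbed ψ p q) :
    transduce ψ (X * m * Y) = transduceIn ψ 1 q X * transduceIn ψ p q m * transduceIn ψ p 1 Y := by
  rw [transduce_eq_transduceIn, transduceIn_mul, transduceIn_mul, map_mul, hX, hY, one_mul, one_mul,
    m.2.1, mul_one, m.2.2]

/-- An absorbed word leaves the transduction of its context unchanged, so exchanging absorbed words
with the same local value is invisible to both `ψ` and `h`. -/
theorem map_context_eq {M : Type*} [Monoid M] {φ : FreeMonoid A →* M} {ψ : FreeMonoid A →* N}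
    {h : FreeMonoid (N × A × N) →* K}
    (H : ∀ v w : FreeMonoid A, ψ v = ψ w → h (transduce ψ v) = h (transduce ψ w) → φ v = φ w)
    {p q : N} {X Y : FreeMonoid A} (hX : ψ X = p) (hY : ψ Y = q) (m m' : absorbed ψ p q)
    (hm : localHom ψ h p q m = localHom ψ h p q m') : φ (X * m * Y) = φ (X * m' * Y) := by
  have hm' : h (transduceIn ψ p q m) = h (transduceIn ψ p q m') := hm
  apply H
  · simp only [map_mul, hX, hY]
    rw [m.2.1, m'.2.1]
  · rw [transduceIn_context hX hY, transduceIn_context hX hY]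
    simp only [map_mul, hm']

end Transduction

/-! ### Monoids in the two-sided product satisfy the identities -/

section Sound

theorem Above.left {M : Type u} [Monoid M] {e x y : M} (h : Above e (x * y)) : Above e x := by
  obtain ⟨a, b, hab⟩ := h
  exact ⟨a, y * b, by rw [hab]; simp only [mul_assoc]⟩

theorem Above.right {M : Type u} [Monoid M] {e x y : M} (h : Above e (x * y)) : Above e y := by
  obtain ⟨a, b, hab⟩ := h
  exact ⟨a * x, b, by rw [hab]; simp only [mul_assoc]⟩

theorem above_pow {M : Type u} [Monoid M] (x : M) {E : ℕ} (hE : 1 < E) : Above (x ^ E) x := by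
  obtain ⟨k, rfl⟩ := Nat.exists_eq_add_of_le' (show 2 ≤ E from hE)
  exact ⟨1, x ^ (k + 1), by rw [one_mul, ← pow_succ']⟩

theorem above_var_of_above_prodVars {M : Type u} [Monoid M] {e : M} {E : ℕ} {ρ : ℕ → M} :
    ∀ {k : ℕ}, Above e ((prodVars k).evalPow E ρ) → ∀ i, 1 ≤ i → i ≤ k → Above e (ρ i)
  | 0, _, i, h1, h2 => by omega
  | 1, h, i, h1, h2 => by
    obtain rfl : i = 1 := by omega
    exact h
  | k + 2, h, i, h1, h2 => by
    rcases Nat.lt_or_ge i (k + 2) with h3 | h3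
    · exact above_var_of_above_prodVars (k := k + 1) h.left i h1 (by omega)
    · obtain rfl : i = k + 2 := by omega
      exact h.right

/-- `𝒥`-trivial monoids lie in `DA`, so `e x e = e`; then `e x`, `x e` and `e` generate the same
ideal and coincide. -/
theorem classJ.absorb {N : Type u} [Monoid N] (hN : classJ N) {e x : N} (he : e * e = e)
    (hx : Above e x) : e * x = e ∧ x * e = e := by
  have := hN.1
  have h := (hN.levelIdentities le_rfl).isDA le_rfl e x he hx
  exact ⟨eq_of_ideal_eq hN (a := 1) (b := x) (c := 1) (d := e) (by simp) (by simp [h]),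
    eq_of_ideal_eq hN (a := x) (b := 1) (c := e) (d := 1) (by simp) (by simp [← mul_assoc, h])⟩

/-- The variables lie above the idempotents `ψ(X)^E` and `ψ(Y)^E`, hence are absorbed by both. So
the inner terms are evaluated inside the monoid of absorbed words, where `localHom` transports the
identity from `K`. -/
theorem eq_of_localHom_eq_pow {A M N K : Type u} [Monoid M] [Monoid N] [Monoid K]
    (hN : classJ N) {φ : FreeMonoid A →* M} {ψ : FreeMonoid A →* N}
    {h : FreeMonoid (N × A × N) →* K}
    (H : ∀ v w : FreeMonoid A, ψ v = ψ w → h (transduce ψ v) = h (transduce ψ w) → φ v = φ w)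
    {E m : ℕ} (hEN : IsExponent N E) (hEK : IsExponent K E) {X Y : FreeMonoid A}
    {ρ : ℕ → FreeMonoid A} (hX : ∀ i, 1 ≤ i → i ≤ m → Above (ψ X ^ E) (ψ (ρ i)))
    (hY : ∀ i, 1 ≤ i → i ≤ m → Above (ψ Y ^ E) (ψ (ρ i))) {s t : OmegaTerm}
    (hs : s.VarsLE m) (ht : t.VarsLE m) (hst : Satisfies K s t) :
    φ (X ^ E * s.evalPow E ρ * Y ^ E) = φ (X ^ E * t.evalPow E ρ * Y ^ E) := by
  set p := ψ X ^ E with hp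
  set q := ψ Y ^ E with hq
  have hmem : ∀ i, 1 ≤ i → i ≤ m → ρ i ∈ absorbed ψ p q := fun i h1 h2 =>
    ⟨(hN.absorb (hEN.2 _) (hX i h1 h2)).1, (hN.absorb (hEN.2 _) (hY i h1 h2)).2⟩
  classical
  -- Variables beyond `m` need not be absorbed; they do not occur in the terms, so the value `1` is
  -- harmless.
  set ρ' : ℕ → absorbed ψ p q := fun i =>
    if hi : 1 ≤ i ∧ i ≤ m then ⟨ρ i, hmem i hi.1 hi.2⟩ else 1 with hρ'
  have hval : ∀ {r : OmegaTerm}, r.VarsLE m → r.evalPow E ρ = (r.evalPow E ρ' : absorbed ψ p q) := by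
    intro r hr
    have h1 := map_evalPow (absorbed ψ p q).subtype E ρ' r
    rw [Submonoid.subtype_apply] at h1
    rw [h1]
    refine evalPow_congr (fun i h1 h2 => ?_) hr
    simp [hρ', h1, h2]
  rw [hval hs, hval ht]
  refine map_context_eq H (map_pow ψ X E) (map_pow ψ Y E) _ _ ?_
  rw [map_evalPow, map_evalPow, ← hEK.eval_eq, ← hEK.eval_eq, hst]

theorem levelIdentities_of_twoSidedProduct {V : MonoidClass.{u}} {n : ℕ} (hn : 1 ≤ n)
    (hV : ∀ (K : Type u) [Monoid K] [Finite K], V K → LevelIdentities n K)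
    {M : Type u} [Monoid M] (hM : twoSidedProduct V classJ M) : LevelIdentities (n + 1) M := by
  obtain ⟨hfin, A, _, φ, hφ, N, _, K, _, hfN, hfK, hN, hK, ψ, h, H⟩ := hM
  set c := Nat.card M + Nat.card N + Nat.card K
  have hEM := isExponent_factorial (M := M) (c := c) (by omega)
  have hEN := isExponent_factorial (M := N) (c := c) (by omega)
  have hEK := isExponent_factorial (M := K) (c := c) (by omega)
  set E := (c + 2).factorial
  obtain ⟨hKap, hKn⟩ := hV K hK
  have lift : ∀ ρ : ℕ → M, ∃ w : ℕ → FreeMonoid A, ∀ t : OmegaTerm,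
      t.eval ρ = φ (t.evalPow E w) := by
    intro ρ
    choose w hw using fun i => hφ (ρ i)
    refine ⟨w, fun t => ?_⟩
    rw [hEM.eval_eq, map_evalPow]
    simp only [hw]
  constructor
  · intro ρ
    obtain ⟨w, hw⟩ := lift ρ
    -- This only gives `x^E x^E x^E = x^E (x x^E) x^E`; powers of `x` commute and `x^E` is
    -- idempotent in `M`, so the outer factors can be dropped.
    have h1 := eq_of_localHom_eq_pow hN H hEN hEK (m := 1) (X := w 1) (Y := w 1) (ρ := w)
      (fun i h1 h2 => by
        obtain rfl : i = 1 := by omega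
        exact above_pow _ hEN.1)
      (fun i h1 h2 => by
        obtain rfl : i = 1 := by omega
        exact above_pow _ hEN.1) (s := .omega (.x 1)) (t := .mul (.x 1) (.omega (.x 1)))
      (by simp [OmegaTerm.VarsLE]) (by simp [OmegaTerm.VarsLE]) hKap
    rw [hw, hw]
    simp only [OmegaTerm.evalPow, map_mul, map_pow] at h1 ⊢
    have h2 := hEM.2 (φ (w 1))
    have h3 : φ (w 1) * φ (w 1) ^ E = φ (w 1) ^ E * φ (w 1) := by rw [← pow_succ, ← pow_succ']
    rw [h3, h2, h2, ← mul_assoc, h2, mul_assoc, h3, ← mul_assoc, h2] at h1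
    rw [h3, ← h1]
  · intro ρ
    obtain ⟨w, hw⟩ := lift ρ
    obtain ⟨k, rfl⟩ := Nat.exists_eq_add_of_le' hn
    rw [hw, hw]
    simp only [uTerm, vTerm, wrap, OmegaTerm.evalPow]
    -- `X` and `Y` are the bases of the two outer `ω`-powers, and each inner variable is a factor of
    -- both.
    refine eq_of_localHom_eq_pow hN H hEN hEK (m := 2 * (k + 1)) (fun i h1 h2 => ?_)
      (fun i h1 h2 => ?_) (uTerm_varsLE hn) (vTerm_varsLE hn) hKn
    · have := above_pow (ψ ((prodVars (2 * (k + 1))).evalPow E w * w (2 * (k + 1) + 1))) hEN.1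
      rw [map_mul, map_evalPow] at this
      rw [map_mul, map_evalPow]
      exact above_var_of_above_prodVars this.left i h1 h2
    · have := above_pow (ψ (w (2 * (k + 1) + 2) * (prodVars (2 * (k + 1))).evalPow E w)) hEN.1
      rw [map_mul, map_evalPow] at this
      rw [map_mul, map_evalPow]
      exact above_var_of_above_prodVars this.right i h1 h2

end Sound

/-! ### The subword congruence -/

section Subword

variable {A : Type*}

/-- The words `u` and `v` have the same subwords of length at most `k`. -/
def SubEq (k : ℕ) (u v : List A) : Prop :=
  ∀ l : List A, l.length ≤ k → (l.Sublist u ↔ l.Sublist v)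

theorem SubEq.refl (k : ℕ) (u : List A) : SubEq k u u := fun _ _ => Iff.rfl

theorem SubEq.symm {k : ℕ} {u v : List A} (h : SubEq k u v) : SubEq k v u :=
  fun l hl => (h l hl).symm

theorem SubEq.trans {k : ℕ} {u v w : List A} (h : SubEq k u v) (h' : SubEq k v w) : SubEq k u w :=
  fun l hl => (h l hl).trans (h' l hl)

theorem SubEq.mono {k m : ℕ} (hkm : k ≤ m) {u v : List A} (h : SubEq m u v) : SubEq k u v :=
  fun l hl => h l (hl.trans hkm)

theorem SubEq.append {k : ℕ} {u v u' v' : List A} (h : SubEq k u v) (h' : SubEq k u' v') :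
    SubEq k (u ++ u') (v ++ v') := by
  intro l hl
  simp only [List.sublist_append_iff]
  constructor
  · rintro ⟨l1, l2, rfl, h1, h2⟩
    rw [List.length_append] at hl
    exact ⟨l1, l2, rfl, (h l1 (by omega)).1 h1, (h' l2 (by omega)).1 h2⟩
  · rintro ⟨l1, l2, rfl, h1, h2⟩
    rw [List.length_append] at hl
    exact ⟨l1, l2, rfl, (h l1 (by omega)).2 h1, (h' l2 (by omega)).2 h2⟩

theorem SubEq.reverse {k : ℕ} {u v : List A} (h : SubEq k u v) : SubEq k u.reverse v.reverse := by
  intro l hl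
  rw [← List.reverse_reverse l, List.reverse_sublist, List.reverse_sublist]
  exact h l.reverse (by simpa using hl)

/-- The congruence of having the same subwords of length at most `k`. -/
def subCon (A : Type*) (k : ℕ) : Con (FreeMonoid A) where
  r u v := SubEq k u.toList v.toList
  iseqv := ⟨fun _ => SubEq.refl _ _, fun h => h.symm, fun h h' => h.trans h'⟩
  mul' h h' := by
    simp only [FreeMonoid.toList_mul]
    exact h.append h'

/-- The monoid of words modulo equality of subwords of length at most `k`. -/
abbrev SubQuot (A : Type*) (k : ℕ) := (subCon A k).Quotient

/-- The projection of words to classes. -/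
abbrev subMk (A : Type*) (k : ℕ) : FreeMonoid A →* SubQuot A k := (subCon A k).mk'

theorem subMk_eq_iff {k : ℕ} {u v : FreeMonoid A} :
    subMk A k u = subMk A k v ↔ SubEq k u.toList v.toList := (subCon A k).eq

instance [Finite A] (k : ℕ) : Finite (SubQuot A k) := by
  have := List.finite_length_le A k
  have : Finite {l : List A // l.length ≤ k} := this
  refine Finite.of_injective (β := Set {l : List A // l.length ≤ k})
    (fun q => Con.liftOn q (fun u => {l | l.1.Sublist u.toList}) ?_) ?_
  · intro u v h
    ext l
    exact h l.1 l.2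
  · intro q q'
    refine Con.induction_on₂ q q' fun u v h => ?_
    refine (subCon A k).eq.2 fun l hl => ?_
    exact Set.ext_iff.1 h ⟨l, hl⟩

theorem sublist_mul_mul (a u b : FreeMonoid A) : u.toList.Sublist (a * u * b).toList := by
  rw [FreeMonoid.toList_mul, FreeMonoid.toList_mul]
  exact (List.sublist_append_right _ _).trans (List.sublist_append_left _ _)

/-- If `u` is congruent to `a v b`, every short subword of `v` is one of `u`; so classes that are
factors of each other have the same short subwords. -/
theorem classJ_subQuot {A : Type u} [Finite A] (k : ℕ) : classJ (SubQuot A k) := by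
  refine ⟨inferInstance, fun s t => ?_⟩
  refine Con.induction_on₂ s t fun u v h => ?_
  have key : ∀ u v : FreeMonoid A, {m | ∃ a b : SubQuot A k, m = a * (u : SubQuot A k) * b} ⊆
      {m | ∃ a b : SubQuot A k, m = a * (v : SubQuot A k) * b} →
      ∀ l : List A, l.length ≤ k → l.Sublist v.toList → l.Sublist u.toList := by
    intro u v h l hl hlv
    obtain ⟨a, b, hab⟩ := h (show (u : SubQuot A k) ∈ _ from ⟨1, 1, by simp⟩)
    revert hab
    refine Con.induction_on₂ a b fun a b hab => ?_
    have hab' : subMk A k u = subMk A k (a * v * b) := hab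
    exact (subMk_eq_iff.1 hab' l hl).2 (hlv.trans (sublist_mul_mul a v b))
  exact (subCon A k).eq.2 fun l hl => ⟨key v u h.ge l hl, key u v h.le l hl⟩

/-- Without repetitions a word is a linear order on its letters, and subwords of length at most `2`
reveal the letters and the order of each pair. -/
theorem eq_of_nodup_of_subEq {x y : List A} (hx : x.Nodup) (hy : y.Nodup) (h : SubEq 2 x y) :
    x = y := by
  induction x generalizing y with
  | nil =>
    cases y with
    | nil => rfl
    | cons b y => simpa using (h [b] (by simp)).2 (by simp)
  | cons a x ih =>
    cases y with
    | nil => simpa using (h [a] (by simp)).1 (by simp)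
    | cons b y =>
      rw [List.nodup_cons] at hx hy
      have hab : a = b := by
        by_contra hab
        have h1 : a ∈ y := by
          have := (h [a] (by simp)).1 (by simp)
          rw [List.singleton_sublist] at this
          exact (List.mem_cons.1 this).resolve_left hab
        have h2 : [b, a].Sublist (a :: x) := (h [b, a] (by simp)).2 (by simpa using h1)
        rw [List.sublist_cons_iff] at h2
        rcases h2 with h2 | ⟨r, hr, -⟩
        · exact hx.1 (h2.subset (by simp))
        · exact hab (List.cons.inj hr).1.symm
      subst hab
      rw [ih hx.2 hy.2]
      intro l hl
      -- The common first letter can be cancelled: it does not recur, so the subwords of the tail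
      -- are the subwords of the whole that avoid it.
      have key : ∀ z : List A, a ∉ z → (l.Sublist z ↔ l.Sublist (a :: z) ∧ a ∉ l) := by
        intro z hz
        refine ⟨fun hlz => ⟨hlz.cons _, fun ha => hz (hlz.subset ha)⟩, fun ⟨h1, h2⟩ => ?_⟩
        rw [List.sublist_cons_iff] at h1
        rcases h1 with h1 | ⟨r, rfl, -⟩
        · exact h1
        · simp at h2
      rw [key x hx.1, key y hy.1, h l hl]

end Subword

/-! ### Descents in the `ℛ`-order -/

section Descents

variable {A M : Type*} [Monoid M]

open Classical in
/-- The letters of `u` at which the value strictly `ℛ`-descends, when starting from `s`. -/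
noncomputable def descents (f : A → M) : M → List A → List A
  | _, [] => []
  | s, a :: u => if ∃ z, s * f a * z = s then descents f (s * f a) u
    else a :: descents f (s * f a) u

/-- At every descent the right ideal generated by the current value strictly shrinks, and elsewhere
it does not grow. -/
theorem length_descents_le [Finite M] (f : A → M) (s : M) (u : List A) :
    (descents f s u).length ≤ Nat.card M := by
  have key : (descents f s u).length + {x | ∃ z, x = s * (u.map f).prod * z}.ncard ≤
      {x | ∃ z, x = s * z}.ncard := by
    induction u generalizing s with
    | nil => simp [descents]
    | cons a u ih =>
      have h1 := ih (s * f a)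
      rw [List.map_cons, List.prod_cons, ← mul_assoc]
      have hsub : {x | ∃ z, x = s * f a * z} ⊆ {x | ∃ z, x = s * z} := by
        rintro _ ⟨z, rfl⟩
        exact ⟨f a * z, by rw [mul_assoc]⟩
      rw [descents]
      split_ifs with h
      · exact h1.trans (Set.ncard_le_ncard hsub)
      · have : {x | ∃ z, x = s * f a * z}.ncard < {x | ∃ z, x = s * z}.ncard := by
          refine Set.ncard_lt_ncard ⟨hsub, fun hsup => h ?_⟩
          obtain ⟨z, hz⟩ := hsup ⟨1, (mul_one s).symm⟩
          exact ⟨z, hz.symm⟩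
        rw [List.length_cons]
        omega
  have := Set.ncard_le_card {x : M | ∃ z, x = s * z}
  omega

theorem descents_sublist (f : A → M) (s : M) (u : List A) : (descents f s u).Sublist u := by
  induction u generalizing s with
  | nil => simp [descents]
  | cons a u ih =>
    rw [descents]
    split_ifs
    · exact (ih _).cons _
    · exact (ih _).cons_cons _

/-- In `DA`, an element that is `ℛ`-stable under `x` and `y` is stable under `x y`. -/
theorem IsDA.stable_mul [Finite M] (h : IsDA M) {s x y : M} (hx : ∃ z, s * x * z = s)
    (hy : ∃ z, s * y * z = s) : ∃ z, s * x * y * z = s * x := by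
  obtain ⟨z, hz⟩ := hx
  obtain ⟨z', hz'⟩ := hy
  -- The element `z y z' x` is a loop at `s x`: it returns to `s`, reads `y`, returns to `s` and
  -- reads `x`. Its idempotent power `e` fixes `s x` and lies below `y`, so `e y e = e` gives `s x ·
  -- y · e = s x`.
  obtain ⟨k, hk, hi⟩ := exists_omegaPow_eq_pow (z * y * z' * x)
  set g := z * y * z' * x with hg
  set e := omegaPow g
  have h1 : s * x * g = s * x := by
    calc s * x * g = s * x * z * y * z' * x := by rw [hg]; simp only [mul_assoc]
      _ = s * x := by rw [hz, hz']
  have h2 : s * x * e = s * x := by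
    rw [hk]
    have : ∀ m, s * x * g ^ m = s * x := by
      intro m
      induction m with
      | zero => simp
      | succ m ih => rw [pow_succ, ← mul_assoc, ih, h1]
    exact this _
  have h3 : Above e y := ⟨z, z' * x * g ^ (k + 1), by
    rw [hk, pow_succ' g (k + 1)]
    nth_rw 1 [hg]
    simp only [mul_assoc]⟩
  refine ⟨e, ?_⟩
  have h4 := h e y hi h3
  rw [← h2, mul_assoc (s * x), mul_assoc (s * x), h4]

/-- Up to the first descent the value stays in the `ℛ`-class of `s`. In `DA` a letter that is stable
at `s` remains stable along this class, so the letter of the first descent already descends at `s`.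
-/
theorem not_stable_of_descents_eq_cons [Finite M] (h : IsDA M) {f : A → M} {s : M} {u : List A}
    {a : A} {c : List A} (hc : descents f s u = a :: c) : ¬ ∃ z, s * f a * z = s := by
  induction u generalizing s with
  | nil => simp [descents] at hc
  | cons b u ih =>
    rw [descents] at hc
    split_ifs at hc with hb
    · exact fun ha => ih hc (h.stable_mul hb ha)
    · rw [(List.cons.inj hc).1] at hb
      exact hb

/-- A descent letter cannot occur earlier in the `ℛ`-class that it leaves, so any embedding of the
descents needs all of them to have taken place. Hence `b` occurs in the last `ℛ`-class, where one
can go back and read it again. -/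
theorem exists_absorb_of_sublist [Finite M] (h : IsDA M) {f : A → M} {s : M} {u : List A} {b : A}
    (hb : (descents f s u ++ [b]).Sublist u) :
    ∃ x y, s * (u.map f).prod * (x * f b * y) = s * (u.map f).prod := by
  induction u generalizing s with
  | nil => simp [descents] at hb
  | cons a u ih =>
    rw [List.map_cons, List.prod_cons, ← mul_assoc]
    rw [descents] at hb
    split_ifs at hb with ha
    · rw [List.sublist_cons_iff] at hb
      rcases hb with hb | ⟨r, hr, -⟩
      · exact ih hb
      · cases hc : descents f (s * f a) u with
        | cons a' c =>
          rw [hc] at hr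
          obtain rfl : a' = a := (List.cons.inj hr).1
          exact absurd (h.stable_mul ha ha) (not_stable_of_descents_eq_cons h hc)
        | nil =>
          rw [hc] at hr
          obtain rfl : b = a := (List.cons.inj hr).1
          obtain ⟨z, hz⟩ := ha
          have hstab : ∀ (t : M) (w : List A), descents f t w = [] →
              ∃ z, t * (w.map f).prod * z = t := by
            intro t w hw
            induction w generalizing t with
            | nil => exact ⟨1, by simp⟩
            | cons d w ihw =>
              rw [descents] at hw
              split_ifs at hw with hd
              obtain ⟨z1, hz1⟩ := ihw _ hw
              obtain ⟨z2, hz2⟩ := hd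
              exact ⟨z1 * z2, by rw [List.map_cons, List.prod_cons, ← mul_assoc, ← mul_assoc, hz1,
                hz2]⟩
          obtain ⟨z', hz'⟩ := hstab _ _ hc
          -- No descent remains: `z'` leads from the end back to just after this `b` and `z` to just
          -- before it; then `b` and the rest are read again.
          refine ⟨z' * z, (u.map f).prod, ?_⟩
          calc s * f b * (u.map f).prod * (z' * z * f b * (u.map f).prod)
              = (s * f b * (u.map f).prod * z') * z * f b * (u.map f).prod := by
                simp only [mul_assoc]
            _ = s * f b * (u.map f).prod := by rw [hz', hz]
    · rw [List.cons_append, List.cons_sublist_cons] at hb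
      exact ih hb

/-- The descents of `u` followed by `b` form a subword of `u b` of length at most `|M| + 1`, hence
of `u`, so the value of `u` absorbs some `x f(b) y`. The idempotent is the `ω`-power of the product
of these elements over all `b`. -/
theorem exists_idem_right [Finite A] [Finite M] (hDA : IsDA M) (f : A → M) {k : ℕ}
    (hk : Nat.card M + 1 ≤ k) (u : List A) (B : Set A) (hB : ∀ b ∈ B, SubEq k (u ++ [b]) u) :
    ∃ e : M, e * e = e ∧ (u.map f).prod * e = (u.map f).prod ∧ ∀ b ∈ B, Above e (f b) := by
  have h1 : ∀ b ∈ B, ∃ g, (u.map f).prod * g = (u.map f).prod ∧ Above g (f b) := by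
    intro b hb
    have hlen := length_descents_le f 1 u
    obtain ⟨x, y, hxy⟩ := exists_absorb_of_sublist hDA
      (((hB b hb) (descents f 1 u ++ [b]) (by simp; omega)).1 ((descents_sublist f 1 u).append_right [b]))
    rw [one_mul] at hxy
    exact ⟨x * f b * y, hxy, x, y, rfl⟩
  have h2 : ∀ F : Set A, F.Finite → F ⊆ B →
      ∃ g, (u.map f).prod * g = (u.map f).prod ∧ ∀ b ∈ F, Above g (f b) := by
    intro F hF
    induction F, hF using Set.Finite.induction_on with
    | empty => exact fun _ => ⟨1, by simp⟩
    | @insert a F' _ _ ih =>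
      intro hFB
      rw [Set.insert_subset_iff] at hFB
      obtain ⟨g, hg1, hg2⟩ := ih hFB.2
      obtain ⟨g', hg1', p, q, rfl⟩ := h1 _ hFB.1
      refine ⟨g * (p * f a * q), by rw [← mul_assoc, hg1, hg1'], fun b hb => ?_⟩
      rcases hb with rfl | hb
      · exact ⟨g * p, q, by simp only [mul_assoc]⟩
      · obtain ⟨p', q', hpq⟩ := hg2 b hb
        exact ⟨p', q' * (p * f a * q), by rw [hpq]; simp only [mul_assoc]⟩
  obtain ⟨g, hg1, hg2⟩ := h2 B B.toFinite le_rfl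
  obtain ⟨m, hm, hi⟩ := exists_omegaPow_eq_pow g
  refine ⟨omegaPow g, hi, ?_, fun b hb => ?_⟩
  · rw [hm]
    generalize m + 2 = j
    induction j with
    | zero => simp
    | succ j ih => rw [pow_succ, ← mul_assoc, ih, hg1]
  · obtain ⟨p, q, hpq⟩ := hg2 b hb
    refine ⟨p, q * g ^ (m + 1), ?_⟩
    rw [hm, pow_succ', ← mul_assoc, ← hpq]

theorem IsDA.mulOpposite (h : IsDA M) : IsDA Mᵐᵒᵖ := by
  rintro e x he ⟨a, b, hab⟩
  have h1 := h e.unop x.unop (by rw [← MulOpposite.unop_mul, he])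
    ⟨b.unop, a.unop, by rw [hab]; simp [mul_assoc]⟩
  apply MulOpposite.unop_injective
  simpa [mul_assoc] using h1

/-- The mirror image: reversed words evaluated in the opposite monoid, which is again in `DA`. -/
theorem exists_idem_left [Finite A] [Finite M] (hDA : IsDA M) (f : A → M) {k : ℕ}
    (hk : Nat.card M + 1 ≤ k) (u : List A) (B : Set A) (hB : ∀ b ∈ B, SubEq k (b :: u) u) :
    ∃ e : M, e * e = e ∧ e * (u.map f).prod = (u.map f).prod ∧ ∀ b ∈ B, Above e (f b) := by
  have : Finite Mᵐᵒᵖ := Finite.of_equiv M MulOpposite.opEquiv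
  have hcard : Nat.card Mᵐᵒᵖ = Nat.card M := (Nat.card_congr MulOpposite.opEquiv).symm
  have hprod : (u.reverse.map fun a => MulOpposite.op (f a)).prod =
      MulOpposite.op (u.map f).prod := by
    rw [MulOpposite.op_list_prod, List.map_reverse, List.map_map]
    rfl
  obtain ⟨e, he, h1, h2⟩ := exists_idem_right hDA.mulOpposite (fun a => MulOpposite.op (f a))
    (k := k) (by omega) u.reverse B (fun b hb => by simpa using (hB b hb).reverse)
  rw [hprod] at h1
  refine ⟨e.unop, by rw [← MulOpposite.unop_mul, he], ?_, fun b hb => ?_⟩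
  · simpa using congrArg MulOpposite.unop h1
  · obtain ⟨p, q, hpq⟩ := h2 b hb
    exact ⟨q.unop, p.unop, by rw [hpq]; simp [mul_assoc]⟩

end Descents

/-! ### Loops and descents in a `𝒥`-trivial monoid -/

section Loops

variable {A N L : Type u} [Monoid N] [Monoid L]

/-- The letter `(p, a, q)` is a loop: `a` is absorbed by `p` and by `q`. -/
def IsLoop (ψ : FreeMonoid A →* N) (σ : N × A × N) : Prop :=
  FreeMonoid.of σ.2.1 ∈ absorbed ψ σ.1 σ.2.2

open Classical in
/-- The subsequence of letters that are not loops. -/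
noncomputable def nonLoops (ψ : FreeMonoid A →* N) (x : FreeMonoid (N × A × N)) :
    List (N × A × N) := x.toList.filter fun σ => ¬ IsLoop ψ σ

open Classical in
/-- The value under `κ` of the subsequence of loops at the object `o`. -/
noncomputable def loopValue (ψ : FreeMonoid A →* N) (κ : FreeMonoid A →* L) (o : N × N) :
    FreeMonoid (N × A × N) →* L :=
  FreeMonoid.lift fun σ => if IsLoop ψ σ ∧ (σ.1, σ.2.2) = o then κ (FreeMonoid.of σ.2.1) else 1

variable {ψ : FreeMonoid A →* N} {κ : FreeMonoid A →* L}

theorem nonLoops_mul (x y : FreeMonoid (N × A × N)) :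
    nonLoops ψ (x * y) = nonLoops ψ x ++ nonLoops ψ y := by
  simp [nonLoops, FreeMonoid.toList_mul]

open Classical in
theorem sublist_nonLoops {l : List (N × A × N)} {x : FreeMonoid (N × A × N)} :
    l.Sublist (nonLoops ψ x) ↔ (∀ σ ∈ l, ¬ IsLoop ψ σ) ∧ l.Sublist x.toList := by
  refine ⟨fun h => ⟨fun σ hσ => ?_, h.trans List.filter_sublist⟩, fun ⟨h1, h2⟩ => ?_⟩
  · simpa using List.of_mem_filter (h.subset hσ)
  · have h3 := h2.filter fun σ => decide (¬ IsLoop ψ σ)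
    rw [List.filter_eq_self.2 (by simpa using h1)] at h3
    exact h3

theorem mem_absorbed_of_forall {p q : N} {l : FreeMonoid A}
    (h : ∀ b ∈ l.toList, FreeMonoid.of b ∈ absorbed ψ p q) : l ∈ absorbed ψ p q := by
  induction l using FreeMonoid.recOn with
  | one => exact one_mem _
  | of_mul b l ih =>
    simp only [FreeMonoid.toList_of_mul, List.mem_cons, forall_eq_or_imp] at h
    exact mul_mem h.1 (ih h.2)

theorem transduceIn_of_mul (p q : N) (a : A) (w : FreeMonoid A) :
    transduceIn ψ p q (FreeMonoid.of a * w) =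
      FreeMonoid.of (p, a, ψ w * q) * transduceIn ψ (p * ψ (FreeMonoid.of a)) q w := by
  rw [transduceIn_mul, transduceIn_of]

theorem transduceIn_loops {p q : N} {l : FreeMonoid A}
    (h : ∀ b ∈ l.toList, FreeMonoid.of b ∈ absorbed ψ p q) :
    nonLoops ψ (transduceIn ψ p q l) = [] ∧
      loopValue ψ κ (p, q) (transduceIn ψ p q l) = κ l ∧
      ∀ o, o ≠ (p, q) → loopValue ψ κ o (transduceIn ψ p q l) = 1 := by
  induction l using FreeMonoid.recOn with
  | one => simp [transduceIn_one, nonLoops]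
  | of_mul b l ih =>
    simp only [FreeMonoid.toList_of_mul, List.mem_cons, forall_eq_or_imp] at h
    obtain ⟨h1, h2, h3⟩ := ih h.2
    have hl : IsLoop ψ (p, b, q) := h.1
    rw [transduceIn_of_mul, (mem_absorbed_of_forall h.2).2, h.1.1]
    refine ⟨?_, ?_, fun o ho => ?_⟩
    · rw [nonLoops_mul, h1]
      simp [nonLoops, hl]
    · rw [map_mul, h2, map_mul]
      simp [loopValue, hl]
    · rw [map_mul, h3 o ho]
      simp [loopValue, ho.symm]

theorem exists_of_mem_transduceIn {p q : N} {w : FreeMonoid A} {σ : N × A × N}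
    (h : σ ∈ (transduceIn ψ p q w).toList) :
    ∃ x y, w = x * FreeMonoid.of σ.2.1 * y ∧ σ.1 = p * ψ x ∧ σ.2.2 = ψ y * q := by
  induction w using FreeMonoid.recOn generalizing p with
  | one => simp [transduceIn_one] at h
  | of_mul b w ih =>
    rw [transduceIn_of_mul] at h
    simp only [FreeMonoid.toList_of_mul, List.mem_cons] at h
    rcases h with rfl | h
    · exact ⟨1, w, by simp⟩
    · obtain ⟨x, y, h1, h2, h3⟩ := ih h
      refine ⟨FreeMonoid.of b * x, y, ?_, ?_, h3⟩
      · rw [h1]; simp only [mul_assoc]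
      · rw [h2, map_mul, mul_assoc]

theorem classJ.eq_of_mul_right (hN : classJ N) {p x y : N} (h : p = p * x * y) : p * x = p :=
  eq_of_ideal_eq hN (a := 1) (b := x) (c := 1) (d := y) (by simp) (by simpa using h)

theorem classJ.eq_of_mul_left (hN : classJ N) {q x y : N} (h : q = y * (x * q)) : x * q = q :=
  eq_of_ideal_eq hN (a := x) (b := 1) (c := y) (d := 1) (by simp) (by simpa using h)

/-- If the transduced letter recurred, its left coordinate would satisfy `p = p · a · x`, so `p`
absorbs `a` by `𝒥`-triviality; the same on the right would make the letter a loop. -/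
theorem not_loop_not_mem (hN : classJ N) {p q : N} {a : A} {w : FreeMonoid A}
    (h : ¬ IsLoop ψ (p, a, ψ w * q)) :
    (p, a, ψ w * q) ∉ (transduceIn ψ (p * ψ (FreeMonoid.of a)) q w).toList := by
  intro hm
  obtain ⟨x, y, h1, h2, h3⟩ := exists_of_mem_transduceIn hm
  refine h ⟨hN.eq_of_mul_right h2, hN.eq_of_mul_left (y := ψ x) ?_⟩
  dsimp only at h1 h3 ⊢
  nth_rw 1 [h1]
  rw [h3]
  simp only [map_mul, mul_assoc]

/-- The pair of coordinates of a gap between letters changes irreversibly across a non-loop: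
returning to it would make the letter absorbed on both sides. -/
theorem not_loop_no_return (hN : classJ N) {p q : N} {a : A} {w : FreeMonoid A}
    (h : ¬ IsLoop ψ (p, a, ψ w * q)) {σ : N × A × N}
    (hσ : σ ∈ (transduceIn ψ (p * ψ (FreeMonoid.of a)) q w).toList) :
    (σ.1, σ.2.2) ≠ (p, ψ (FreeMonoid.of a) * (ψ w * q)) := by
  intro he
  rw [Prod.mk.injEq] at he
  obtain ⟨x, y, h1, h2, h3⟩ := exists_of_mem_transduceIn hσ
  refine h ⟨hN.eq_of_mul_right (y := ψ x) (he.1 ▸ h2),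
    hN.eq_of_mul_left (y := ψ (x * FreeMonoid.of σ.2.1)) ?_⟩
  dsimp only
  rw [← he.2, h3]
  nth_rw 1 [h1]
  simp only [map_mul, mul_assoc]

theorem nodup_nonLoops (hN : classJ N) (p q : N) (w : FreeMonoid A) :
    (nonLoops ψ (transduceIn ψ p q w)).Nodup := by
  induction w using FreeMonoid.recOn generalizing p with
  | one => simp [transduceIn_one, nonLoops]
  | of_mul a w ih =>
    rw [transduceIn_of_mul, nonLoops_mul]
    by_cases h : IsLoop ψ (p, a, ψ w * q)
    · simpa [nonLoops, h] using ih _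
    · have h1 := not_loop_not_mem hN h
      have h2 := ih (p * ψ (FreeMonoid.of a))
      simp only [nonLoops, FreeMonoid.toList_of] at h2 ⊢
      rw [List.filter_singleton]
      simp only [h, not_false_eq_true, decide_true, cond_true, List.singleton_append]
      exact List.nodup_cons.2 ⟨fun hm => h1 (List.mem_of_mem_filter hm), h2⟩

theorem loopValue_eq_one {o : N × N} {x : FreeMonoid (N × A × N)}
    (h : ∀ σ ∈ x.toList, (σ.1, σ.2.2) ≠ o) : loopValue ψ κ o x = 1 := by
  induction x using FreeMonoid.recOn with
  | one => exact map_one _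
  | of_mul σ x ih =>
    simp only [FreeMonoid.toList_of_mul, List.mem_cons, forall_eq_or_imp] at h
    rw [map_mul, ih h.2]
    simp [loopValue, h.1]

/-- Loops do not change the pair of coordinates, so the maximal initial block of loops sits at one
object, namely that of the gap before the first non-loop. -/
theorem loops_or_exists_nonLoop (p q : N) (v : FreeMonoid A) :
    (∀ b ∈ v.toList, FreeMonoid.of b ∈ absorbed ψ p q) ∨
    ∃ l a v', v = l * (FreeMonoid.of a * v') ∧
      (∀ b ∈ l.toList, FreeMonoid.of b ∈ absorbed ψ p (ψ (FreeMonoid.of a) * (ψ v' * q))) ∧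
      ¬ IsLoop ψ (p, a, ψ v' * q) := by
  induction v using FreeMonoid.recOn with
  | one => left; simp
  | of_mul b v ih =>
    by_cases h : IsLoop ψ (p, b, ψ v * q)
    · rcases ih with ih | ⟨l, a, v', rfl, h1, h2⟩
      · left
        have hb : FreeMonoid.of b ∈ absorbed ψ p q := by
          have := (mem_absorbed_of_forall ih).2
          have h' : FreeMonoid.of b ∈ absorbed ψ p (ψ v * q) := h
          rwa [this] at h'
        simpa using ⟨hb, ih⟩
      · right
        refine ⟨FreeMonoid.of b * l, a, v', by simp only [mul_assoc], ?_, h2⟩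
        have hb : FreeMonoid.of b ∈ absorbed ψ p (ψ (FreeMonoid.of a) * (ψ v' * q)) := by
          have := (mem_absorbed_of_forall h1).2
          have h' : FreeMonoid.of b ∈ absorbed ψ p (ψ (l * (FreeMonoid.of a * v')) * q) := h
          rwa [map_mul, map_mul, mul_assoc, mul_assoc, this] at h'
        simpa using ⟨hb, h1⟩
    · right
      exact ⟨1, b, v, by simp, by simp, h⟩

theorem transduceIn_decomposition (hN : classJ N) {p q : N} {l v' : FreeMonoid A} {a : A}
    (h1 : ∀ b ∈ l.toList, FreeMonoid.of b ∈ absorbed ψ p (ψ (FreeMonoid.of a) * (ψ v' * q)))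
    (h2 : ¬ IsLoop ψ (p, a, ψ v' * q)) :
    nonLoops ψ (transduceIn ψ p q (l * (FreeMonoid.of a * v'))) =
      (p, a, ψ v' * q) :: nonLoops ψ (transduceIn ψ (p * ψ (FreeMonoid.of a)) q v') ∧
    loopValue ψ κ (p, ψ (FreeMonoid.of a) * (ψ v' * q))
      (transduceIn ψ p q (l * (FreeMonoid.of a * v'))) = κ l ∧
    loopValue ψ κ (p, ψ (FreeMonoid.of a) * (ψ v' * q))
      (transduceIn ψ (p * ψ (FreeMonoid.of a)) q v') = 1 ∧
    ∀ o, o ≠ (p, ψ (FreeMonoid.of a) * (ψ v' * q)) →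
      loopValue ψ κ o (transduceIn ψ p q (l * (FreeMonoid.of a * v'))) =
        loopValue ψ κ o (transduceIn ψ (p * ψ (FreeMonoid.of a)) q v') := by
  obtain ⟨h3, h4, h5⟩ := transduceIn_loops (κ := κ) h1
  have h6 := loopValue_eq_one (ψ := ψ) (κ := κ) (fun σ hσ => not_loop_no_return hN h2 hσ)
  rw [transduceIn_mul, (mem_absorbed_of_forall h1).1, transduceIn_of_mul, map_mul, mul_assoc]
  have hone : ∀ o, loopValue ψ κ o (FreeMonoid.of (p, a, ψ v' * q)) = 1 := fun o => by
    simp [loopValue, h2]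
  refine ⟨?_, ?_, h6, fun o ho => ?_⟩
  · rw [nonLoops_mul, nonLoops_mul, h3]
    simp [nonLoops, h2]
  · rw [map_mul, h4, map_mul, h6, hone]
    simp
  · rw [map_mul, h5 o ho, map_mul, hone]
    simp

/-- `v` and `w` alternate between blocks of loops and the same non-loops. Blocks at different places
have different objects, so equal loop values mean that corresponding blocks have equal value under
`κ`; they are exchanged one at a time from the left by `swap`. -/
theorem eq_of_loopValue_eq {M : Type*} [Monoid M] (hN : classJ N) {φ : FreeMonoid A →* M}
    (swap : ∀ (p q : N) (l l' : FreeMonoid A), (∀ b ∈ l.toList, FreeMonoid.of b ∈ absorbed ψ p q) →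
      (∀ b ∈ l'.toList, FreeMonoid.of b ∈ absorbed ψ p q) → κ l = κ l' →
      ∀ U W, ψ U = p → ψ W = q → φ (U * l * W) = φ (U * l' * W)) {p q : N} {v w : FreeMonoid A}
    (hvw : ψ v * q = ψ w * q)
    (hnl : nonLoops ψ (transduceIn ψ p q v) = nonLoops ψ (transduceIn ψ p q w))
    (hlv : ∀ o, loopValue ψ κ o (transduceIn ψ p q v) = loopValue ψ κ o (transduceIn ψ p q w))
    {U W : FreeMonoid A} (hU : ψ U = p) (hW : ψ W = q) : φ (U * v * W) = φ (U * w * W) := by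
  obtain ⟨n, hn⟩ : ∃ n, v.toList.length ≤ n := ⟨_, le_rfl⟩
  induction n generalizing v w p U with
  | zero =>
    obtain rfl : v = 1 := by
      rw [Nat.le_zero, List.length_eq_zero_iff] at hn
      exact FreeMonoid.toList.injective hn
    rcases loops_or_exists_nonLoop (ψ := ψ) p q w with h | ⟨l, a, w', rfl, h1, h2⟩
    · refine swap p q 1 w (by simp) h ?_ U W hU hW
      rw [← (transduceIn_loops (κ := κ) h).2.1, ← hlv, transduceIn_one]
      simp
    · rw [(transduceIn_decomposition (κ := κ) hN h1 h2).1] at hnl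
      simp [transduceIn_one, nonLoops] at hnl
  | succ n ih =>
    rcases loops_or_exists_nonLoop (ψ := ψ) p q v with hv | ⟨l, a, v', rfl, h1, h2⟩ <;>
    rcases loops_or_exists_nonLoop (ψ := ψ) p q w with hw | ⟨m, b, w', rfl, h3, h4⟩
    · refine swap p q v w hv hw ?_ U W hU hW
      rw [← (transduceIn_loops (κ := κ) hv).2.1, hlv, (transduceIn_loops (κ := κ) hw).2.1]
    · rw [(transduceIn_decomposition (κ := κ) hN h3 h4).1, (transduceIn_loops (κ := κ) hv).1] at hnl
      simp at hnl
    · rw [(transduceIn_decomposition (κ := κ) hN h1 h2).1, (transduceIn_loops (κ := κ) hw).1] at hnl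
      simp at hnl
    · obtain ⟨d1, d2, d3, d4⟩ := transduceIn_decomposition (κ := κ) hN h1 h2
      obtain ⟨e1, e2, e3, e4⟩ := transduceIn_decomposition (κ := κ) hN h3 h4
      rw [d1, e1] at hnl
      simp only [List.cons.injEq, Prod.mk.injEq, true_and] at hnl
      obtain ⟨⟨rfl, hq⟩, hnl⟩ := hnl
      rw [← hq] at h3 e2 e3 e4
      have hκ : κ l = κ m := by rw [← d2, hlv, e2]
      -- At the object of the first block both remainders contribute `1`, since it is never visited
      -- again; at all other objects the first block and the non-loop contribute `1`.
      have hlv' : ∀ o, loopValue ψ κ o (transduceIn ψ (p * ψ (FreeMonoid.of a)) q v') =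
          loopValue ψ κ o (transduceIn ψ (p * ψ (FreeMonoid.of a)) q w') := by
        intro o
        by_cases ho : o = (p, ψ (FreeMonoid.of a) * (ψ v' * q))
        · rw [ho, d3, e3]
        · rw [← d4 o ho, ← e4 o ho, hlv]
      have s1 := swap p _ l m h1 h3 hκ U (FreeMonoid.of a * v' * W) hU
        (by simp only [map_mul, hW, mul_assoc])
      have s2 := ih (p := p * ψ (FreeMonoid.of a)) (U := U * m * FreeMonoid.of a) hq hnl hlv'
        (by simp only [map_mul, hU, (mem_absorbed_of_forall h3).1]) (by
          simp only [FreeMonoid.toList_mul, List.length_append, FreeMonoid.toList_of,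
            List.length_singleton] at hn
          omega)
      simp only [← mul_assoc] at s1 s2 ⊢
      exact s1.trans s2

end Loops

/-! ### The local monoids -/

section Local

variable {M : Type u} [Monoid M]

/-- Pairs of idempotents. -/
abbrev IdemPair (M : Type u) [Monoid M] := {p : M × M // p.1 * p.1 = p.1 ∧ p.2 * p.2 = p.2}

/-- The elements `𝒥`-above both idempotents. -/
def localSubmonoid (h : IsDA M) (i : IdemPair M) : Submonoid M :=
  aboveSubmonoid h i.2.1 ⊓ aboveSubmonoid h i.2.2

instance finite_con_quotient {S : Type*} [Monoid S] [Finite S] (c : Con S) : Finite c.Quotient :=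
  Finite.of_surjective c.mk' c.mk'_surjective

/-- Elements are identified if they act in the same way between the two idempotents. -/
def localCon (h : IsDA M) (i : IdemPair M) : Con (localSubmonoid h i) where
  r x y := ∀ s t : localSubmonoid h i,
    i.1.1 * s * x * t * i.1.2 = i.1.1 * s * y * t * i.1.2
  iseqv := ⟨fun _ _ _ => rfl, fun h s t => (h s t).symm, fun h h' s t => (h s t).trans (h' s t)⟩
  mul' {w x y z} h h' s t := by
    have h1 := h s (y * t)
    have h2 := h' (s * x) t
    simp only [Submonoid.coe_mul, mul_assoc] at h1 h2 ⊢
    rw [h1, h2]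

/-- The surrounding factors `s` and `t` are absorbed into the idempotents: by `DA` both `e s` and `t
f` are idempotent, and the elements of the local submonoid lie above them, so
`idem_mul_eval_mul_idem` applies to `e s` and `t f`. -/
theorem localCon_levelIdentities [Finite M] {n : ℕ} (hn : 1 ≤ n) (hM : LevelIdentities (n + 1) M)
    (i : IdemPair M) : LevelIdentities n (localCon (hM.isDA (by omega)) i).Quotient := by
  have hDA := hM.isDA (by omega)
  have key : ∀ s t : OmegaTerm, (∀ ρ : ℕ → localSubmonoid hDA i,
      (localCon hDA i) (s.eval ρ) (t.eval ρ)) → Satisfies (localCon hDA i).Quotient s t := by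
    intro s t h ρ
    choose r hr using fun j => (localCon hDA i).mk'_surjective (ρ j)
    obtain rfl : (fun j => (localCon hDA i).mk' (r j)) = ρ := funext hr
    rw [← map_eval, ← map_eval]
    exact (localCon hDA i).eq.2 (h r)
  have hcoe : ∀ (ρ : ℕ → localSubmonoid hDA i) (t : OmegaTerm),
      ((t.eval ρ : localSubmonoid hDA i) : M) = t.eval fun j => (ρ j : M) :=
    fun ρ t => map_eval (localSubmonoid hDA i).subtype ρ t
  constructor
  · refine key _ _ fun ρ s t => ?_
    rw [hcoe, hcoe, hM.1]
  · refine key _ _ fun ρ s t => ?_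
    rw [hcoe, hcoe]
    have hs := hDA _ _ i.2.1 s.2.1
    have ht := hDA _ _ i.2.2 t.2.2
    have h1 := idem_mul_eval_mul_idem hDA hn hM.2 (e := i.1.1 * s) (f := t * i.1.2)
      (by rw [← mul_assoc, hs]) (by rw [mul_assoc, ← mul_assoc i.1.2, ht]) (fun j => (ρ j : M))
      (fun j _ _ => by
        obtain ⟨⟨a, b, hab⟩, c, d, hcd⟩ := (ρ j).2
        refine ⟨⟨a, b * s, by rw [← mul_assoc, ← hab]⟩, ⟨t * c, d, ?_⟩⟩
        rw [mul_assoc _ c, mul_assoc, ← hcd])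
    simpa only [mul_assoc] using h1

open Classical in
/-- The product over all pairs of idempotents of the maps from words to local monoids. -/
noncomputable def localValue {A : Type*} (h : IsDA M) (φ : FreeMonoid A →* M) :
    FreeMonoid A →* ∀ i : IdemPair M, (localCon h i).Quotient :=
  MonoidHom.pi fun i => FreeMonoid.lift fun a =>
    if ha : φ (FreeMonoid.of a) ∈ localSubmonoid h i then
      (localCon h i).mk' ⟨φ (FreeMonoid.of a), ha⟩ else 1

theorem localValue_eq {A : Type*} (h : IsDA M) {φ : FreeMonoid A →* M} {i : IdemPair M}
    {l : FreeMonoid A} (hl : ∀ b ∈ l.toList, φ (FreeMonoid.of b) ∈ localSubmonoid h i) :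
    ∃ hm : φ l ∈ localSubmonoid h i, localValue h φ l i = (localCon h i).mk' ⟨φ l, hm⟩ := by
  induction l using FreeMonoid.recOn with
  | one =>
    refine ⟨by rw [map_one]; exact one_mem _, ?_⟩
    rw [map_one, Pi.one_apply, ← map_one (localCon h i).mk']
    exact congrArg _ (Subtype.ext (map_one φ).symm)
  | of_mul b l ih =>
    simp only [FreeMonoid.toList_of_mul, List.mem_cons, forall_eq_or_imp] at hl
    obtain ⟨hm, h1⟩ := ih hl.2
    refine ⟨by rw [map_mul]; exact mul_mem hl.1 hm, ?_⟩
    rw [map_mul, Pi.mul_apply, h1]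
    have h2 : localValue h φ (FreeMonoid.of b) i =
        (localCon h i).mk' ⟨φ (FreeMonoid.of b), hl.1⟩ := by
      simp [localValue, hl.1]
    rw [h2, ← map_mul]
    exact congrArg _ (Subtype.ext (map_mul φ _ _).symm)

theorem apply_eq_prod {A : Type*} (φ : FreeMonoid A →* M) (w : FreeMonoid A) :
    φ w = (w.toList.map fun a => φ (FreeMonoid.of a)).prod := by
  induction w using FreeMonoid.recOn with
  | one => simp
  | of_mul a w ih => simp [map_mul, ih]

/-- Letters that change the short subwords of neither `U` nor `W` lie above idempotents `e` and `f`
with `φ(U) e = φ(U)` and `f φ(W) = φ(W)`. Hence only `e φ(l) f` matters, and this is a function of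
the local value at `(e, f)`. -/
theorem localValue_swap {A : Type*} [Finite A] [Finite M] (h : IsDA M) (φ : FreeMonoid A →* M)
    {k : ℕ} (hk : Nat.card M + 1 ≤ k) {U W l l' : FreeMonoid A}
    (hl : ∀ b ∈ l.toList, subMk A k (U * FreeMonoid.of b) = subMk A k U ∧
      subMk A k (FreeMonoid.of b * W) = subMk A k W)
    (hl' : ∀ b ∈ l'.toList, subMk A k (U * FreeMonoid.of b) = subMk A k U ∧
      subMk A k (FreeMonoid.of b * W) = subMk A k W)
    (hv : localValue h φ l = localValue h φ l') : φ (U * l * W) = φ (U * l' * W) := by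
  obtain ⟨e, he, he1, he2⟩ := exists_idem_right h (fun a => φ (FreeMonoid.of a)) hk U.toList
    {b | subMk A k (U * FreeMonoid.of b) = subMk A k U}
    (fun b hb => by simpa using subMk_eq_iff.1 hb)
  obtain ⟨f, hf, hf1, hf2⟩ := exists_idem_left h (fun a => φ (FreeMonoid.of a)) hk W.toList
    {b | subMk A k (FreeMonoid.of b * W) = subMk A k W}
    (fun b hb => by simpa using subMk_eq_iff.1 hb)
  rw [← apply_eq_prod] at he1 hf1
  let i : IdemPair M := ⟨(e, f), he, hf⟩
  obtain ⟨hm, h1⟩ := localValue_eq (i := i) h (φ := φ) fun b hb =>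
    ⟨he2 b (hl b hb).1, hf2 b (hl b hb).2⟩
  obtain ⟨hm', h1'⟩ := localValue_eq (i := i) h (φ := φ) fun b hb =>
    ⟨he2 b (hl' b hb).1, hf2 b (hl' b hb).2⟩
  have h2 : (localCon h i).mk' ⟨φ l, hm⟩ = (localCon h i).mk' ⟨φ l', hm'⟩ := by
    rw [← h1, ← h1', hv]
  have h3 := (localCon h i).eq.1 h2 1 1
  have h4 : e * φ l * f = e * φ l' * f := by simpa using h3
  rw [map_mul, map_mul, map_mul, map_mul, ← he1, ← hf1]
  calc φ U * e * φ l * (f * φ W) = φ U * (e * φ l * f) * φ W := by simp only [mul_assoc]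
    _ = φ U * (e * φ l' * f) * φ W := by rw [h4]
    _ = _ := by simp only [mul_assoc]

end Local

/-! ### The equational description of the levels -/

/-- `K` has two jobs: for every object in `N × N` it multiplies the local values of the loops there,
and through subwords of length `2` it remembers the sequence of non-loops. The first factor is a
power of local monoids and the second is `𝒥`-trivial, so both satisfy the identities of level `n`.
-/
theorem factorsThrough_of_levelIdentities {V : MonoidClass.{u}} {n : ℕ} (hn : 1 ≤ n)
    (hV : ∀ (K : Type u) [Monoid K] [Finite K], LevelIdentities n K → V K)
    {A M : Type u} [Finite A] [Monoid M] [Finite M] (hM : LevelIdentities (n + 1) M)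
    (φ : FreeMonoid A →* M) : FactorsThrough V classJ φ := by
  have hDA := hM.isDA (by omega)
  set k := Nat.card M + 1
  set N := SubQuot A k
  set ψ : FreeMonoid A →* N := subMk A k
  have hN : classJ N := classJ_subQuot k
  let L := ∀ i : IdemPair M, (localCon hDA i).Quotient
  have : Finite (N × N → L) := inferInstance
  let K := (N × N → L) × SubQuot (N × A × N) 2
  have hK : LevelIdentities n K := by
    have h1 : LevelIdentities n L := LevelIdentities.pi fun i => localCon_levelIdentities hn hM i
    have h2 : LevelIdentities n (N × N → L) := LevelIdentities.pi fun _ => h1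
    exact h2.prod ((classJ_subQuot 2).levelIdentities hn)
  let h : FreeMonoid (N × A × N) →* K :=
    (MonoidHom.pi fun o => loopValue ψ (localValue hDA φ) o).prod (subMk _ 2)
  refine ⟨N, inferInstance, K, inferInstance, inferInstance, inferInstance, hN, hV K hK, ψ, h,
    fun v w hvw hh => ?_⟩
  rw [transduce_eq_transduceIn, transduce_eq_transduceIn] at hh
  have hh1 := congrArg Prod.fst hh
  have hh2 : subMk _ 2 (transduceIn ψ 1 1 v) = subMk _ 2 (transduceIn ψ 1 1 w) :=
    congrArg Prod.snd hh
  have := eq_of_loopValue_eq (κ := localValue hDA φ) (φ := φ) hN (p := 1) (q := 1) (v := v) (w := w)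
    (fun p q l l' hl hl' hv U W hU hW => ?_) (by rw [hvw])
    (eq_of_nodup_of_subEq (nodup_nonLoops hN 1 1 v) (nodup_nonLoops hN 1 1 w) ?_)
    (fun o => congrFun hh1 o) (U := 1) (W := 1) (map_one _) (map_one _)
  · simpa using this
  · subst hU hW
    exact localValue_swap hDA φ le_rfl
      (fun b hb => ⟨by rw [map_mul]; exact (hl b hb).1, by rw [map_mul]; exact (hl b hb).2⟩)
      (fun b hb => ⟨by rw [map_mul]; exact (hl' b hb).1, by rw [map_mul]; exact (hl' b hb).2⟩) hv
  · intro l hl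
    have h1 := subMk_eq_iff.1 hh2 l hl
    rw [sublist_nonLoops, sublist_nonLoops, h1]

theorem levelV_iff {n : ℕ} (hn : 1 ≤ n) (M : Type u) [Monoid M] [Finite M] :
    levelV n M ↔ LevelIdentities n M := by
  induction n, hn using Nat.le_induction generalizing M with
  | base => exact ⟨fun h => classJ.levelIdentities h le_rfl, fun h => classJ_of_satisfies h.1 h.2⟩
  | succ n hn ih =>
    obtain ⟨k, rfl⟩ := Nat.exists_eq_add_of_le' hn
    constructor
    · exact levelIdentities_of_twoSidedProduct hn fun K _ _ hK => (ih K).1 hK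
    · intro h
      -- The elements of `M` themselves serve as alphabet.
      refine ⟨inferInstance, M, inferInstance, FreeMonoid.lift id, fun m => ⟨FreeMonoid.of m, by simp⟩,
        factorsThrough_of_levelIdentities hn (fun K _ _ hK => (ih K).2 hK) h _⟩

/-! ### Simon's theorem on `𝒥`-trivial monoids -/

section Simon

variable {A : Type*} {M : Type u} [Monoid M]

/-- In a `𝒥`-trivial monoid a stable letter even fixes `s`. A prefix that avoids the letter of the
first descent therefore does nothing. -/
theorem descents_append_of_not_mem (hM : classJ M) {f : A → M} {s : M} {x y : List A}
    (h : ∀ a ∈ (descents f s (x ++ y)).head?, a ∉ x) :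
    s * (x.map f).prod = s ∧ descents f s y = descents f s (x ++ y) := by
  induction x with
  | nil => simp
  | cons b x ih =>
    rw [List.cons_append, descents] at h ⊢
    by_cases hb : ∃ z, s * f b * z = s
    · rw [if_pos hb] at h ⊢
      have hs : s * f b = s := by
        obtain ⟨z, hz⟩ := hb
        exact hM.eq_of_mul_right (y := z) hz.symm
      rw [hs] at h ⊢
      obtain ⟨h1, h2⟩ := ih fun a ha hax => h a ha (List.mem_cons_of_mem _ hax)
      exact ⟨by rw [List.map_cons, List.prod_cons, ← mul_assoc, hs, h1], h2⟩
    · rw [if_neg hb] at h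
      exact absurd (List.mem_cons_self) (h b rfl)

theorem exists_first_descent (hM : classJ M) {f : A → M} {s : M} {u : List A} {a : A} {c : List A}
    (h : descents f s u = a :: c) : ∃ u₀ u', u = u₀ ++ a :: u' ∧ a ∉ u₀ ∧
      s * (u.map f).prod = s * f a * (u'.map f).prod ∧ descents f (s * f a) u' = c := by
  have ha : a ∈ u := (descents_sublist f s u).subset (by rw [h]; exact List.mem_cons_self)
  obtain ⟨u₀, u', rfl, ha'⟩ := List.eq_append_cons_of_mem ha
  obtain ⟨h1, h2⟩ := descents_append_of_not_mem hM (f := f) (s := s) (x := u₀) (y := a :: u')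
    (by rw [h]; simpa using ha')
  refine ⟨u₀, u', rfl, ha', ?_, ?_⟩
  · rw [List.map_append, List.prod_append, ← mul_assoc, h1, List.map_cons, List.prod_cons,
      mul_assoc]
  · rw [h, descents] at h2
    have := hM.1
    have hne := not_stable_of_descents_eq_cons ((hM.levelIdentities le_rfl).isDA le_rfl) h
    rw [if_neg hne] at h2
    exact (List.cons.inj h2).2

open Classical in
/-- The letters of `u` at which the value of the suffix changes. -/
noncomputable def suffixDescents (f : A → M) : List A → List A
  | [] => []
  | a :: u => if f a * (u.map f).prod = (u.map f).prod then suffixDescents f u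
    else a :: suffixDescents f u

theorem suffixDescents_sublist (f : A → M) (u : List A) : (suffixDescents f u).Sublist u := by
  induction u with
  | nil => simp [suffixDescents]
  | cons a u ih =>
    rw [suffixDescents]
    split_ifs
    · exact ih.cons _
    · exact ih.cons_cons _

theorem length_suffixDescents_le (hM : classJ M) (f : A → M) (u : List A) :
    (suffixDescents f u).length ≤ Nat.card M := by
  have := hM.1
  have key : (suffixDescents f u).length + {x | ∃ z, x = z * (u.map f).prod}.ncard ≤
      Nat.card M := by
    induction u with
    | nil => simp only [suffixDescents, List.length_nil, zero_add]; exact Set.ncard_le_card _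
    | cons a u ih =>
      rw [List.map_cons, List.prod_cons]
      have hsub : {x | ∃ z, x = z * (f a * (u.map f).prod)} ⊆ {x | ∃ z, x = z * (u.map f).prod} := by
        rintro _ ⟨z, rfl⟩
        exact ⟨z * f a, by rw [mul_assoc]⟩
      rw [suffixDescents]
      split_ifs with h
      · exact (Nat.add_le_add_left (Set.ncard_le_ncard hsub) _).trans ih
      · have : {x | ∃ z, x = z * (f a * (u.map f).prod)}.ncard <
            {x | ∃ z, x = z * (u.map f).prod}.ncard := by
          refine Set.ncard_lt_ncard ⟨hsub, fun hsup => h ?_⟩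
          obtain ⟨z, hz⟩ := hsup ⟨1, (one_mul _).symm⟩
          exact hM.eq_of_mul_left hz
        rw [List.length_cons]
        omega
  omega

/-- Read from the right, the letters that change the suffix value need the whole of `w` to be
embedded, and there is no room for a further changing letter in front. -/
theorem not_cons_suffixDescents_sublist {f : A → M} {w : List A} {b : A}
    (hb : f b * (w.map f).prod ≠ (w.map f).prod) : ¬ (b :: suffixDescents f w).Sublist w := by
  induction w generalizing b with
  | nil => simp
  | cons a w ih =>
    intro h
    rw [suffixDescents] at h
    rw [List.map_cons, List.prod_cons] at hb
    split_ifs at h with ha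
    · rw [List.sublist_cons_iff] at h
      rcases h with h | ⟨r, hr, -⟩
      · exact ih (by rwa [ha] at hb) h
      · rw [(List.cons.inj hr).1, ha, ha] at hb
        exact hb rfl
    · have h' : (a :: suffixDescents f w).Sublist w := by
        rw [List.sublist_cons_iff] at h
        rcases h with h | ⟨r, hr, h⟩
        · exact (List.sublist_cons_self _ _).trans h
        · rwa [(List.cons.inj hr).2]
      exact ih ha h'

theorem suffixDescents_of_sublist {f : A → M} {x y : List A}
    (h : (suffixDescents f (x ++ y)).Sublist y) :
    suffixDescents f y = suffixDescents f (x ++ y) ∧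
      ((x ++ y).map f).prod = (y.map f).prod := by
  induction x with
  | nil => simp
  | cons b x ih =>
    rw [List.cons_append, suffixDescents] at h ⊢
    split_ifs at h ⊢ with hb
    · rw [List.map_cons, List.prod_cons, hb]
      exact ih h
    · exact absurd (h.trans (List.sublist_append_right _ _)) (not_cons_suffixDescents_sublist hb)

theorem exists_first_suffixDescent {f : A → M} {v : List A} {a : A} {d : List A}
    (h : suffixDescents f v = a :: d) : ∃ v₀ v', v = v₀ ++ a :: v' ∧ suffixDescents f v' = d ∧
      (v.map f).prod = f a * (v'.map f).prod := by
  induction v with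
  | nil => simp [suffixDescents] at h
  | cons b v ih =>
    rw [suffixDescents] at h
    split_ifs at h with hb
    · obtain ⟨v₀, v', rfl, h1, h2⟩ := ih h
      exact ⟨b :: v₀, v', rfl, h1, by rw [List.map_cons, List.prod_cons, hb, h2]⟩
    · obtain ⟨rfl, rfl⟩ := List.cons.inj h
      exact ⟨[], v, rfl, rfl, by simp⟩

theorem cons_sublist_append_cons_iff {a : A} {l x y : List A} (h : a ∉ x) :
    (a :: l).Sublist (x ++ a :: y) ↔ l.Sublist y := by
  induction x with
  | nil => exact List.cons_sublist_cons
  | cons b x ih =>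
    rw [List.mem_cons, not_or] at h
    rw [List.cons_append, List.sublist_cons_iff, ih h.2]
    refine ⟨?_, Or.inl⟩
    rintro (h' | ⟨r, hr, -⟩)
    · exact h'
    · exact absurd (List.cons.inj hr).1 h.1

theorem cons_sublist_append_iff {a : A} {l x y : List A} (h : a ∉ x) :
    (a :: l).Sublist (x ++ y) ↔ (a :: l).Sublist y := by
  induction x with
  | nil => rfl
  | cons b x ih =>
    rw [List.mem_cons, not_or] at h
    rw [List.cons_append, List.sublist_cons_iff, ih h.2]
    refine ⟨?_, Or.inl⟩
    rintro (h' | ⟨r, hr, -⟩)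
    · exact h'
    · exact absurd (List.cons.inj hr).1 h.1

theorem exists_first_occurrence {a : A} {l v : List A} (h : (a :: l).Sublist v) :
    ∃ x y, v = x ++ a :: y ∧ a ∉ x ∧ l.Sublist y := by
  obtain ⟨x, y, rfl, hx⟩ := List.eq_append_cons_of_mem (h.subset List.mem_cons_self)
  exact ⟨x, y, rfl, hx, (cons_sublist_append_cons_iff hx).1 h⟩

/-- The word `x` merges the descents `c` of `u` with the suffix descents `d` of `v`, in an order
compatible with both words: read from `s` it acts like `u`, and evaluated from the right it acts
like `v`. The next letter `b` of `c` is emitted first if `b d` still fits into `u`; otherwise the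
next letter of `d` is emitted, together with `b` if the two agree. The hypothesis on prefixes of `c`
followed by suffixes of `d` makes the choice consistent for `u` and `v`. -/
theorem exists_common_subword (hM : classJ M) (f : A → M) {c d u v : List A} {s : M}
    (hc : descents f s u = c) (hd : suffixDescents f v = d)
    (h : ∀ c' d', c' <+: c → d' <:+ d → ((c' ++ d').Sublist u ↔ (c' ++ d').Sublist v)) :
    ∃ x : List A, s * (u.map f).prod = s * (x.map f).prod ∧
      (v.map f).prod = (x.map f).prod := by
  obtain ⟨n, hn⟩ : ∃ n, c.length + d.length ≤ n := ⟨_, le_rfl⟩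
  induction n generalizing c d u v s with
  | zero =>
    obtain rfl : c = [] := List.length_eq_zero_iff.1 (by omega)
    obtain rfl : d = [] := List.length_eq_zero_iff.1 (by omega)
    refine ⟨[], ?_, ?_⟩
    · have := (descents_append_of_not_mem hM (f := f) (s := s) (x := u) (y := [])
        (by rw [List.append_nil, hc]; simp)).1
      simpa using this
    · have := (suffixDescents_of_sublist (f := f) (x := v) (y := [])
        (by rw [List.append_nil, hd])).2
      simpa using this
  | succ n ih =>
    have hcu := descents_sublist f s u
    have hdv := suffixDescents_sublist f v
    rw [hc] at hcu
    rw [hd] at hdv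
    have hdu : d.Sublist u := (h [] d List.nil_prefix List.suffix_rfl).2 hdv
    -- Emitting only the letter `a` of `d`: both words are cut after an `a`. As `b d` does not fit,
    -- no `b` is lost by the cuts, so the part removed from `u`, including `a`, fixes `s`.
    have right : ∀ a d', d = a :: d' → (∀ b ∈ c.head?, b ≠ a ∧ ¬ (b :: d).Sublist u) →
        ∃ x : List A, s * (u.map f).prod = s * (x.map f).prod ∧
          (v.map f).prod = (x.map f).prod := by
      rintro a d' rfl hb
      obtain ⟨v₀, v', rfl, h1, h2⟩ := exists_first_suffixDescent hd
      obtain ⟨u₀, u', rfl, h3, h4⟩ := exists_first_occurrence hdu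
      have hu₀ : ∀ b ∈ c.head?, b ∉ u₀ ++ [a] := by
        intro b hbc hb'
        rcases List.mem_append.1 hb' with hb' | hb'
        · exact (hb b hbc).2 (List.Sublist.append (List.singleton_sublist.2 hb')
            (List.cons_sublist_cons.2 h4))
        · exact (hb b hbc).1 (List.mem_singleton.1 hb')
      have h1' : d'.Sublist v' := h1 ▸ suffixDescents_sublist f v'
      have hv₀ : ∀ b ∈ c.head?, b ∉ v₀ ++ [a] := by
        intro b hbc hb'
        rcases List.mem_append.1 hb' with hb' | hb'
        · refine (hb b hbc).2 ((h [b] (a :: d') ?_ List.suffix_rfl).2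
            (List.Sublist.append (List.singleton_sublist.2 hb') (List.cons_sublist_cons.2 h1')))
          cases c with
          | nil => simp at hbc
          | cons b' c =>
            obtain rfl : b' = b := by simpa using hbc
            exact ⟨c, rfl⟩
        · exact (hb b hbc).1 (List.mem_singleton.1 hb')
      have e1 : u₀ ++ a :: u' = (u₀ ++ [a]) ++ u' := by simp
      have e2 : v₀ ++ a :: v' = (v₀ ++ [a]) ++ v' := by simp
      obtain ⟨s1, -⟩ := descents_append_of_not_mem hM (f := f) (s := s) (x := u₀) (y := a :: u')
        (by rw [hc]; exact fun b hb hb' => hu₀ b hb (List.mem_append_left _ hb'))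
      obtain ⟨s2, s3⟩ := descents_append_of_not_mem hM (f := f) (s := s) (x := u₀ ++ [a]) (y := u')
        (by rw [← e1, hc]; exact hu₀)
      have hsub : ∀ c' d'', c' <+: c → d'' <:+ d' →
          ((c' ++ d'').Sublist u' ↔ (c' ++ d'').Sublist v') := by
        intro c' d'' hc' hd'
        cases c' with
        | nil => exact iff_of_true (hd'.sublist.trans h4) (hd'.sublist.trans h1')
        | cons b c' =>
          have hbc : b ∈ c.head? := by
            obtain ⟨r, rfl⟩ := hc'
            simp
          have h5 := h (b :: c') d'' hc' (hd'.trans (List.suffix_cons a d'))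
          rw [e1, e2, List.cons_append, cons_sublist_append_iff (hu₀ b hbc),
            cons_sublist_append_iff (hv₀ b hbc)] at h5
          exact h5
      obtain ⟨x, hx1, hx2⟩ := ih (c := c) (d := d') (u := u') (v := v') (s := s)
        (by rw [s3, ← e1, hc]) h1 hsub
        (by rw [List.length_cons] at hn; omega)
      refine ⟨a :: x, ?_, ?_⟩
      · have s4 : s * f a = s := by
          rw [List.map_append, List.prod_append, ← mul_assoc, s1] at s2
          simpa using s2
        rw [e1, List.map_append, List.prod_append, ← mul_assoc, s2, List.map_cons,
          List.prod_cons, ← mul_assoc, s4, hx1]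
      · rw [h2, hx2, List.map_cons, List.prod_cons]
    cases c with
    | nil =>
      cases d with
      | nil =>
        exact ih hc hd h (by simp)
      | cons a d' => exact right a d' rfl (by simp)
    | cons b c =>
      obtain ⟨u₀, u', rfl, hb, hu, hc'⟩ := exists_first_descent hM hc
      by_cases hbd : (b :: d).Sublist (u₀ ++ b :: u')
      · have hbv := (h [b] d ⟨c, rfl⟩ List.suffix_rfl).1 hbd
        obtain ⟨v₀, v', rfl, hb', hdv'⟩ := exists_first_occurrence hbv
        have e2 : v₀ ++ b :: v' = (v₀ ++ [b]) ++ v' := by simp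
        have h1 := suffixDescents_of_sublist (f := f) (x := v₀) (y := b :: v')
          (by rw [hd]; exact hdv'.cons _)
        have h2 := suffixDescents_of_sublist (f := f) (x := v₀ ++ [b]) (y := v')
          (by rw [← e2, hd]; exact hdv')
        obtain ⟨x, hx1, hx2⟩ := ih (c := c) (d := d) (u := u') (v := v') hc'
          (by rw [h2.1, ← e2, hd]) (fun c' d' hcc hdd => by
            have h3 := h (b :: c') d' (List.cons_prefix_cons.2 ⟨rfl, hcc⟩) hdd
            rwa [List.cons_append, cons_sublist_append_cons_iff hb,
              cons_sublist_append_cons_iff hb'] at h3)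
          (by rw [List.length_cons] at hn; omega)
        refine ⟨b :: x, ?_, ?_⟩
        · rw [hu, hx1, List.map_cons, List.prod_cons, mul_assoc]
        · rw [h1.2, List.map_cons, List.prod_cons, hx2, List.map_cons, List.prod_cons]
      · cases d with
        | nil => exact absurd ((List.cons_sublist_cons.2 (List.nil_sublist c)).trans hcu) hbd
        | cons a d' =>
          by_cases hab : b = a
          · subst hab
            obtain ⟨v₀, v', rfl, hb', hdv'⟩ := exists_first_occurrence hdv
            have h1 := suffixDescents_of_sublist (f := f) (x := v₀) (y := b :: v')
              (by rw [hd]; exact List.cons_sublist_cons.2 hdv')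
            have hd' : suffixDescents f v' = d' := by
              have h2 := h1.1
              rw [hd, suffixDescents] at h2
              split_ifs at h2
              -- If this first `b` were not itself a suffix descent, `b d'` would embed behind it
              -- and `b d` would fit into `v`, hence into `u`.
              · refine absurd ((h [b] (b :: d') ⟨c, rfl⟩ List.suffix_rfl).2 ?_) hbd
                refine (List.cons_sublist_cons.2 ?_).trans (List.sublist_append_right v₀ _)
                rw [← h2]
                exact suffixDescents_sublist f v'
              · exact (List.cons.inj h2).2
            obtain ⟨x, hx1, hx2⟩ := ih (c := c) (d := d') (u := u') (v := v') hc' hd'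
              (fun c' d'' hcc hdd => by
                have h3 := h (b :: c') d'' (List.cons_prefix_cons.2 ⟨rfl, hcc⟩)
                  (hdd.trans (List.suffix_cons b d'))
                rwa [List.cons_append, cons_sublist_append_cons_iff hb,
                  cons_sublist_append_cons_iff hb'] at h3)
              (by simp only [List.length_cons] at hn; omega)
            refine ⟨b :: x, ?_, ?_⟩
            · rw [hu, hx1, List.map_cons, List.prod_cons, mul_assoc]
            · rw [h1.2, List.map_cons, List.prod_cons, hx2, List.map_cons, List.prod_cons]
          · exact right a d' rfl (by
              intro b' hb'
              obtain rfl : b = b' := by simpa using hb'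
              exact ⟨hab, hbd⟩)

/-- Simon's theorem: words with the same subwords of bounded length have the same value in a finite
`𝒥`-trivial monoid. -/
theorem prod_eq_of_subEq (hM : classJ M) (f : A → M) {u v : List A}
    (h : SubEq (2 * Nat.card M) u v) : (u.map f).prod = (v.map f).prod := by
  have := hM.1
  -- The two kinds of descents number at most `|M|` each, which is where the bound `2 |M|` comes
  -- from.
  obtain ⟨x, h1, h2⟩ := exists_common_subword hM f (u := u) (v := v) (s := 1) rfl rfl
    (fun c d hc hd => h _ (by
      have h1 := hc.length_le.trans (length_descents_le f 1 u)
      have h2 := hd.length_le.trans (length_suffixDescents_le hM f v)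
      rw [List.length_append]
      omega))
  rw [h2, ← one_mul (u.map f).prod, h1, one_mul]

end Simon

/-! ### Definability in two-variable logic -/

namespace FO2

variable {A : Type}

/-- The negation normal form of the negation. -/
def neg : FO2 A → FO2 A
  | tru => fls
  | fls => tru
  | letter s a x => letter (!s) a x
  | less s x y => less (!s) x y
  | equal s x y => equal (!s) x y
  | and α β => or α.neg β.neg
  | or α β => and α.neg β.neg
  | ex x α => all x α.neg
  | all x α => ex x α.neg

theorem iff_not_eq_true (p : Prop) (s : Bool) : (p ↔ (!s) = true) ↔ ¬ (p ↔ s = true) := by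
  cases s <;> simp

theorem sat_neg (w : List A) (ν : Fin 2 → ℕ) (α : FO2 A) : Sat w ν α.neg ↔ ¬ Sat w ν α := by
  induction α generalizing ν with
  | tru => simp [neg, Sat]
  | fls => simp [neg, Sat]
  | letter s a x => exact iff_not_eq_true _ s
  | less s x y => exact iff_not_eq_true _ s
  | equal s x y => exact iff_not_eq_true _ s
  | and α β hα hβ => simp only [neg, Sat, hα, hβ]; tauto
  | or α β hα hβ => simp only [neg, Sat, hα, hβ]; tauto
  | ex x α hα => simp only [neg, Sat, hα]; push Not; rfl
  | all x α hα => simp only [neg, Sat, hα]; push Not; rfl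

theorem free_neg (α : FO2 A) : α.neg.free = α.free := by
  induction α with
  | and α β hα hβ => simp only [neg, free, hα, hβ]
  | or α β hα hβ => simp only [neg, free, hα, hβ]
  | ex x α hα => simp only [neg, free, hα]
  | all x α hα => simp only [neg, free, hα]
  | _ => rfl

theorem blocksFrom_neg (q : Option Bool) (α : FO2 A) :
    blocksFrom q α.neg = blocksFrom (q.map not) α := by
  induction α generalizing q with
  | and α β hα hβ => simp only [neg, blocksFrom, hα, hβ]
  | or α β hα hβ => simp only [neg, blocksFrom, hα, hβ]
  | ex x α hα => rcases q with _ | _ | _ <;> simp [neg, blocksFrom, hα]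
  | all x α hα => rcases q with _ | _ | _ <;> simp [neg, blocksFrom, hα]
  | _ => rcases q with _ | _ | _ <;> rfl

theorem blocks_neg (α : FO2 A) : α.neg.blocks = α.blocks := blocksFrom_neg none α

theorem blocksFrom_le_blocks (q : Option Bool) (α : FO2 A) : blocksFrom q α ≤ α.blocks := by
  rw [blocks]
  induction α with
  | and α β hα hβ => exact max_le_max hα hβ
  | or α β hα hβ => exact max_le_max hα hβ
  | ex x α hα => simp only [blocksFrom, reduceCtorEq, if_false]; split_ifs <;> omega
  | all x α hα => simp only [blocksFrom, reduceCtorEq, if_false]; split_ifs <;> omega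
  | _ => exact le_rfl

theorem sat_congr {w : List A} {ν ν' : Fin 2 → ℕ} {α : FO2 A} (h : ∀ x ∈ α.free, ν x = ν' x) :
    Sat w ν α ↔ Sat w ν' α := by
  have hq : ∀ {x : Fin 2} {β : FO2 A} {μ μ' : Fin 2 → ℕ}, (∀ y ∈ β.free \ {x}, μ y = μ' y) →
      ∀ i, ∀ y ∈ β.free, Function.update μ x i y = Function.update μ' x i y := by
    intro x β μ μ' h i y hy
    by_cases hyx : y = x
    · simp [hyx]
    · simp only [Function.update_of_ne hyx]
      exact h y ⟨hy, hyx⟩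
  induction α generalizing ν ν' with
  | tru => rfl
  | fls => rfl
  | letter s a x => simp only [Sat, h x (by simp [free])]
  | less s x y => simp only [Sat, h x (by simp [free]), h y (by simp [free])]
  | equal s x y => simp only [Sat, h x (by simp [free]), h y (by simp [free])]
  | and α β hα hβ =>
    exact and_congr (hα fun x hx => h x (Or.inl hx)) (hβ fun x hx => h x (Or.inr hx))
  | or α β hα hβ =>
    exact or_congr (hα fun x hx => h x (Or.inl hx)) (hβ fun x hx => h x (Or.inr hx))
  | ex x α hα => exact exists_congr fun i => and_congr_right fun _ => hα (hq h i)
  | all x α hα => exact forall_congr' fun i => imp_congr_right fun _ => hα (hq h i)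

/-- The predicate `P` on words with a valuation is defined by a formula with at most `n` blocks and
free variables in `S`. -/
def Definable (n : ℕ) (S : Set (Fin 2)) (P : List A → (Fin 2 → ℕ) → Prop) : Prop :=
  ∃ α : FO2 A, α.free ⊆ S ∧ α.blocks ≤ n ∧ ∀ w ν, Sat w ν α ↔ P w ν

variable {n m : ℕ} {S : Set (Fin 2)} {P Q : List A → (Fin 2 → ℕ) → Prop}

theorem Definable.mono (h : Definable n S P) (hnm : n ≤ m) : Definable m S P := by
  obtain ⟨α, h1, h2, h3⟩ := h
  exact ⟨α, h1, h2.trans hnm, h3⟩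

/-- `blocks` does not care whether the first quantifier is `∃` or `∀`, so negation is free and each
level is closed under Boolean combinations. -/
theorem Definable.not (h : Definable n S P) : Definable n S fun w ν => ¬ P w ν := by
  obtain ⟨α, h1, h2, h3⟩ := h
  exact ⟨α.neg, by rwa [free_neg], by rwa [blocks_neg], fun w ν => by rw [sat_neg, h3]⟩

theorem Definable.and (hP : Definable n S P) (hQ : Definable n S Q) :
    Definable n S fun w ν => P w ν ∧ Q w ν := by
  obtain ⟨α, h1, h2, h3⟩ := hP
  obtain ⟨β, h4, h5, h6⟩ := hQ
  exact ⟨.and α β, Set.union_subset h1 h4, max_le h2 h5, fun w ν => by simp only [Sat, h3, h6]⟩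

theorem Definable.or (hP : Definable n S P) (hQ : Definable n S Q) :
    Definable n S fun w ν => P w ν ∨ Q w ν := by
  obtain ⟨α, h1, h2, h3⟩ := hP
  obtain ⟨β, h4, h5, h6⟩ := hQ
  exact ⟨.or α β, Set.union_subset h1 h4, max_le h2 h5, fun w ν => by simp only [Sat, h3, h6]⟩

theorem Definable.const (p : Prop) : Definable n S fun (_ : List A) _ => p := by
  by_cases hp : p
  · exact ⟨.tru, by simp [free], by simp [blocks, blocksFrom], by simp [Sat, hp]⟩
  · exact ⟨.fls, by simp [free], by simp [blocks, blocksFrom], by simp [Sat, hp]⟩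

theorem Definable.congr (hP : Definable n S P) (h : ∀ w ν, P w ν ↔ Q w ν) : Definable n S Q := by
  obtain ⟨α, h1, h2, h3⟩ := hP
  exact ⟨α, h1, h2, fun w ν => (h3 w ν).trans (h w ν)⟩

theorem Definable.exists_mem {ι : Type*} {T : Set ι} (hT : T.Finite)
    {R : ι → List A → (Fin 2 → ℕ) → Prop} (h : ∀ i, Definable n S (R i)) :
    Definable n S fun w ν => ∃ i ∈ T, R i w ν := by
  induction T, hT using Set.Finite.induction_on with
  | empty => exact (Definable.const False).congr (by simp)
  | @insert a T _ _ ih => exact ((h a).or ih).congr (by simp)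

theorem Definable.forall {ι : Type*} [Finite ι]
    {R : ι → List A → (Fin 2 → ℕ) → Prop} (h : ∀ i, Definable n S (R i)) :
    Definable n S fun w ν => ∀ i, R i w ν := by
  refine ((Definable.exists_mem (Set.toFinite Set.univ) fun i => (h i).not).not).congr fun w ν => ?_
  simp

/-- A predicate whose truth is determined by finitely many definable predicates is definable. -/
theorem Definable.of_determined {ι : Type*} [Finite ι]
    {R : ι → List A → (Fin 2 → ℕ) → Prop} (h : ∀ i, Definable n S (R i))
    (hP : ∀ w ν w' ν', (∀ i, R i w ν ↔ R i w' ν') → P w ν → P w' ν') : Definable n S P := by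
  have h1 : ∀ s : Set ι, Definable n S fun w ν => ∀ i, (R i w ν ↔ i ∈ s) := fun s =>
    Definable.forall fun i => by
      by_cases hi : i ∈ s
      · exact (h i).congr (by simp [hi])
      · exact (h i).not.congr (by simp [hi])
  refine (Definable.exists_mem
    (Set.toFinite {s : Set ι | ∃ w ν, P w ν ∧ ∀ i, (R i w ν ↔ i ∈ s)}) h1).congr fun w ν => ?_
  constructor
  · rintro ⟨s, ⟨w', ν', h2, h3⟩, h4⟩
    exact hP w' ν' w ν (fun i => (h3 i).trans (h4 i).symm) h2
  · exact fun h2 => ⟨{i | R i w ν}, ⟨w, ν, h2, fun _ => Iff.rfl⟩, fun _ => Iff.rfl⟩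

/-! ### Subword formulas -/

/-- `l` is a subword of the part of the word after `x`. -/
def after : Fin 2 → List A → FO2 A
  | _, [] => tru
  | x, a :: l => ex (x + 1) (and (less true x (x + 1)) (and (letter true a (x + 1))
      (after (x + 1) l)))

/-- The reverse of `l` is a subword of the part of the word before `x`. -/
def before : Fin 2 → List A → FO2 A
  | _, [] => tru
  | x, a :: l => ex (x + 1) (and (less true (x + 1) x) (and (letter true a (x + 1))
      (before (x + 1) l)))

theorem fin_two_ne (x : Fin 2) : x ≠ x + 1 := by fin_cases x <;> decide

theorem fin_two_eq_of_ne {x y : Fin 2} (h : y ≠ x) : y = x + 1 := by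
  revert x y
  decide

theorem cons_sublist_drop_iff {a : A} {l w : List A} {m : ℕ} :
    (a :: l).Sublist (w.drop m) ↔
      ∃ i < w.length, m ≤ i ∧ w[i]? = some a ∧ l.Sublist (w.drop (i + 1)) := by
  constructor
  · intro h
    obtain ⟨x, y, hxy, -, hy⟩ := exists_first_occurrence h
    have hlen := congrArg List.length hxy
    simp only [List.length_drop, List.length_append, List.length_cons] at hlen
    refine ⟨m + x.length, by omega, by omega, ?_, ?_⟩
    · rw [← List.getElem?_drop, hxy]
      simp
    · rw [add_assoc, ← List.drop_drop, hxy]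
      simpa using hy
  · rintro ⟨i, hi, hmi, ha, hl⟩
    obtain ⟨j, rfl⟩ := Nat.exists_eq_add_of_le hmi
    rw [List.getElem?_eq_getElem hi, Option.some_inj] at ha
    have h1 : (w.drop (m + j)) = a :: w.drop (m + j + 1) := by
      rw [← ha, List.drop_eq_getElem_cons hi]
    have h2 : (a :: l).Sublist (w.drop (m + j)) := by
      rw [h1]
      exact List.cons_sublist_cons.2 hl
    rw [← List.drop_drop] at h2
    exact h2.trans (List.drop_sublist _ _)

theorem concat_sublist_take_iff {a : A} {l w : List A} {m : ℕ} :
    (l ++ [a]).Sublist (w.take m) ↔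
      ∃ i < w.length, i < m ∧ w[i]? = some a ∧ l.Sublist (w.take i) := by
  constructor
  · intro h
    rw [List.append_sublist_iff] at h
    obtain ⟨x, y, hxy, hx, hy⟩ := h
    obtain ⟨s, t, rfl⟩ := List.append_of_mem (List.singleton_sublist.1 hy)
    have hlen := congrArg List.length hxy
    simp only [List.length_take, List.length_append, List.length_cons] at hlen
    have hi : x.length + s.length < w.length := by omega
    have hm : x.length + s.length < m := by omega
    refine ⟨x.length + s.length, hi, hm, ?_, ?_⟩
    · rw [← List.getElem?_take_of_lt hm, hxy]
      simp
    · have : w.take (x.length + s.length) = x ++ s := by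
        have h1 := congrArg (List.take (x.length + s.length)) hxy
        rw [List.take_take, min_eq_left hm.le] at h1
        rw [h1, ← List.append_assoc, ← List.length_append, List.take_left]
      rw [this]
      exact hx.trans (List.sublist_append_left _ _)
  · rintro ⟨i, hi, him, ha, hl⟩
    rw [List.getElem?_eq_getElem hi, Option.some_inj] at ha
    have h1 : w.take (i + 1) = w.take i ++ [a] := by
      rw [← ha, List.take_succ_eq_append_getElem hi]
    have h2 : (l ++ [a]).Sublist (w.take (i + 1)) := by
      rw [h1]
      exact hl.append_right [a]
    have h3 : (w.take (i + 1)).Sublist (w.take m) := by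
      rw [show i + 1 = min (i + 1) m by omega, ← List.take_take]
      exact List.take_sublist _ _
    exact h2.trans h3

/-- Two variables taking turns suffice, as only the last position found has to be remembered; in
`Fin 2` the other variable is `x + 1`. -/
theorem sat_after {w : List A} {ν : Fin 2 → ℕ} {x : Fin 2} {l : List A} :
    Sat w ν (after x l) ↔ l.Sublist (w.drop (ν x + 1)) := by
  induction l generalizing ν x with
  | nil => simp [after, Sat]
  | cons a l ih =>
    rw [cons_sublist_drop_iff]
    simp only [after, Sat, ih, Function.update_self, Function.update_of_ne (fin_two_ne x), iff_true,
      Nat.succ_le_iff]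

theorem sat_before {w : List A} {ν : Fin 2 → ℕ} {x : Fin 2} {l : List A} :
    Sat w ν (before x l) ↔ l.reverse.Sublist (w.take (ν x)) := by
  induction l generalizing ν x with
  | nil => simp [before, Sat]
  | cons a l ih =>
    rw [List.reverse_cons, concat_sublist_take_iff]
    simp only [before, Sat, ih, Function.update_self, Function.update_of_ne (fin_two_ne x), iff_true]

theorem free_after (x : Fin 2) (l : List A) : (after x l).free ⊆ {x} := by
  cases l with
  | nil => simp [after, free]
  | cons a l =>
    intro y hy
    by_contra h
    exact hy.2 (fin_two_eq_of_ne h)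

theorem free_before (x : Fin 2) (l : List A) : (before x l).free ⊆ {x} := by
  cases l with
  | nil => simp [before, free]
  | cons a l =>
    intro y hy
    by_contra h
    exact hy.2 (fin_two_eq_of_ne h)

theorem blocksFrom_after (x : Fin 2) (l : List A) : blocksFrom (some true) (after x l) = 0 := by
  induction l generalizing x with
  | nil => rfl
  | cons a l ih => simp [after, blocksFrom, ih]

theorem blocksFrom_before (x : Fin 2) (l : List A) : blocksFrom (some true) (before x l) = 0 := by
  induction l generalizing x with
  | nil => rfl
  | cons a l ih => simp [before, blocksFrom, ih]

theorem definable_after (x : Fin 2) (l : List A) :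
    Definable 1 {x} fun w ν => l.Sublist (w.drop (ν x + 1)) := by
  refine ⟨after x l, free_after x l, ?_, fun w ν => sat_after⟩
  cases l with
  | nil => simp [after, blocks, blocksFrom]
  | cons a l => simp [after, blocks, blocksFrom, blocksFrom_after]

theorem definable_before (x : Fin 2) (l : List A) :
    Definable 1 {x} fun w ν => l.Sublist (w.take (ν x)) := by
  -- `before` scans from right to left and therefore needs the reversed word.
  refine ⟨before x l.reverse, free_before x _, ?_, fun w ν => by
    rw [sat_before, List.reverse_reverse]⟩
  cases l.reverse with
  | nil => simp [before, blocks, blocksFrom]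
  | cons a l => simp [before, blocks, blocksFrom, blocksFrom_before]

theorem definable_sublist (l : List A) : Definable 1 ∅ fun w _ => l.Sublist w := by
  cases l with
  | nil => exact (Definable.const True).congr (by simp)
  | cons a l =>
    refine ⟨ex 0 (and (letter true a 0) (after 0 l)), ?_, ?_, fun w ν => ?_⟩
    · intro y hy
      rcases hy with ⟨h1 | h1, h2⟩
      · exact h2 h1
      · exact h2 (free_after 0 l h1)
    · simp [blocks, blocksFrom, blocksFrom_after]
    · have := cons_sublist_drop_iff (a := a) (l := l) (w := w) (m := 0)
      rw [List.drop_zero] at this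
      simp [Sat, sat_after, this]

end FO2

/-! ### Languages recognized by the levels are definable -/

section Definability

variable {A : Type}

instance finite_short_words (A : Type*) [Finite A] (k : ℕ) : Finite {l : List A // l.length ≤ k} :=
  List.finite_length_le A k

theorem map_ofList_eq_of_subEq {M : Type} [Monoid M] (hM : classJ M) (φ : FreeMonoid A →* M)
    {u v : List A} (h : SubEq (2 * Nat.card M) u v) :
    φ (FreeMonoid.ofList u) = φ (FreeMonoid.ofList v) := by
  rw [apply_eq_prod, apply_eq_prod]
  exact prod_eq_of_subEq hM _ h

/-- There are finitely many words of length at most `k`, so an invariant of the subword congruence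
is a Boolean combination of subword tests. Here `g` stands for the whole word or for its part before
or after a position. -/
theorem definable_of_subEq [Finite A] {n k : ℕ} {S : Set (Fin 2)} (g : List A → (Fin 2 → ℕ) → List A)
    (hg : ∀ l : List A, FO2.Definable n S fun w ν => l.Sublist (g w ν)) {P : List A → Prop}
    (hP : ∀ u v, SubEq k u v → P u → P v) : FO2.Definable n S fun w ν => P (g w ν) :=
  FO2.Definable.of_determined (ι := {l : List A // l.length ≤ k}) (fun l => hg l.1)
    fun _ _ _ _ h => hP _ _ fun l hl => h ⟨l, hl⟩

theorem definable_map_eq [Finite A] {M : Type} [Monoid M] (hM : classJ M) (φ : FreeMonoid A →* M) {n : ℕ}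
    {S : Set (Fin 2)} (g : List A → (Fin 2 → ℕ) → List A)
    (hg : ∀ l : List A, FO2.Definable n S fun w ν => l.Sublist (g w ν)) (m : M) :
    FO2.Definable n S fun w ν => φ (FreeMonoid.ofList (g w ν)) = m :=
  definable_of_subEq (k := 2 * Nat.card M) g hg (P := fun u => φ (FreeMonoid.ofList u) = m)
    fun u v h hu => by rw [← map_ofList_eq_of_subEq hM φ h, hu]

theorem getElem?_transduceFrom {A N : Type u} [Monoid N] (ψ : FreeMonoid A →* N) (p : N)
    (w : List A) (i : ℕ) : (transduceFrom ψ p w)[i]? = w[i]?.map fun a =>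
      (p * ψ (FreeMonoid.ofList (w.take i)), a, ψ (FreeMonoid.ofList (w.drop (i + 1)))) := by
  induction w generalizing p i with
  | nil => simp [transduceFrom]
  | cons a w ih =>
    cases i with
    | zero => simp [transduceFrom]
    | succ i =>
      rw [transduceFrom, List.getElem?_cons_succ, ih]
      simp [FreeMonoid.ofList_cons, mul_assoc]

theorem length_transduceFrom {A N : Type u} [Monoid N] (ψ : FreeMonoid A →* N) (p : N)
    (w : List A) : (transduceFrom ψ p w).length = w.length := by
  induction w generalizing p with
  | nil => rfl
  | cons a w ih => simp [transduceFrom, ih]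

/-- Substitution of formulas for letters. -/
def FO2.subst {B : Type} (χ : B → Fin 2 → FO2 A) : FO2 B → FO2 A
  | .tru => .tru
  | .fls => .fls
  | .letter s b x => if s then χ b x else (χ b x).neg
  | .less s x y => .less s x y
  | .equal s x y => .equal s x y
  | .and α β => .and (α.subst χ) (β.subst χ)
  | .or α β => .or (α.subst χ) (β.subst χ)
  | .ex x α => .ex x (α.subst χ)
  | .all x α => .all x (α.subst χ)

theorem FO2.free_subst {B : Type} {χ : B → Fin 2 → FO2 A} (hχ : ∀ b x, (χ b x).free ⊆ {x})
    (α : FO2 B) : (α.subst χ).free ⊆ α.free := by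
  induction α with
  | letter s b x =>
    cases s
    · exact (FO2.free_neg _).trans_subset (hχ b x)
    · exact hχ b x
  | and α β hα hβ => exact Set.union_subset_union hα hβ
  | or α β hα hβ => exact Set.union_subset_union hα hβ
  | ex x α hα => exact Set.sdiff_subset_sdiff_left hα
  | all x α hα => exact Set.sdiff_subset_sdiff_left hα
  | _ => exact le_rfl

/-- Letters are leaves of the parse tree, so each path meets at most one substituted formula. -/
theorem FO2.blocksFrom_subst {B : Type} {χ : B → Fin 2 → FO2 A} (hχ : ∀ b x, (χ b x).blocks ≤ 1)
    (q : Option Bool) (α : FO2 B) : FO2.blocksFrom q (α.subst χ) ≤ FO2.blocksFrom q α + 1 := by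
  induction α generalizing q with
  | letter s b x =>
    cases s
    · simp only [FO2.subst, FO2.blocksFrom]
      exact (FO2.blocksFrom_le_blocks q _).trans (by simpa [FO2.blocks_neg] using hχ b x)
    · simp only [FO2.subst, FO2.blocksFrom]
      exact (FO2.blocksFrom_le_blocks q _).trans (by simpa using hχ b x)
  | and α β hα hβ =>
    have h1 := hα q
    have h2 := hβ q
    simp only [FO2.subst, FO2.blocksFrom]
    omega
  | or α β hα hβ =>
    have h1 := hα q
    have h2 := hβ q
    simp only [FO2.subst, FO2.blocksFrom]
    omega
  | ex x α hα =>
    have := hα (some true)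
    simp only [FO2.subst, FO2.blocksFrom]
    omega
  | all x α hα =>
    have := hα (some false)
    simp only [FO2.subst, FO2.blocksFrom]
    omega
  | _ => simp [FO2.subst, FO2.blocksFrom]

theorem FO2.sat_subst {B : Type} {χ : B → Fin 2 → FO2 A} {w : List A} {w' : List B}
    (hlen : w.length = w'.length)
    (hχ : ∀ b x ν, FO2.Sat w ν (χ b x) ↔ w'[ν x]? = some b) (ν : Fin 2 → ℕ) (α : FO2 B) :
    FO2.Sat w ν (α.subst χ) ↔ FO2.Sat w' ν α := by
  induction α generalizing ν with
  | letter s b x => cases s <;> simp [FO2.subst, FO2.Sat, FO2.sat_neg, hχ]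
  | and α β hα hβ => simp only [FO2.subst, FO2.Sat, hα, hβ]
  | or α β hα hβ => simp only [FO2.subst, FO2.Sat, hα, hβ]
  | ex x α hα => simp only [FO2.subst, FO2.Sat, hα, hlen]
  | all x α hα => simp only [FO2.subst, FO2.Sat, hα, hlen]
  | _ => rfl

/-- Definable languages of transduced words are definable, with one more block. -/
theorem definable_transduce [Finite A] {N : Type} [Monoid N] (hN : classJ N) (ψ : FreeMonoid A →* N)
    {n : ℕ} {P : List (N × A × N) → Prop} (hP : FO2.Definable n ∅ fun w _ => P w) :
    FO2.Definable (n + 1) ∅ fun w _ => P (transduceFrom ψ 1 w) := by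
  -- A transduced letter prescribes the letter at `x` and the `N`-values of the parts before and
  -- after `x`; by Simon's theorem these values are visible with one block.
  have hletter : ∀ (σ : N × A × N) (x : Fin 2), FO2.Definable 1 {x} fun (w : List A) ν =>
      (transduceFrom ψ 1 w)[ν x]? = some σ := by
    intro σ x
    have h1 := definable_map_eq hN ψ (fun w ν => w.take (ν x))
      (fun l => FO2.definable_before x l) σ.1
    have h2 := definable_map_eq hN ψ (fun w ν => w.drop (ν x + 1))
      (fun l => FO2.definable_after x l) σ.2.2
    have h3 : FO2.Definable 1 {x} fun (w : List A) ν => w[ν x]? = some σ.2.1 :=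
      ⟨.letter true σ.2.1 x, le_rfl, by simp [FO2.blocks, FO2.blocksFrom], by simp [FO2.Sat]⟩
    refine ((h1.and h2).and h3).congr fun w ν => ?_
    rw [getElem?_transduceFrom, one_mul]
    obtain ⟨p, a, q⟩ := σ
    simp only [Option.map_eq_some_iff, Prod.mk.injEq]
    constructor
    · rintro ⟨⟨k1, k2⟩, k3⟩
      exact ⟨a, k3, k1, rfl, k2⟩
    · rintro ⟨b, k3, k1, rfl, k2⟩
      exact ⟨⟨k1, k2⟩, k3⟩
  choose χ hχ1 hχ2 hχ3 using hletter
  obtain ⟨α, h1, h2, h3⟩ := hP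
  refine ⟨α.subst χ, (FO2.free_subst hχ1 α).trans h1,
    (FO2.blocksFrom_subst hχ2 none α).trans (Nat.add_le_add_right h2 1), fun w ν => ?_⟩
  rw [FO2.sat_subst (length_transduceFrom ψ 1 w).symm (fun b x ν => hχ3 b x w ν), h3]

/-- The value `φ(w)` is determined by `ψ(w)`, which costs one block, and by the `K`-value of the
transduced word, which costs one block more than level `n`. `FactorsThrough.of_surjective` allows an
arbitrary `φ`. -/
theorem definable_of_levelV {n : ℕ} (hn : 1 ≤ n) {A M : Type} [Finite A] [Monoid M]
    (hM : levelV n M) (φ : FreeMonoid A →* M) (m : M) :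
    FO2.Definable n ∅ fun w _ => φ (FreeMonoid.ofList w) = m := by
  induction n, hn using Nat.le_induction generalizing A M with
  | base => exact definable_map_eq hM φ (fun w _ => w) FO2.definable_sublist m
  | succ n hn ih =>
    obtain ⟨k, rfl⟩ := Nat.exists_eq_add_of_le' hn
    obtain ⟨hfin, B, _, φ', hφ', hfac⟩ := hM
    obtain ⟨N, _, K, _, hfN, hfK, hN, hK, ψ, h, H⟩ := hfac.of_surjective hφ' φ
    refine FO2.Definable.of_determined (ι := N ⊕ K)
      (R := Sum.elim (fun p w _ => ψ (FreeMonoid.ofList w) = p)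
        (fun κ w _ => h (transduce ψ (FreeMonoid.ofList w)) = κ)) ?_ ?_
    · rintro (p | κ)
      · exact (definable_map_eq hN ψ (fun w _ => w) FO2.definable_sublist p).mono (by omega)
      · exact definable_transduce hN ψ (ih hK h κ)
    · intro w _ w' _ h1 h2
      subst h2
      exact H _ _ ((h1 (Sum.inl (ψ (FreeMonoid.ofList w)))).1 rfl)
        ((h1 (Sum.inr (h (transduce ψ (FreeMonoid.ofList w))))).1 rfl)

end Definability

/-! ### One block of quantifiers is determined by subwords -/

namespace FO2

variable {A : Type}

theorem neg_neg (α : FO2 A) : α.neg.neg = α := by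
  induction α with
  | and α β hα hβ => simp only [neg, hα, hβ]
  | or α β hα hβ => simp only [neg, hα, hβ]
  | ex x α hα => simp only [neg, hα]
  | all x α hα => simp only [neg, hα]
  | _ => simp [neg]

theorem insert_free_subset {x : Fin 2} {α : FO2 A} {S : Set (Fin 2)} (h : α.free \ {x} ⊆ S) :
    α.free ⊆ insert x S := by
  rwa [Set.sdiff_subset_iff, Set.singleton_union] at h

/-- The truth of an existential formula is witnessed by boundedly many positions, and is preserved
under order-preserving and letter-preserving maps defined on them. -/
theorem exists_witness {α : FO2 A} (hα : blocksFrom (some true) α = 0) {S : Set (Fin 2)}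
    (hS : α.free ⊆ S) : ∃ k, ∀ (w : List A) (ν : Fin 2 → ℕ), Sat w ν α →
      (∀ x ∈ S, ν x < w.length) → ∃ P : Finset ℕ, P.card ≤ k ∧ (∀ i ∈ P, i < w.length) ∧
        ∀ (w' : List A) (g : ℕ → ℕ), (∀ i ∈ (P : Set ℕ) ∪ ν '' S, w'[g i]? = w[i]?) →
          StrictMonoOn g ((P : Set ℕ) ∪ ν '' S) → Sat w' (g ∘ ν) α := by
  induction α generalizing S with
  | tru => exact ⟨0, fun w ν _ _ => ⟨∅, by simp [Sat]⟩⟩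
  | fls => exact ⟨0, fun w ν h _ => h.elim⟩
  | letter s a x =>
    refine ⟨0, fun w ν h _ => ⟨∅, le_rfl, by simp, fun w' g hg _ => ?_⟩⟩
    simp only [Sat, Function.comp_apply] at h ⊢
    rwa [hg _ (Or.inr ⟨x, hS rfl, rfl⟩)]
  | less s x y =>
    refine ⟨0, fun w ν h _ => ⟨∅, le_rfl, by simp, fun w' g _ hg => ?_⟩⟩
    simp only [Sat, Function.comp_apply] at h ⊢
    rwa [hg.lt_iff_lt (Or.inr ⟨x, hS (Or.inl rfl), rfl⟩) (Or.inr ⟨y, hS (Or.inr rfl), rfl⟩)]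
  | equal s x y =>
    refine ⟨0, fun w ν h _ => ⟨∅, le_rfl, by simp, fun w' g _ hg => ?_⟩⟩
    simp only [Sat, Function.comp_apply] at h ⊢
    rwa [hg.injOn.eq_iff (Or.inr ⟨x, hS (Or.inl rfl), rfl⟩) (Or.inr ⟨y, hS (Or.inr rfl), rfl⟩)]
  | and α β iα iβ =>
    simp only [blocksFrom, Nat.max_eq_zero_iff] at hα
    obtain ⟨k, hk⟩ := iα hα.1 ((Set.subset_union_left).trans hS)
    obtain ⟨l, hl⟩ := iβ hα.2 ((Set.subset_union_right).trans hS)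
    refine ⟨k + l, fun w ν h hν => ?_⟩
    obtain ⟨P, hP1, hP2, hP3⟩ := hk w ν h.1 hν
    obtain ⟨Q, hQ1, hQ2, hQ3⟩ := hl w ν h.2 hν
    have s1 : (P : Set ℕ) ∪ ν '' S ⊆ ((P ∪ Q : Finset ℕ) : Set ℕ) ∪ ν '' S := by
      rw [Finset.coe_union]
      exact Set.union_subset_union_left _ Set.subset_union_left
    have s2 : (Q : Set ℕ) ∪ ν '' S ⊆ ((P ∪ Q : Finset ℕ) : Set ℕ) ∪ ν '' S := by
      rw [Finset.coe_union]
      exact Set.union_subset_union_left _ Set.subset_union_right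
    refine ⟨P ∪ Q, (Finset.card_union_le P Q).trans (Nat.add_le_add hP1 hQ1), fun i hi => ?_,
      fun w' g hg1 hg2 => ⟨hP3 w' g (fun i hi => hg1 i (s1 hi)) (hg2.mono s1),
        hQ3 w' g (fun i hi => hg1 i (s2 hi)) (hg2.mono s2)⟩⟩
    rcases Finset.mem_union.1 hi with hi | hi
    exacts [hP2 i hi, hQ2 i hi]
  | or α β iα iβ =>
    simp only [blocksFrom, Nat.max_eq_zero_iff] at hα
    obtain ⟨k, hk⟩ := iα hα.1 ((Set.subset_union_left).trans hS)
    obtain ⟨l, hl⟩ := iβ hα.2 ((Set.subset_union_right).trans hS)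
    refine ⟨k + l, fun w ν h hν => ?_⟩
    rcases h with h | h
    · obtain ⟨P, hP1, hP2, hP3⟩ := hk w ν h hν
      exact ⟨P, by omega, hP2, fun w' g hg1 hg2 => Or.inl (hP3 w' g hg1 hg2)⟩
    · obtain ⟨P, hP1, hP2, hP3⟩ := hl w ν h hν
      exact ⟨P, by omega, hP2, fun w' g hg1 hg2 => Or.inr (hP3 w' g hg1 hg2)⟩
  | ex x α iα =>
    simp only [blocksFrom, if_true, zero_add] at hα
    obtain ⟨k, hk⟩ := iα hα (insert_free_subset hS)
    refine ⟨k + 1, fun w ν h hν => ?_⟩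
    obtain ⟨i, hi, h⟩ := h
    obtain ⟨P, hP1, hP2, hP3⟩ := hk w _ h (by
      rintro y (rfl | hy)
      · simpa using hi
      · by_cases hyx : y = x
        · simpa [hyx] using hi
        · simpa [hyx] using hν y hy)
    have s1 : (P : Set ℕ) ∪ Function.update ν x i '' insert x S ⊆
        ((insert i P : Finset ℕ) : Set ℕ) ∪ ν '' S := by
      rintro j (hj | ⟨y, hy, rfl⟩)
      · exact Or.inl (by simpa using Or.inr hj)
      · by_cases hyx : y = x
        · left
          simp [hyx]
        · right
          exact ⟨y, hy.resolve_left hyx, by simp [hyx]⟩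
    refine ⟨insert i P, (Finset.card_insert_le i P).trans (Nat.add_le_add_right hP1 1), ?_,
      fun w' g hg1 hg2 => ?_⟩
    · simpa using ⟨hi, hP2⟩
    · have h1 := hP3 w' g (fun j hj => hg1 j (s1 hj)) (hg2.mono s1)
      rw [Function.comp_update] at h1
      refine ⟨g i, ?_, h1⟩
      have h2 := hg1 i (Or.inl (by simp))
      rw [List.getElem?_eq_getElem hi] at h2
      exact (List.getElem?_eq_some_iff.1 h2).1
  | all x α iα => simp [blocksFrom] at hα

/-- `l` is the word read off at the positions in `P`; an occurrence of `l` in `w'` tells where to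
send them. -/
theorem exists_embedding_word (w : List A) (P : Finset ℕ) (hP : ∀ i ∈ P, i < w.length) :
    ∃ l : List A, l.length ≤ P.card ∧ l.Sublist w ∧ ∀ w' : List A, l.Sublist w' →
      ∃ g : ℕ → ℕ, StrictMonoOn g P ∧ ∀ i ∈ P, w'[g i]? = w[i]? := by
  induction w generalizing P with
  | nil =>
    obtain rfl : P = ∅ := Finset.eq_empty_of_forall_notMem fun i hi => by simpa using hP i hi
    exact ⟨[], by simp, by simp, fun _ _ => ⟨id, by simp [StrictMonoOn]⟩⟩
  | cons a w ih =>
    set P' := (P.erase 0).image (· - 1) with hP'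
    have hmem : ∀ i, i ∈ P' ↔ i + 1 ∈ P := by
      intro i
      simp only [hP', Finset.mem_image, Finset.mem_erase]
      constructor
      · rintro ⟨j, ⟨h0, hj⟩, rfl⟩
        rwa [Nat.sub_add_cancel (Nat.one_le_iff_ne_zero.2 h0)]
      · exact fun h => ⟨i + 1, ⟨by omega, h⟩, by omega⟩
    obtain ⟨l, hl1, hl2, hl3⟩ := ih P' fun i hi => by
      have := hP _ ((hmem i).1 hi)
      simpa using this
    have hcard : P'.card ≤ (P.erase 0).card := Finset.card_image_le
    by_cases h0 : 0 ∈ P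
    · refine ⟨a :: l, ?_, hl2.cons_cons a, fun w' hw' => ?_⟩
      · have h1 := Finset.card_erase_add_one h0
        rw [List.length_cons]
        omega
      · obtain ⟨x, y, rfl, -, hy⟩ := exists_first_occurrence hw'
        obtain ⟨g, hg1, hg2⟩ := hl3 y hy
        -- Position `0` goes to the first `a` of `w'`, and the remaining positions are embedded
        -- behind it.
        refine ⟨fun i => Nat.casesOn i x.length fun j => x.length + (1 + g j), ?_, ?_⟩
        · rintro (_ | i) hi (_ | j) hj hij
          · omega
          · show x.length < x.length + (1 + g j)
            omega
          · omega
          · have := hg1 ((hmem i).2 hi) ((hmem j).2 hj) (by omega)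
            show x.length + (1 + g i) < x.length + (1 + g j)
            omega
        · rintro (_ | i) hi
          · simp
          · have := hg2 i ((hmem i).2 hi)
            show (x ++ a :: y)[x.length + (1 + g i)]? = _
            rw [List.getElem?_append_right (by omega), Nat.add_sub_cancel_left, Nat.add_comm 1,
              List.getElem?_cons_succ, List.getElem?_cons_succ, this]
    · refine ⟨l, ?_, hl2.cons a, fun w' hw' => ?_⟩
      · rw [Finset.erase_eq_of_notMem h0] at hcard
        omega
      · obtain ⟨g, hg1, hg2⟩ := hl3 w' hw'
        refine ⟨fun i => Nat.casesOn i 0 g, ?_, ?_⟩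
        · rintro (_ | i) hi (_ | j) hj hij
          · omega
          · exact absurd hi h0
          · omega
          · exact hg1 ((hmem i).2 hi) ((hmem j).2 hj) (by omega)
        · rintro (_ | i) hi
          · exact absurd hi h0
          · simpa using hg2 i ((hmem i).2 hi)

theorem exists_embedding {k : ℕ} {w w' : List A} (h : SubEq k w w') (P : Finset ℕ)
    (hP : ∀ i ∈ P, i < w.length) (hk : P.card ≤ k) :
    ∃ g : ℕ → ℕ, StrictMonoOn g P ∧ ∀ i ∈ P, w'[g i]? = w[i]? := by
  obtain ⟨l, h1, h2, h3⟩ := exists_embedding_word w P hP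
  exact h3 w' ((h l (h1.trans hk)).1 h2)

/-- The positions on either side of `i` are embedded separately, and the two maps are glued at `i ↦
i'`. -/
theorem exists_pointed_embedding {k : ℕ} {w w' : List A} {i i' : ℕ} (hi : i < w.length)
    (hi' : w'[i']? = w[i]?) (h1 : SubEq k (w.take i) (w'.take i'))
    (h2 : SubEq k (w.drop (i + 1)) (w'.drop (i' + 1))) (P : Finset ℕ)
    (hP : ∀ i ∈ P, i < w.length) (hk : P.card ≤ k) :
    ∃ g : ℕ → ℕ, StrictMonoOn g (insert i (P : Set ℕ)) ∧ g i = i' ∧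
      ∀ j ∈ insert i (P : Set ℕ), w'[g j]? = w[j]? := by
  obtain ⟨g₁, hg₁, hg₁'⟩ := exists_embedding h1 (P.filter (· < i)) (fun j hj => by
    rw [Finset.mem_filter] at hj
    rw [List.length_take]
    omega) ((Finset.card_filter_le _ _).trans hk)
  obtain ⟨g₂, hg₂, hg₂'⟩ := exists_embedding h2 ((P.filter (i < ·)).image (· - (i + 1)))
    (fun j hj => by
      simp only [Finset.mem_image, Finset.mem_filter] at hj
      obtain ⟨j, ⟨hj1, hj2⟩, rfl⟩ := hj
      have := hP j hj1
      rw [List.length_drop]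
      omega) (Finset.card_image_le.trans ((Finset.card_filter_le _ _).trans hk))
  have m1 : ∀ j, j ∈ P → j < i → j ∈ P.filter (· < i) := fun j h h' => Finset.mem_filter.2 ⟨h, h'⟩
  have m2 : ∀ j, j ∈ P → i < j → j - (i + 1) ∈ (P.filter (i < ·)).image (· - (i + 1)) :=
    fun j h h' => Finset.mem_image.2 ⟨j, Finset.mem_filter.2 ⟨h, h'⟩, rfl⟩
  have b1 : ∀ j, j ∈ P → j < i → g₁ j < i' ∧ w'[g₁ j]? = w[j]? := by
    intro j hj hji
    have h3 := hg₁' j (m1 j hj hji)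
    rw [List.getElem?_take_of_lt hji, List.getElem?_eq_getElem (hP j hj)] at h3
    have h4 := (List.getElem?_eq_some_iff.1 h3).1
    rw [List.length_take] at h4
    have h5 : g₁ j < i' := by omega
    rw [List.getElem?_take_of_lt h5] at h3
    exact ⟨h5, by rw [h3, List.getElem?_eq_getElem]⟩
  refine ⟨fun j => if j < i then g₁ j else if j = i then i' else i' + 1 + g₂ (j - (i + 1)),
    ?_, by simp, ?_⟩
  · have hlow : ∀ j ∈ insert i (P : Set ℕ), j < i → j ∈ P := fun j hj h =>
      (Set.mem_insert_iff.1 hj).resolve_left (by omega)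
    have hhigh : ∀ j ∈ insert i (P : Set ℕ), i < j → j ∈ P := fun j hj h =>
      (Set.mem_insert_iff.1 hj).resolve_left (by omega)
    intro a ha b hb hab
    dsimp only
    rcases lt_trichotomy a i with hai | hai | hai <;> rcases lt_trichotomy b i with hbi | hbi | hbi
    · rw [if_pos hai, if_pos hbi]
      exact hg₁ (m1 a (hlow a ha hai) hai) (m1 b (hlow b hb hbi) hbi) hab
    · rw [if_pos hai, if_neg (by omega), if_pos hbi]
      exact (b1 a (hlow a ha hai) hai).1
    · rw [if_pos hai, if_neg (by omega), if_neg (by omega)]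
      have := (b1 a (hlow a ha hai) hai).1
      omega
    · omega
    · omega
    · rw [if_neg (by omega), if_pos hai, if_neg (by omega), if_neg (by omega)]
      omega
    · omega
    · omega
    · rw [if_neg (by omega), if_neg (by omega), if_neg (by omega), if_neg (by omega)]
      have := hg₂ (m2 a (hhigh a ha hai) hai) (m2 b (hhigh b hb hbi) hbi) (by omega)
      omega
  · intro j hj
    dsimp only
    rcases lt_trichotomy j i with h | h | h
    · rw [if_pos h]
      exact (b1 j ((Set.mem_insert_iff.1 hj).resolve_left (by omega)) h).2
    · rw [if_neg (by omega), if_pos h, hi', h]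
    · rw [if_neg (by omega), if_neg (by omega)]
      have h3 := hg₂' _ (m2 j ((Set.mem_insert_iff.1 hj).resolve_left (by omega)) h)
      rw [List.getElem?_drop, List.getElem?_drop] at h3
      rw [h3]
      congr 1
      omega

/-- The truth of a formula with one block of quantifiers and one free variable is determined by the
letter at this variable and by the subwords of the two parts of the word around it. -/
theorem determined_pointed {b : Bool} {γ : FO2 A} (hγ : blocksFrom (some b) γ = 0) {y : Fin 2}
    (hy : γ.free ⊆ {y}) : ∃ k, ∀ (w w' : List A) (ν ν' : Fin 2 → ℕ), ν y < w.length →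
      w'[ν' y]? = w[ν y]? → SubEq k (w.take (ν y)) (w'.take (ν' y)) →
      SubEq k (w.drop (ν y + 1)) (w'.drop (ν' y + 1)) → (Sat w ν γ ↔ Sat w' ν' γ) := by
  have key : ∀ {γ : FO2 A}, blocksFrom (some true) γ = 0 → γ.free ⊆ {y} →
      ∃ k, ∀ (w w' : List A) (ν ν' : Fin 2 → ℕ), ν y < w.length →
        w'[ν' y]? = w[ν y]? → SubEq k (w.take (ν y)) (w'.take (ν' y)) →
        SubEq k (w.drop (ν y + 1)) (w'.drop (ν' y + 1)) → (Sat w ν γ ↔ Sat w' ν' γ) := by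
    intro γ hγ hy
    obtain ⟨k, hk⟩ := exists_witness hγ hy
    have h1 : ∀ (w w' : List A) (ν ν' : Fin 2 → ℕ), ν y < w.length →
        w'[ν' y]? = w[ν y]? → SubEq k (w.take (ν y)) (w'.take (ν' y)) →
        SubEq k (w.drop (ν y + 1)) (w'.drop (ν' y + 1)) → Sat w ν γ → Sat w' ν' γ := by
      intro w w' ν ν' hν hν' h2 h3 h4
      obtain ⟨P, hP1, hP2, hP3⟩ := hk w ν h4 (by rintro x rfl; exact hν)
      obtain ⟨g, hg1, hg2, hg3⟩ := exists_pointed_embedding hν hν' h2 h3 P hP2 hP1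
      rw [Set.image_singleton, Set.union_singleton] at hP3
      refine (sat_congr fun x hx => ?_).1 (hP3 w' g hg3 hg1)
      obtain rfl : x = y := hy hx
      exact hg2
    refine ⟨k, fun w w' ν ν' hν hν' h2 h3 => ⟨h1 w w' ν ν' hν hν' h2 h3, h1 w' w ν' ν ?_ hν'.symm
      h2.symm h3.symm⟩⟩
    rw [List.getElem?_eq_getElem hν] at hν'
    exact (List.getElem?_eq_some_iff.1 hν').1
  cases b with
  | true => exact key hγ hy
  | false =>
    obtain ⟨k, hk⟩ := key (γ := γ.neg) (by rw [blocksFrom_neg]; exact hγ) (by rwa [free_neg])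
    refine ⟨k, fun w w' ν ν' h1 h2 h3 h4 => ?_⟩
    have := hk w w' ν ν' h1 h2 h3 h4
    rw [sat_neg, sat_neg] at this
    tauto

/-- The truth of a closed formula with one block of quantifiers is determined by the subwords. -/
theorem determined_closed {b : Bool} {γ : FO2 A} (hγ : blocksFrom (some b) γ = 0)
    (hy : γ.free ⊆ ∅) : ∃ k, ∀ (w w' : List A) (ν ν' : Fin 2 → ℕ), SubEq k w w' →
      (Sat w ν γ ↔ Sat w' ν' γ) := by
  have key : ∀ {γ : FO2 A}, blocksFrom (some true) γ = 0 → γ.free ⊆ ∅ →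
      ∃ k, ∀ (w w' : List A) (ν ν' : Fin 2 → ℕ), SubEq k w w' → (Sat w ν γ ↔ Sat w' ν' γ) := by
    intro γ hγ hy
    obtain ⟨k, hk⟩ := exists_witness hγ hy
    have h1 : ∀ (w w' : List A) (ν ν' : Fin 2 → ℕ), SubEq k w w' → Sat w ν γ → Sat w' ν' γ := by
      intro w w' ν ν' h2 h4
      obtain ⟨P, hP1, hP2, hP3⟩ := hk w ν h4 (by simp)
      obtain ⟨g, hg1, hg3⟩ := exists_embedding h2 P hP2 hP1
      rw [Set.image_empty, Set.union_empty] at hP3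
      exact (sat_congr fun x hx => (hy hx).elim).1 (hP3 w' g hg3 hg1)
    exact ⟨k, fun w w' ν ν' h => ⟨h1 w w' ν ν' h, h1 w' w ν' ν h.symm⟩⟩
  cases b with
  | true => exact key hγ hy
  | false =>
    obtain ⟨k, hk⟩ := key (γ := γ.neg) (by rw [blocksFrom_neg]; exact hγ) (by rwa [free_neg])
    refine ⟨k, fun w w' ν ν' h => ?_⟩
    have := hk w w' ν ν' h
    rw [sat_neg, sat_neg] at this
    tauto

theorem determined_of_blocks_le_one {α : FO2 A} (hα : α.blocks ≤ 1) (h : α.free ⊆ ∅) :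
    ∃ k, ∀ (w w' : List A) (ν ν' : Fin 2 → ℕ), SubEq k w w' → (Sat w ν α ↔ Sat w' ν' α) := by
  induction α with
  | tru => exact ⟨0, fun _ _ _ _ _ => Iff.rfl⟩
  | fls => exact ⟨0, fun _ _ _ _ _ => Iff.rfl⟩
  | letter s a x => exact (h (show x ∈ ({x} : Set _) from rfl)).elim
  | less s x y => exact (h (show x ∈ ({x, y} : Set _) from Or.inl rfl)).elim
  | equal s x y => exact (h (show x ∈ ({x, y} : Set _) from Or.inl rfl)).elim
  | and α β iα iβ =>
    obtain ⟨k, hk⟩ := iα ((le_max_left _ _).trans hα) (Set.subset_union_left.trans h)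
    obtain ⟨l, hl⟩ := iβ ((le_max_right _ _).trans hα) (Set.subset_union_right.trans h)
    exact ⟨max k l, fun w w' ν ν' hw => and_congr (hk w w' ν ν' (hw.mono (le_max_left _ _)))
      (hl w w' ν ν' (hw.mono (le_max_right _ _)))⟩
  | or α β iα iβ =>
    obtain ⟨k, hk⟩ := iα ((le_max_left _ _).trans hα) (Set.subset_union_left.trans h)
    obtain ⟨l, hl⟩ := iβ ((le_max_right _ _).trans hα) (Set.subset_union_right.trans h)
    exact ⟨max k l, fun w w' ν ν' hw => or_congr (hk w w' ν ν' (hw.mono (le_max_left _ _)))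
      (hl w w' ν ν' (hw.mono (le_max_right _ _)))⟩
  | ex x α _ =>
    simp only [blocks, blocksFrom, reduceCtorEq, if_false] at hα
    exact determined_closed (b := true) (by simp only [blocksFrom, if_true]; omega) h
  | all x α _ =>
    simp only [blocks, blocksFrom, reduceCtorEq, if_false] at hα
    exact determined_closed (b := false) (by simp only [blocksFrom, if_true]; omega) h

/-! ### Replacing the innermost blocks by letters -/

/-- Over the words transduced by the subword congruence, the formula can be expressed with one block
less. -/
def Reducible (α : FO2 A) : Prop :=
  ∀ (S : Set (Fin 2)) (q : Option Bool) (m : ℕ), 1 ≤ m → α.free ⊆ S → blocksFrom q α ≤ m →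
    (q = none → 2 ≤ m) → (q ≠ none → S.Nonempty) →
    ∃ k₀, ∀ k, k₀ ≤ k → ∃ α' : FO2 (SubQuot A k × A × SubQuot A k), α'.free ⊆ S ∧
      blocksFrom q α' ≤ m - 1 ∧ ∀ (w : List A) (ν : Fin 2 → ℕ), (∀ x ∈ S, ν x < w.length) →
        (Sat w ν α ↔ Sat (transduceFrom (subMk A k) 1 w) ν α')

theorem Reducible.neg {α : FO2 A} (h : Reducible α) : Reducible α.neg := by
  intro S q m hm hS hb h1 h2
  rw [free_neg] at hS
  rw [blocksFrom_neg] at hb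
  obtain ⟨k₀, hk⟩ := h S (q.map not) m hm hS hb (fun h => h1 (by simpa using h))
    (fun h => h2 (by simpa using h))
  refine ⟨k₀, fun k hk' => ?_⟩
  obtain ⟨α', h3, h4, h5⟩ := hk k hk'
  refine ⟨α'.neg, by rwa [free_neg], by rwa [blocksFrom_neg], fun w ν hν => ?_⟩
  rw [sat_neg, sat_neg, h5 w ν hν]

theorem definable_exists_letter {B : Type} [Finite B] (T : Set B) (x : Fin 2) :
    Definable 0 {x} fun (w : List B) ν => ∃ σ ∈ T, w[ν x]? = some σ :=
  Definable.exists_mem (Set.toFinite T) fun σ =>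
    ⟨letter true σ x, le_rfl, le_rfl, fun w ν => by simp [Sat]⟩

theorem reducible_letter [Finite A] (s : Bool) (a : A) (x : Fin 2) : Reducible (letter s a x) := by
  have key : Reducible (letter true a x) := by
    intro S q m hm hS hb h1 h2
    refine ⟨0, fun k _ => ?_⟩
    obtain ⟨α', h3, h4, h5⟩ := definable_exists_letter
      {σ : SubQuot A k × A × SubQuot A k | σ.2.1 = a} x
    refine ⟨α', h3.trans hS, (blocksFrom_le_blocks q α').trans (by omega), fun w ν hν => ?_⟩
    rw [h5]
    dsimp only
    rw [getElem?_transduceFrom]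
    simp only [Sat, iff_true, Option.map_eq_some_iff]
    constructor
    · exact fun h => ⟨_, rfl, a, h, rfl⟩
    · rintro ⟨σ, hσ, b, hb', rfl⟩
      subst hσ
      exact hb'
  cases s with
  | true => exact key
  | false => exact key.neg

theorem subEq_of_transduceFrom_eq {k : ℕ} {w w' : List A} {i i' : ℕ}
    {σ : SubQuot A k × A × SubQuot A k} (h : (transduceFrom (subMk A k) 1 w)[i]? = some σ)
    (h' : (transduceFrom (subMk A k) 1 w')[i']? = some σ) :
    w'[i']? = w[i]? ∧ SubEq k (w.take i) (w'.take i') ∧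
      SubEq k (w.drop (i + 1)) (w'.drop (i' + 1)) := by
  rw [getElem?_transduceFrom, one_mul, Option.map_eq_some_iff] at h h'
  obtain ⟨a, ha, rfl⟩ := h
  obtain ⟨a', ha', h⟩ := h'
  rw [Prod.mk.injEq, Prod.mk.injEq] at h
  exact ⟨by rw [ha, ha', h.2.1], subMk_eq_iff.1 h.1.symm, subMk_eq_iff.1 h.2.2.symm⟩

/-- For large `k` the transduced letter at `y` knows everything on which the truth of `γ` depends,
so `γ` becomes a disjunction of letters. -/
theorem exists_letters_of_oneBlock [Finite A] {b : Bool} {γ : FO2 A}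
    (hγ : blocksFrom (some b) γ = 0) {y : Fin 2} (hy : γ.free ⊆ {y}) :
    ∃ k₀, ∀ k, k₀ ≤ k → ∃ α' : FO2 (SubQuot A k × A × SubQuot A k), α'.free ⊆ {y} ∧
      α'.blocks = 0 ∧ ∀ (w : List A) (ν : Fin 2 → ℕ), ν y < w.length →
        (Sat w ν γ ↔ Sat (transduceFrom (subMk A k) 1 w) ν α') := by
  obtain ⟨k₀, hk₀⟩ := determined_pointed hγ hy
  refine ⟨k₀, fun k hk => ?_⟩
  obtain ⟨α', h1, h2, h3⟩ := definable_exists_letter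
    {σ : SubQuot A k × A × SubQuot A k | ∃ w ν, Sat w ν γ ∧ ν y < w.length ∧
      (transduceFrom (subMk A k) 1 w)[ν y]? = some σ} y
  refine ⟨α', h1, Nat.le_zero.1 h2, fun w ν hν => ?_⟩
  rw [h3]
  constructor
  · intro h
    have hlen : ν y < (transduceFrom (subMk A k) 1 w).length := by rwa [length_transduceFrom]
    exact ⟨_, ⟨w, ν, h, hν, List.getElem?_eq_getElem hlen⟩, List.getElem?_eq_getElem hlen⟩
  · rintro ⟨σ, ⟨w', ν', h4, h5, h6⟩, h7⟩
    obtain ⟨h8, h9, h10⟩ := subEq_of_transduceFrom_eq h6 h7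
    exact (hk₀ w' w ν' ν h5 h8 (h9.mono hk) (h10.mono hk)).1 h4

theorem Reducible.ex [Finite A] {x : Fin 2} {β : FO2 A} (h : Reducible β) : Reducible (ex x β) := by
  intro S q m hm hS hb h1 h2
  have upd : ∀ {w : List A} {ν : Fin 2 → ℕ} {i : ℕ}, (∀ x ∈ S, ν x < w.length) → i < w.length →
      ∀ y ∈ insert x S, Function.update ν x i y < w.length := by
    intro w ν i hν hi y hy
    by_cases hyx : y = x
    · simpa [hyx] using hi
    · simpa [hyx] using hν y (hy.resolve_left hyx)
  -- Here the quantifier is kept and the reduction happens inside `β`, with `m'` blocks left below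
  -- it.
  have build : ∀ m', 1 ≤ m' → blocksFrom (some true) β ≤ m' →
      (if q = some true then 0 else 1) + (m' - 1) ≤ m - 1 →
      ∃ k₀, ∀ k, k₀ ≤ k → ∃ α' : FO2 (SubQuot A k × A × SubQuot A k), α'.free ⊆ S ∧
      blocksFrom q α' ≤ m - 1 ∧ ∀ (w : List A) (ν : Fin 2 → ℕ), (∀ x ∈ S, ν x < w.length) →
        (Sat w ν (.ex x β) ↔ Sat (transduceFrom (subMk A k) 1 w) ν α') := by
    intro m' hm' hb' hmm
    obtain ⟨k₀, hk₀⟩ := h (insert x S) (some true) m' hm' (insert_free_subset hS) hb' (by simp)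
      (fun _ => Set.insert_nonempty x S)
    refine ⟨k₀, fun k hk => ?_⟩
    obtain ⟨β', h3, h4, h5⟩ := hk₀ k hk
    refine ⟨.ex x β', ?_, ?_, fun w ν hν => ?_⟩
    · rw [free, Set.sdiff_subset_iff, Set.singleton_union]
      exact h3
    · rw [blocksFrom]
      exact (Nat.add_le_add_left h4 _).trans hmm
    · simp only [Sat, length_transduceFrom]
      exact exists_congr fun i => and_congr_right fun hi => h5 w _ (upd hν hi)
  by_cases hq : q = some true
  · subst hq
    simp only [blocksFrom, if_true, zero_add] at hb
    exact build m hm hb (by simp)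
  · simp only [blocksFrom, if_neg hq] at hb
    rcases Nat.lt_or_ge m 2 with hm2 | hm2
    -- A new block opens and it is the last one allowed, so the whole formula is replaced by
    -- letters. It has at most one free variable; if it is closed, any variable of `S` carries the
    -- letter, which is why `S` must be nonempty.
    · have hS' := h2 fun hq => by have := h1 hq; omega
      obtain ⟨y, hyS, hy⟩ : ∃ y ∈ S, (FO2.ex x β).free ⊆ {y} := by
        by_cases hxS : x + 1 ∈ S
        · refine ⟨x + 1, hxS, fun z hz => fin_two_eq_of_ne hz.2⟩
        · obtain ⟨y, hy⟩ := hS'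
          refine ⟨y, hy, fun z hz => ?_⟩
          have := hS hz
          rw [fin_two_eq_of_ne hz.2] at this
          exact absurd this hxS
      obtain ⟨k₀, hk₀⟩ := exists_letters_of_oneBlock (b := true) (γ := .ex x β)
        (by simp only [blocksFrom, if_true]; omega) hy
      refine ⟨k₀, fun k hk => ?_⟩
      obtain ⟨α', h3, h4, h5⟩ := hk₀ k hk
      exact ⟨α', h3.trans (by simpa using hyS), (blocksFrom_le_blocks q α').trans (by omega),
        fun w ν hν => h5 w ν (hν y hyS)⟩
    · exact build (m - 1) (by omega) (by omega) (by rw [if_neg hq]; omega)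

theorem reducible [Finite A] (α : FO2 A) : Reducible α := by
  induction α with
  | tru => exact fun S q m _ _ _ _ _ => ⟨0, fun k _ => ⟨.tru, by simp [free, blocksFrom, Sat]⟩⟩
  | fls => exact fun S q m _ _ _ _ _ => ⟨0, fun k _ => ⟨.fls, by simp [free, blocksFrom, Sat]⟩⟩
  | letter s a x => exact reducible_letter s a x
  | less s x y =>
    exact fun S q m _ h _ _ _ => ⟨0, fun k _ => ⟨.less s x y, h, by simp [blocksFrom],
      fun _ _ _ => Iff.rfl⟩⟩
  | equal s x y =>
    exact fun S q m _ h _ _ _ => ⟨0, fun k _ => ⟨.equal s x y, h, by simp [blocksFrom],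
      fun _ _ _ => Iff.rfl⟩⟩
  | and α β iα iβ =>
    intro S q m hm hS hb h1 h2
    obtain ⟨k, hk⟩ := iα S q m hm (Set.subset_union_left.trans hS) ((le_max_left _ _).trans hb) h1 h2
    obtain ⟨l, hl⟩ := iβ S q m hm (Set.subset_union_right.trans hS) ((le_max_right _ _).trans hb)
      h1 h2
    refine ⟨max k l, fun j hj => ?_⟩
    obtain ⟨α', h3, h4, h5⟩ := hk j ((le_max_left _ _).trans hj)
    obtain ⟨β', h6, h7, h8⟩ := hl j ((le_max_right _ _).trans hj)
    exact ⟨.and α' β', Set.union_subset h3 h6, max_le h4 h7, fun w ν hν =>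
      and_congr (h5 w ν hν) (h8 w ν hν)⟩
  | or α β iα iβ =>
    intro S q m hm hS hb h1 h2
    obtain ⟨k, hk⟩ := iα S q m hm (Set.subset_union_left.trans hS) ((le_max_left _ _).trans hb) h1 h2
    obtain ⟨l, hl⟩ := iβ S q m hm (Set.subset_union_right.trans hS) ((le_max_right _ _).trans hb)
      h1 h2
    refine ⟨max k l, fun j hj => ?_⟩
    obtain ⟨α', h3, h4, h5⟩ := hk j ((le_max_left _ _).trans hj)
    obtain ⟨β', h6, h7, h8⟩ := hl j ((le_max_right _ _).trans hj)
    exact ⟨.or α' β', Set.union_subset h3 h6, max_le h4 h7, fun w ν hν =>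
      or_congr (h5 w ν hν) (h8 w ν hν)⟩
  | ex x β iβ => exact iβ.ex
  | all x β iβ =>
    have := (iβ.neg.ex (x := x)).neg
    rwa [neg, neg_neg] at this

end FO2

/-! ### Definable languages are recognized by the levels -/

section Recognition

variable {A : Type}

/-- The language `P` is a union of fibres of a homomorphism to a monoid in `Vₙ`. -/
def Recognized (n : ℕ) (P : List A → Prop) : Prop :=
  ∃ (M : Type) (_ : Monoid M) (φ : FreeMonoid A →* M) (F : Set M), Finite M ∧ levelV n M ∧
    ∀ w : List A, P w ↔ φ (FreeMonoid.ofList w) ∈ F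

/-- The syntactic congruence. -/
def synCon (P : List A → Prop) : Con (FreeMonoid A) where
  r u v := ∀ x y : FreeMonoid A, P (x * u * y).toList ↔ P (x * v * y).toList
  iseqv := ⟨fun _ _ _ => Iff.rfl, fun h x y => (h x y).symm,
    fun h h' x y => (h x y).trans (h' x y)⟩
  mul' {u v u' v'} h h' x y := by
    have h1 := h x (u' * y)
    have h2 := h' (x * v) y
    simp only [← mul_assoc] at h1 h2 ⊢
    exact h1.trans h2

theorem iff_mem_synCon_classes (P : List A → Prop) (w : List A) :
    P w ↔ (synCon P).mk' (FreeMonoid.ofList w) ∈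
      {c | ∃ u : FreeMonoid A, P u.toList ∧ (synCon P).mk' u = c} := by
  constructor
  · exact fun h => ⟨_, h, rfl⟩
  · rintro ⟨u, hu, h⟩
    have := (synCon P).eq.1 h 1 1
    simpa using this.1 (by simpa using hu)

theorem finite_synCon {P : List A → Prop} {T : Type*} [Finite T] (f : FreeMonoid A → T)
    (hf : ∀ u v, f u = f v → synCon P u v) : Finite (synCon P).Quotient := by
  refine Finite.of_injective
    (fun c => f (Function.surjInv (synCon P).mk'_surjective c)) fun c d h => ?_
  have := (synCon P).eq.2 (hf _ _ h)
  have h1 := Function.surjInv_eq (synCon P).mk'_surjective c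
  have h2 := Function.surjInv_eq (synCon P).mk'_surjective d
  rw [← h1, ← h2]
  exact this

/-- The `K`-value of a transduced word alone is not stable under contexts, because a context
translates the coordinates. Recording the values under all translates, in a power of `K`, repairs
this and shows that the syntactic monoid lies in `Vₙ ** J`. -/
theorem recognized_transduce [Finite A] {n : ℕ} (hn : 1 ≤ n) {N : Type} [Monoid N]
    (hN : classJ N) (ψ : FreeMonoid A →* N) {P' : List (N × A × N) → Prop}
    (h : Recognized n P') : Recognized (n + 1) fun w : List A => P' (transduceFrom ψ 1 w) := by
  have := hN.1
  obtain ⟨K, _, h₀, F, hfin, hK, hF⟩ := h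
  set P := fun w : List A => P' (transduceFrom ψ 1 w)
  let g : FreeMonoid (N × A × N) →* (N × N → K) := MonoidHom.pi fun o =>
    h₀.comp (FreeMonoid.map (translate o.1 o.2))
  have hg : ∀ w o, g (transduce ψ w) o = h₀ (transduceIn ψ o.1 o.2 w) := by
    intro w o
    have h1 := transduceFrom_translate ψ o.1 1 o.2 w.toList
    rw [mul_one] at h1
    show h₀ (FreeMonoid.map (translate o.1 o.2) (transduce ψ w)) = _
    rw [transduceIn, ← h1]
    rfl
  have hK' : levelV n (N × N → K) :=
    (levelV_iff hn _).2 (LevelIdentities.pi fun _ => (levelV_iff hn K).1 hK)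
  have hsyn : ∀ v w : FreeMonoid A, ψ v = ψ w → g (transduce ψ v) = g (transduce ψ w) →
      synCon P v w := by
    intro v w h1 h2 x y
    have h3 : ∀ p q, h₀ (transduceIn ψ p q v) = h₀ (transduceIn ψ p q w) := fun p q => by
      rw [← hg v (p, q), ← hg w (p, q), h2]
    have h4 : ∀ u : FreeMonoid A, P u.toList ↔ h₀ (transduceIn ψ 1 1 u) ∈ F := fun u => by
      rw [← transduce_eq_transduceIn]
      exact hF _
    rw [h4, h4]
    simp only [transduceIn_mul, map_mul, h1, h3]
  have hfinM : Finite (synCon P).Quotient :=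
    finite_synCon (fun w => (ψ w, g (transduce ψ w))) fun u v h =>
      hsyn u v (congrArg Prod.fst h) (congrArg Prod.snd h)
  refine ⟨_, inferInstance, (synCon P).mk', _, hfinM, ?_, iff_mem_synCon_classes P⟩
  obtain ⟨m, rfl⟩ := Nat.exists_eq_add_of_le' hn
  exact ⟨hfinM, A, inferInstance, (synCon P).mk', (synCon P).mk'_surjective, N, inferInstance,
    N × N → K, inferInstance, inferInstance, inferInstance, hN, hK', ψ, g,
    fun v w h1 h2 => (synCon P).eq.2 (hsyn v w h1 h2)⟩

theorem recognized_of_definable {n : ℕ} (hn : 1 ≤ n) {A : Type} [Finite A] {P : List A → Prop}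
    (h : FO2.Definable n ∅ fun w _ => P w) : Recognized n P := by
  induction n, hn using Nat.le_induction generalizing A with
  | base =>
    obtain ⟨α, h1, h2, h3⟩ := h
    obtain ⟨k, hk⟩ := FO2.determined_of_blocks_le_one h2 h1
    refine ⟨SubQuot A k, inferInstance, subMk A k, {c | ∃ u, P u ∧ subMk A k (FreeMonoid.ofList u) = c},
      inferInstance, classJ_subQuot k, fun w => ⟨fun hw => ⟨w, hw, rfl⟩, ?_⟩⟩
    rintro ⟨u, hu, h4⟩
    have h5 := hk u w (fun _ => 0) (fun _ => 0) (subMk_eq_iff.1 h4)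
    rw [h3, h3] at h5
    exact h5.1 hu
  | succ n hn ih =>
    obtain ⟨α, h1, h2, h3⟩ := h
    -- A sentence leaves no variable to carry a letter; since `n + 1 ≥ 2`, its outermost quantifiers
    -- are kept and the replacement happens below them.
    obtain ⟨k, hk⟩ := FO2.reducible α ∅ none (n + 1) (by omega) h1 h2 (fun _ => by omega)
      (fun h => absurd rfl h)
    obtain ⟨α', h4, h5, h6⟩ := hk k le_rfl
    have h7 := recognized_transduce hn (classJ_subQuot k) (subMk A k) (ih (A := SubQuot A k × A × SubQuot A k)
      (P := fun w => FO2.Sat w (fun _ => 0) α')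
      ⟨α', h4, h5, fun w ν => FO2.sat_congr fun x hx => (h4 hx).elim⟩)
    obtain ⟨M, i, φ, F, hfin, hM, hF⟩ := h7
    refine ⟨M, i, φ, F, hfin, hM, fun w => ?_⟩
    rw [← hF]
    exact (h3 w fun _ => 0).symm.trans (h6 w _ (by simp))

theorem definable_of_recognized {n : ℕ} (hn : 1 ≤ n) [Finite A] {P : List A → Prop}
    (h : Recognized n P) : FO2.Definable n ∅ fun w _ => P w := by
  obtain ⟨M, _, φ, F, hfin, hM, hF⟩ := h
  refine (FO2.Definable.exists_mem (Set.toFinite F) fun m => definable_of_levelV hn hM φ m).congr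
    fun w _ => ?_
  rw [hF]
  simp

theorem inAlternationLevel_iff {n : ℕ} (hn : 1 ≤ n) [Finite A] (L : Language A) :
    InAlternationLevel n L ↔ Recognized n (· ∈ L) := by
  constructor
  · rintro ⟨α, h1, h2, h3⟩
    refine recognized_of_definable hn ⟨α, h1.le, h2, fun w ν => ?_⟩
    dsimp only
    rw [h3 w]
    exact FO2.sat_congr fun x hx => by simp [h1] at hx
  · intro h
    obtain ⟨α, h1, h2, h3⟩ := definable_of_recognized hn h
    exact ⟨α, Set.subset_empty_iff.1 h1, h2, fun w => (h3 w _).symm⟩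

end Recognition

/-! ### The identities in syntactic monoids -/

section Syntactic

variable {A : Type}

/-- The syntactic monoid is a quotient of the image of any recognizing homomorphism, and identities
pass to submonoids and quotients. -/
theorem recognized_iff {n : ℕ} (hn : 1 ≤ n) {P : List A → Prop} (hfin : Finite (synCon P).Quotient) :
    Recognized n P ↔ LevelIdentities n (synCon P).Quotient := by
  constructor
  · rintro ⟨M, _, φ, F, _, hM, hF⟩
    have hle : Con.ker φ ≤ synCon P := by
      intro v w h x y
      have h' : φ v = φ w := h
      have h1 : ∀ u : FreeMonoid A, P u.toList ↔ φ u ∈ F := fun u => hF _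
      rw [h1, h1]
      simp only [map_mul, h']
    have : Finite (Con.ker φ).Quotient := Finite.of_injective _ (Con.kerLift_injective φ)
    have h1 : LevelIdentities n (Con.ker φ).Quotient :=
      ((levelV_iff hn M).1 hM).of_injective _ (Con.kerLift_injective φ)
    refine h1.of_surjective (Con.map (Con.ker φ) (synCon P) hle) fun c => ?_
    obtain ⟨w, rfl⟩ := (synCon P).mk'_surjective c
    exact ⟨(Con.ker φ).mk' w, rfl⟩
  · intro h
    exact ⟨_, inferInstance, (synCon P).mk', _, hfin, (levelV_iff hn _).2 h,
      iff_mem_synCon_classes P⟩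

/-- The syntactic congruence identifies the values of both sides of the identities, when `ω` is
replaced by the exponent `E`. -/
def SyntacticIdentities (E n : ℕ) (P : List A → Prop) : Prop :=
  ∀ ρ : ℕ → FreeMonoid A,
    synCon P ((uTerm n).evalPow E ρ) ((vTerm n).evalPow E ρ) ∧
    synCon P (ρ 1 ^ E) (ρ 1 * ρ 1 ^ E)

theorem levelIdentities_synCon_iff {n E : ℕ} {P : List A → Prop}
    (hE : IsExponent (synCon P).Quotient E) :
    LevelIdentities n (synCon P).Quotient ↔ SyntacticIdentities E n P := by
  have key : ∀ s t : OmegaTerm, Satisfies (synCon P).Quotient s t ↔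
      ∀ ρ : ℕ → FreeMonoid A, synCon P (s.evalPow E ρ) (t.evalPow E ρ) := by
    intro s t
    constructor
    · intro h ρ
      refine (synCon P).eq.1 ?_
      have h1 := h fun i => (synCon P).mk' (ρ i)
      rw [hE.eval_eq, hE.eval_eq, ← map_evalPow, ← map_evalPow] at h1
      exact h1
    · intro h ρ
      choose r hr using fun i => (synCon P).mk'_surjective (ρ i)
      obtain rfl : (fun i => (synCon P).mk' (r i)) = ρ := funext hr
      rw [hE.eval_eq, hE.eval_eq, ← map_evalPow, ← map_evalPow]
      exact (synCon P).eq.2 (h r)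
  rw [LevelIdentities, Aperiodic, key, key, SyntacticIdentities, forall_and, and_comm]
  rfl

end Syntactic

/-! ### Runs of automata given by tables -/

section Run

/-- The entry of the table at `(q, a)`. -/
def entry (T : List (List ℕ)) (q a : ℕ) : ℕ := (T.getD q []).getD a 0

/-- The state that is reached from `q` by reading `w`. -/
def run (T : List (List ℕ)) (q : ℕ) (w : List ℕ) : ℕ := w.foldl (entry T) q

theorem run_append (T : List (List ℕ)) (q : ℕ) (v w : List ℕ) :
    run T q (v ++ w) = run T (run T q v) w := List.foldl_append

/-- Words over `Fin k` as words of numbers. -/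
def numbers {k : ℕ} (w : FreeMonoid (Fin k)) : List ℕ := w.toList.map Fin.val

theorem numbers_mul {k : ℕ} (v w : FreeMonoid (Fin k)) :
    numbers (v * w) = numbers v ++ numbers w := by
  simp [numbers, FreeMonoid.toList_mul]

theorem numbers_lt {k : ℕ} {w : FreeMonoid (Fin k)} {a : ℕ} (h : a ∈ numbers w) : a < k := by
  obtain ⟨b, -, rfl⟩ := List.mem_map.1 h
  exact b.2

theorem exists_numbers_eq {k : ℕ} {l : List ℕ} (h : ∀ a ∈ l, a < k) :
    ∃ w : FreeMonoid (Fin k), numbers w = l := by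
  induction l with
  | nil => exact ⟨1, rfl⟩
  | cons a l ih =>
    rw [List.forall_mem_cons] at h
    obtain ⟨w, hw⟩ := ih h.2
    exact ⟨FreeMonoid.of ⟨a, h.1⟩ * w, by rw [numbers_mul, hw]; rfl⟩

/-- The set `{0, …, S - 1}` of states is closed under transitions by letters below `k`. -/
def ClosedStates (T : List (List ℕ)) (k S : ℕ) : Prop := ∀ q < S, ∀ a < k, entry T q a < S

variable {T : List (List ℕ)} {k S : ℕ}

theorem ClosedStates.run_lt (h : ClosedStates T k S) {q : ℕ} (hq : q < S) {w : List ℕ}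
    (hw : ∀ a ∈ w, a < k) : run T q w < S := by
  induction w generalizing q with
  | nil => exact hq
  | cons a w ih =>
    rw [List.forall_mem_cons] at hw
    exact ih (h q hq a hw.1) hw.2

/-- Words over `Fin k` are identified if they act in the same way on the states. -/
def actionCon (h : ClosedStates T k S) : Con (FreeMonoid (Fin k)) where
  r u v := ∀ q < S, run T q (numbers u) = run T q (numbers v)
  iseqv := ⟨fun _ _ _ => rfl, fun h q hq => (h q hq).symm, fun h h' q hq => (h q hq).trans (h' q hq)⟩
  mul' {u v u' v'} h1 h2 q hq := by
    rw [numbers_mul, numbers_mul, run_append, run_append, h1 q hq,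
      h2 _ (h.run_lt hq fun a ha => numbers_lt ha)]

/-- The map on states defined by a word. -/
def actionMap (h : ClosedStates T k S) (w : FreeMonoid (Fin k)) : Fin S → Fin S :=
  fun q => ⟨run T q (numbers w), h.run_lt q.2 fun _ ha => numbers_lt ha⟩

theorem actionMap_eq_iff (h : ClosedStates T k S) {v w : FreeMonoid (Fin k)} :
    actionMap h v = actionMap h w ↔ actionCon h v w := by
  simp only [funext_iff, actionMap, Fin.mk.injEq]
  exact ⟨fun H q hq => H ⟨q, hq⟩, fun H q => H q q.2⟩

/-- Among the first `S ^ S + 1` prefixes of a longer word two act alike on the states, and the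
factor between them can be cut out. -/
theorem exists_short_word (h : ClosedStates T k S) (w : FreeMonoid (Fin k)) :
    ∃ w', actionCon h w w' ∧ (numbers w').length ≤ S ^ S := by
  obtain ⟨n, hn⟩ : ∃ n, w.toList.length ≤ n := ⟨_, le_rfl⟩
  have hlen : ∀ v : FreeMonoid (Fin k), (numbers v).length = v.toList.length := by simp [numbers]
  induction n generalizing w with
  | zero => exact ⟨w, (actionCon h).refl w, by rw [hlen]; omega⟩
  | succ n ih =>
    by_cases hw : w.toList.length ≤ S ^ S
    · exact ⟨w, (actionCon h).refl w, by rwa [hlen]⟩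
    · have hni : ¬ Function.Injective (fun i : Fin (S ^ S + 1) =>
          actionMap h (FreeMonoid.ofList (w.toList.take i))) := by
        intro hinj
        have := Fintype.card_le_of_injective _ hinj
        simp at this
      simp only [Function.Injective, not_forall] at hni
      obtain ⟨i, j, hij, hne⟩ := hni
      wlog hlt : i < j generalizing i j with H
      · exact H j i hij.symm (Ne.symm hne) (lt_of_le_of_ne (not_lt.mp hlt) (Ne.symm hne))
      have hlt' : (i : ℕ) < j := hlt
      have hj := j.2
      rw [actionMap_eq_iff] at hij
      have h1 : w = FreeMonoid.ofList (w.toList.take j) * FreeMonoid.ofList (w.toList.drop j) := by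
        rw [← FreeMonoid.ofList_append, List.take_append_drop, FreeMonoid.ofList_toList]
      obtain ⟨w', hw', hl⟩ := ih
        (FreeMonoid.ofList (w.toList.take i) * FreeMonoid.ofList (w.toList.drop j)) (by
          rw [FreeMonoid.toList_mul]
          simp only [FreeMonoid.toList_ofList, List.length_append, List.length_take,
            List.length_drop]
          omega)
      refine ⟨w', (actionCon h).trans ?_ hw', hl⟩
      nth_rw 1 [h1]
      exact (actionCon h).mul ((actionCon h).symm hij) ((actionCon h).refl _)

theorem actionCon_le_synCon (h : ClosedStates T k S) {x : ℕ} (hx : x < S) {F : List ℕ}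
    {P : List (Fin k) → Prop} (hP : ∀ w, P w ↔ run T x (w.map Fin.val) ∈ F)
    {v w : FreeMonoid (Fin k)} (hvw : actionCon h v w) : synCon P v w := by
  intro a b
  have h1 := (actionCon h).mul ((actionCon h).mul ((actionCon h).refl a) hvw)
    ((actionCon h).refl b) x hx
  rw [hP, hP]
  exact iff_of_eq (congrArg (· ∈ F) h1)

theorem finite_synCon_of_closedStates (h : ClosedStates T k S) {x : ℕ} (hx : x < S) {F : List ℕ}
    {P : List (Fin k) → Prop} (hP : ∀ w, P w ↔ run T x (w.map Fin.val) ∈ F) :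
    Finite (synCon P).Quotient ∧ Nat.card (synCon P).Quotient ≤ S ^ S := by
  have hf : ∀ u v, actionMap h u = actionMap h v → synCon P u v := fun u v huv =>
    actionCon_le_synCon h hx hP ((actionMap_eq_iff h).1 huv)
  refine ⟨finite_synCon (actionMap h) hf, ?_⟩
  have hinj : Function.Injective
      fun c => actionMap h (Function.surjInv (synCon P).mk'_surjective c) := by
    intro c d hcd
    have := (synCon P).eq.2 (hf _ _ hcd)
    rw [← Function.surjInv_eq (synCon P).mk'_surjective c,
      ← Function.surjInv_eq (synCon P).mk'_surjective d]
    exact this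
  simpa using Nat.card_le_card_of_injective _ hinj

end Run

/-! ### A bounded test for the identities -/

section Test

/-- The `E`-th power of a word. -/
def powWord (E : ℕ) (w : List ℕ) : List ℕ := Nat.rec [] (fun _ r => r ++ w) E

/-- The word `x₁ ⋯ xₙ₊₁` for a list of words. -/
def prodWord (t : List (List ℕ)) (n : ℕ) : List ℕ :=
  Nat.rec (t.getD 1 []) (fun m r => r ++ t.getD (m + 2) []) n

/-- The word that is obtained from `b` by wrapping it `n` times. -/
def wrapWord (E : ℕ) (t : List (List ℕ)) (b : List ℕ) (n : ℕ) : List ℕ :=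
  Nat.rec b (fun m r => powWord E (prodWord t (2 * m + 1) ++ t.getD (2 * m + 3) []) ++ r ++
    powWord E (t.getD (2 * m + 4) [] ++ prodWord t (2 * m + 1))) n

/-- All lists of length `n` with entries in `W`. -/
def tuples {α : Type*} (W : List α) (n : ℕ) : List (List α) :=
  Nat.rec [[]] (fun _ r => r.flatMap fun t => W.map fun w => w :: t) n

/-- All words of length at most `L` over the letters below `k`. -/
def shortWords (k L : ℕ) : List (List ℕ) := (List.range (L + 1)).flatMap (tuples (List.range k))

theorem mem_tuples {α : Type*} {W : List α} {n : ℕ} {t : List α} :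
    t ∈ tuples W n ↔ t.length = n ∧ ∀ w ∈ t, w ∈ W := by
  induction n generalizing t with
  | zero =>
    show t ∈ [[]] ↔ _
    rw [List.mem_singleton, List.length_eq_zero_iff]
    exact ⟨fun h => ⟨h, by simp [h]⟩, fun h => h.1⟩
  | succ n ih =>
    show t ∈ (tuples W n).flatMap _ ↔ _
    simp only [List.mem_flatMap, List.mem_map, ih]
    constructor
    · rintro ⟨s, ⟨rfl, h⟩, w, hw, rfl⟩
      exact ⟨rfl, by simpa using ⟨hw, h⟩⟩
    · rintro ⟨h1, h2⟩
      cases t with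
      | nil => simp at h1
      | cons w s =>
        rw [List.forall_mem_cons] at h2
        exact ⟨s, ⟨by simpa using h1, h2.2⟩, w, h2.1, rfl⟩

theorem mem_shortWords {k L : ℕ} {w : List ℕ} :
    w ∈ shortWords k L ↔ w.length ≤ L ∧ ∀ a ∈ w, a < k := by
  simp [shortWords, mem_tuples]

/-- The exponent used for automata with `S` states. -/
def exponent (S : ℕ) : ℕ := (S ^ S + 2).factorial

/-- The word `w` is accepted from the state `x`. -/
def Accepted (T : List (List ℕ)) (x : ℕ) (F : List ℕ) (w : List ℕ) : Prop := run T x w ∈ F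

/-- The identities hold for one choice `t` of words, where the first and the last word of `t` are
the context. -/
def TestTuple (n S : ℕ) (T : List (List ℕ)) (x : ℕ) (F : List ℕ) (t : List (List ℕ)) : Prop :=
  (Accepted T x F (t.getD 0 [] ++ wrapWord (exponent S) t
      (powWord (exponent S) (t.getD 1 [] ++ t.getD 2 [])) (n - 1) ++ t.getD (2 * n + 1) []) ↔
    Accepted T x F (t.getD 0 [] ++ wrapWord (exponent S) t
      (powWord (exponent S) (t.getD 2 [] ++ t.getD 1 [])) (n - 1) ++ t.getD (2 * n + 1) [])) ∧
  (Accepted T x F (t.getD 0 [] ++ powWord (exponent S) (t.getD 1 []) ++ t.getD (2 * n + 1) []) ↔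
    Accepted T x F (t.getD 0 [] ++ (t.getD 1 [] ++ powWord (exponent S) (t.getD 1 [])) ++
      t.getD (2 * n + 1) []))

/-- The identities hold for all choices of short words. -/
def TestAll (n k S : ℕ) (T : List (List ℕ)) (x : ℕ) (F : List ℕ) : Prop :=
  ∀ t ∈ tuples (shortWords k (S ^ S)) (2 * n + 2), TestTuple n S T x F t

variable {k : ℕ}

theorem numbers_pow (w : FreeMonoid (Fin k)) (E : ℕ) : numbers (w ^ E) = powWord E (numbers w) := by
  induction E with
  | zero => rfl
  | succ E ih =>
    rw [pow_succ, numbers_mul, ih]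
    rfl

theorem numbers_prodVars {E m : ℕ} {ρ : ℕ → FreeMonoid (Fin k)} {t : List (List ℕ)}
    (h : ∀ i, 1 ≤ i → i ≤ m → numbers (ρ i) = t.getD i []) : ∀ {j : ℕ}, j + 1 ≤ m →
    numbers ((prodVars (j + 1)).evalPow E ρ) = prodWord t j
  | 0, hj => h 1 le_rfl hj
  | j + 1, hj => by
    rw [prodVars, OmegaTerm.evalPow, numbers_mul, numbers_prodVars h (j := j) (by omega),
      OmegaTerm.evalPow, h (j + 2) (by omega) hj]
    rfl

theorem numbers_wrap {E m : ℕ} {ρ : ℕ → FreeMonoid (Fin k)} {t : List (List ℕ)}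
    (h : ∀ i, 1 ≤ i → i ≤ m → numbers (ρ i) = t.getD i []) {s : OmegaTerm} {j : ℕ}
    (hj : 2 * j + 4 ≤ m) : numbers ((wrap (j + 1) s).evalPow E ρ) =
      powWord E (prodWord t (2 * j + 1) ++ t.getD (2 * j + 3) []) ++ numbers (s.evalPow E ρ) ++
        powWord E (t.getD (2 * j + 4) [] ++ prodWord t (2 * j + 1)) := by
  have h1 := numbers_prodVars (E := E) h (j := 2 * j + 1) (by omega)
  simp only [wrap, OmegaTerm.evalPow, numbers_mul, numbers_pow]
  rw [show 2 * (j + 1) = 2 * j + 1 + 1 by ring, h1, h (2 * j + 1 + 1 + 1) (by omega) (by omega),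
    h (2 * j + 1 + 1 + 2) (by omega) (by omega)]

theorem numbers_uTerm {E m : ℕ} {ρ : ℕ → FreeMonoid (Fin k)} {t : List (List ℕ)}
    (h : ∀ i, 1 ≤ i → i ≤ m → numbers (ρ i) = t.getD i []) : ∀ {j : ℕ}, 2 * j + 2 ≤ m →
    numbers ((uTerm (j + 1)).evalPow E ρ) =
      wrapWord E t (powWord E (t.getD 1 [] ++ t.getD 2 [])) j
  | 0, hj => by
    simp only [uTerm, OmegaTerm.evalPow, numbers_pow, numbers_mul]
    rw [h 1 le_rfl (by omega), h 2 (by omega) (by omega)]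
    rfl
  | j + 1, hj => by
    rw [uTerm, numbers_wrap h (by omega), numbers_uTerm h (j := j) (by omega)]
    rfl

theorem numbers_vTerm {E m : ℕ} {ρ : ℕ → FreeMonoid (Fin k)} {t : List (List ℕ)}
    (h : ∀ i, 1 ≤ i → i ≤ m → numbers (ρ i) = t.getD i []) : ∀ {j : ℕ}, 2 * j + 2 ≤ m →
    numbers ((vTerm (j + 1)).evalPow E ρ) =
      wrapWord E t (powWord E (t.getD 2 [] ++ t.getD 1 [])) j
  | 0, hj => by
    simp only [vTerm, OmegaTerm.evalPow, numbers_pow, numbers_mul]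
    rw [h 1 le_rfl (by omega), h 2 (by omega) (by omega)]
    rfl
  | j + 1, hj => by
    rw [vTerm, numbers_wrap h (by omega), numbers_vTerm h (j := j) (by omega)]
    rfl

theorem testTuple_iff {n S x : ℕ} (hn : 1 ≤ n) {T : List (List ℕ)} {F : List ℕ}
    {P : List (Fin k) → Prop} (hP : ∀ w, P w ↔ run T x (w.map Fin.val) ∈ F)
    {ρ : ℕ → FreeMonoid (Fin k)} {t : List (List ℕ)}
    (h : ∀ i, i ≤ 2 * n + 1 → numbers (ρ i) = t.getD i []) :
    TestTuple n S T x F t ↔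
      (P (ρ 0 * (uTerm n).evalPow (exponent S) ρ * ρ (2 * n + 1)).toList ↔
        P (ρ 0 * (vTerm n).evalPow (exponent S) ρ * ρ (2 * n + 1)).toList) ∧
      (P (ρ 0 * ρ 1 ^ (exponent S) * ρ (2 * n + 1)).toList ↔
        P (ρ 0 * (ρ 1 * ρ 1 ^ (exponent S)) * ρ (2 * n + 1)).toList) := by
  obtain ⟨j, rfl⟩ := Nat.exists_eq_add_of_le' hn
  have h' : ∀ i, 1 ≤ i → i ≤ 2 * (j + 1) + 1 → numbers (ρ i) = t.getD i [] := fun i _ hi => h i hi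
  have hP' : ∀ w : FreeMonoid (Fin k), P w.toList ↔ Accepted T x F (numbers w) := fun w => hP _
  simp only [hP', numbers_mul]
  rw [numbers_uTerm h' (by omega), numbers_vTerm h' (by omega), numbers_pow, h 0 (by omega),
    h 1 (by omega), h (2 * (j + 1) + 1) le_rfl]
  rfl

/-- Acceptance depends only on the action on the states, so every variable and both context words
may be replaced by short words with the same action. -/
theorem testAll_iff {n S x : ℕ} (hn : 1 ≤ n) {T : List (List ℕ)} {F : List ℕ}
    (hT : ClosedStates T k S) (hx : x < S) {P : List (Fin k) → Prop}
    (hP : ∀ w, P w ↔ run T x (w.map Fin.val) ∈ F) :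
    TestAll n k S T x F ↔ SyntacticIdentities (exponent S) n P := by
  constructor
  · intro h
    have key : ∀ ρ : ℕ → FreeMonoid (Fin k), ∀ a b : FreeMonoid (Fin k),
        (P (a * (uTerm n).evalPow (exponent S) ρ * b).toList ↔
          P (a * (vTerm n).evalPow (exponent S) ρ * b).toList) ∧
        (P (a * ρ 1 ^ (exponent S) * b).toList ↔
          P (a * (ρ 1 * ρ 1 ^ (exponent S)) * b).toList) := by
      intro ρ a b
      have hact : ∀ v w : FreeMonoid (Fin k), (actionCon hT).mk' v = (actionCon hT).mk' w →
          (P v.toList ↔ P w.toList) := by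
        intro v w hvw
        have := actionCon_le_synCon hT hx hP ((actionCon hT).eq.1 hvw) 1 1
        simpa using this
      choose s hs1 hs2 using exists_short_word hT
      have hs : ∀ w, (actionCon hT).mk' w = (actionCon hT).mk' (s w) :=
        fun w => (actionCon hT).eq.2 (hs1 w)
      -- The indices `0` and `2n + 1`, which the terms of level `n` do not use, hold the left and
      -- the right context.
      set σ : ℕ → FreeMonoid (Fin k) := fun i =>
        if i = 0 then s a else if i = 2 * n + 1 then s b else s (ρ i) with hσ
      set t := (List.range (2 * n + 2)).map fun i => numbers (σ i) with ht
      have hget : ∀ i, i ≤ 2 * n + 1 → numbers (σ i) = t.getD i [] := by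
        intro i hi
        rw [ht, List.getD_eq_getElem _ _ (by simp; omega)]
        simp
      have hmem : t ∈ tuples (shortWords k (S ^ S)) (2 * n + 2) := by
        rw [mem_tuples]
        refine ⟨by simp [ht], fun w hw => ?_⟩
        obtain ⟨i, -, rfl⟩ := List.mem_map.1 hw
        rw [mem_shortWords]
        refine ⟨?_, fun c hc => numbers_lt hc⟩
        simp only [hσ]
        split_ifs <;> exact hs2 _
      have h1 := (testTuple_iff hn hP hget).1 (h t hmem)
      have hvar : ∀ {r : OmegaTerm}, r.VarsLE (2 * n) →
          (actionCon hT).mk' (r.evalPow (exponent S) σ) =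
            (actionCon hT).mk' (r.evalPow (exponent S) ρ) := by
        intro r hr
        rw [map_evalPow, map_evalPow]
        refine evalPow_congr (fun i h1 h2 => ?_) hr
        simp only [hσ]
        rw [if_neg (by omega), if_neg (by omega), ← hs]
      have e0 : (actionCon hT).mk' (σ 0) = (actionCon hT).mk' a := by simp [hσ, ← hs]
      have e1 : (actionCon hT).mk' (σ 1) = (actionCon hT).mk' (ρ 1) :=
        hvar (r := .x 1) ⟨le_rfl, by omega⟩
      have e2 : (actionCon hT).mk' (σ (2 * n + 1)) = (actionCon hT).mk' b := by simp [hσ, ← hs]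
      have eu := hvar (uTerm_varsLE hn)
      have ev := hvar (vTerm_varsLE hn)
      refine (and_congr (iff_congr (hact _ _ ?_) (hact _ _ ?_))
        (iff_congr (hact _ _ ?_) (hact _ _ ?_))).1 h1 <;>
      simp only [map_mul, map_pow, e0, e1, e2, eu, ev]
    exact fun ρ => ⟨fun a b => (key ρ a b).1, fun a b => (key ρ a b).2⟩
  · intro h t ht
    rw [mem_tuples] at ht
    have hlift : ∀ i, ∃ w : FreeMonoid (Fin k), numbers w = t.getD i [] := by
      intro i
      refine exists_numbers_eq fun a ha => ?_
      rcases Nat.lt_or_ge i t.length with hi | hi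
      · rw [List.getD_eq_getElem _ _ hi] at ha
        exact (mem_shortWords.1 (ht.2 _ (List.getElem_mem hi))).2 a ha
      · rw [List.getD_eq_default _ _ hi] at ha
        simp at ha
    choose ρ hρ using hlift
    exact (testTuple_iff hn hP fun i _ => hρ i).2 ⟨(h ρ).1 _ _, (h ρ).2 _ _⟩

theorem recognized_iff_testAll {n S x : ℕ} (hn : 1 ≤ n) {T : List (List ℕ)} {F : List ℕ}
    (hT : ClosedStates T k S) (hx : x < S) {P : List (Fin k) → Prop}
    (hP : ∀ w, P w ↔ run T x (w.map Fin.val) ∈ F) :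
    Recognized n P ↔ TestAll n k S T x F := by
  obtain ⟨hfin, hcard⟩ := finite_synCon_of_closedStates hT hx hP
  rw [recognized_iff hn hfin, levelIdentities_synCon_iff (isExponent_factorial hcard),
    testAll_iff hn hT hx hP]
  rfl

end Test

/-! ### Automata and multiplication tables -/

section Inputs

/-- A bound for the states of the automaton with table `T`. -/
def stateBound (T : List (List ℕ)) : ℕ := T.flatten.sum + 1

/-- Each entry is at most the sum of all entries, and missing entries default to `0`; so the bound
is valid for malformed tables too. -/
theorem entry_lt_stateBound (T : List (List ℕ)) (q a : ℕ) : entry T q a < stateBound T := by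
  rw [stateBound, Nat.lt_succ_iff, entry]
  rcases Nat.lt_or_ge a (T.getD q []).length with ha | ha
  · rw [List.getD_eq_getElem _ _ ha]
    rcases Nat.lt_or_ge q T.length with hq | hq
    · refine List.single_le_sum (by simp) _ (List.mem_flatten.2 ⟨T.getD q [], ?_, List.getElem_mem ha⟩)
      rw [List.getD_eq_getElem _ _ hq]
      exact List.getElem_mem hq
    · exfalso
      rw [List.getD_eq_default _ _ hq] at ha
      simp at ha
  · rw [List.getD_eq_default _ _ ha]
    exact Nat.zero_le _

theorem mem_accepts_iff {k : ℕ} {T : List (List ℕ)} {F : List ℕ} (w : List (Fin k)) :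
    w ∈ (tableDFA k T F).accepts ↔ run T 0 (w.map Fin.val) ∈ F := by
  have h : ∀ q, (tableDFA k T F).evalFrom q w = run T q (w.map Fin.val) := by
    induction w with
    | nil => exact fun q => rfl
    | cons a w ih => exact fun q => ih _
  show (tableDFA k T F).evalFrom 0 w ∈ {q | q ∈ F} ↔ _
  rw [h]
  rfl

theorem inAlternationLevel_iff_testAll {n k : ℕ} (hn : 1 ≤ n) (T : List (List ℕ)) (F : List ℕ) :
    InAlternationLevel n (tableDFA k T F).accepts ↔ TestAll n k (stateBound T) T 0 F := by
  rw [inAlternationLevel_iff hn]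
  exact recognized_iff_testAll hn (fun _ _ _ _ => entry_lt_stateBound T _ _)
    (Nat.succ_pos _) mem_accepts_iff

/-- The table defines a monoid operation on `{0, …, |T| - 1}`. -/
def ValidTable (T : List (List ℕ)) : Prop :=
  (∃ e < T.length, ∀ x < T.length, entry T e x = x ∧ entry T x e = x) ∧
  (∀ x < T.length, ∀ y < T.length, entry T x y < T.length) ∧
  ∀ x < T.length, ∀ y < T.length, ∀ z < T.length,
    entry T (entry T x y) z = entry T x (entry T y z)

theorem IsTable.validTable {T : List (List ℕ)} {M : Type} [Monoid M] (h : IsTable T M) :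
    ValidTable T := by
  obtain ⟨e, he⟩ := h
  have hsurj : ∀ x < T.length, ∃ m : M, (e m : ℕ) = x := fun x hx =>
    ⟨e.symm ⟨x, hx⟩, by simp⟩
  have he' : ∀ x y : M, entry T (e x) (e y) = e (x * y) := he
  refine ⟨⟨e 1, (e 1).2, fun x hx => ?_⟩, fun x hx y hy => ?_, fun x hx y hy z hz => ?_⟩
  · obtain ⟨m, rfl⟩ := hsurj x hx
    rw [he', he', one_mul, mul_one]
    exact ⟨rfl, rfl⟩
  · obtain ⟨m, rfl⟩ := hsurj x hx
    obtain ⟨m', rfl⟩ := hsurj y hy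
    rw [he']
    exact (e _).2
  · obtain ⟨m, rfl⟩ := hsurj x hx
    obtain ⟨m', rfl⟩ := hsurj y hy
    obtain ⟨m'', rfl⟩ := hsurj z hz
    rw [he', he', he', he', mul_assoc]

/-- The carrier of the monoid given by a table. -/
def TableCarrier (T : List (List ℕ)) : Type := Fin T.length

theorem ValidTable.exists_monoid {T : List (List ℕ)} (h : ValidTable T) :
    ∃ (M : Type) (_ : Monoid M), IsTable T M := by
  obtain ⟨⟨e, he, hone⟩, hlt, hassoc⟩ := h
  let i : Monoid (TableCarrier T) :=
    { mul := fun x y => ⟨entry T x.1 y.1, hlt _ x.2 _ y.2⟩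
      one := ⟨e, he⟩
      mul_assoc := fun x y z => Fin.ext (hassoc _ x.2 _ y.2 _ z.2)
      one_mul := fun x => Fin.ext (hone _ x.2).1
      mul_one := fun x => Fin.ext (hone _ x.2).2 }
  exact ⟨TableCarrier T, i, Equiv.refl _, fun _ _ => rfl⟩

/-- The table is read as the automaton of right multiplication, with the elements of `M` as both
states and letters. The test runs over the languages `{w | x φ(w) = y}`: `M` recognizes all of them,
and conversely those with `x = 1` jointly separate the elements of `M`. -/
theorem IsTable.levelV_iff_testAll {n : ℕ} (hn : 1 ≤ n) {T : List (List ℕ)} {M : Type} [Monoid M]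
    (h : IsTable T M) : levelV n M ↔
      ∀ x < T.length, ∀ y < T.length, TestAll n T.length T.length T x [y] := by
  have hvalid := h.validTable
  obtain ⟨e, he⟩ := h
  have he' : ∀ x y : M, entry T (e x) (e y) = e (x * y) := he
  have : Finite M := Finite.of_equiv _ e.symm
  have hcard : Nat.card M = T.length := by simpa using Nat.card_congr e
  have hpos : 0 < T.length := hcard ▸ Nat.card_pos
  let φ : FreeMonoid (Fin T.length) →* M := FreeMonoid.lift e.symm
  have hφ : Function.Surjective φ := fun m => ⟨FreeMonoid.of (e m), by simp [φ]⟩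
  have hrun : ∀ (m : M) (w : FreeMonoid (Fin T.length)),
      run T (e m) (numbers w) = e (m * φ w) := by
    intro m w
    induction w using FreeMonoid.recOn generalizing m with
    | one => simp [numbers, run]
    | of_mul a w ih =>
      rw [numbers_mul, run_append]
      have h1 : run T (e m) (numbers (FreeMonoid.of a)) = e (m * φ (FreeMonoid.of a)) := by
        rw [← he']
        simp [φ, numbers, run]
      rw [h1, ih, map_mul φ, mul_assoc]
  have hclosed : ClosedStates T T.length T.length := fun q hq a ha => hvalid.2.1 q hq a ha
  have htest : ∀ x < T.length, ∀ y, TestAll n T.length T.length T x [y] ↔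
      Recognized n fun w : List (Fin T.length) => run T x (w.map Fin.val) ∈ [y] := fun x hx y =>
    (recognized_iff_testAll hn hclosed hx fun w => Iff.rfl).symm
  have hle : Nat.card M ≤ T.length ^ T.length :=
    hcard.trans_le (Nat.le_self_pow hpos.ne' _)
  have hE : IsExponent M (exponent T.length) := isExponent_factorial hle
  constructor
  · intro hM x hx y hy
    rw [htest x hx]
    obtain ⟨m, hm⟩ : ∃ m : M, (e m : ℕ) = x := ⟨e.symm ⟨x, hx⟩, by simp⟩
    refine ⟨M, inferInstance, φ, {g | (e (m * g) : ℕ) = y}, inferInstance, hM, fun w => ?_⟩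
    have := hrun m (FreeMonoid.ofList w)
    rw [hm] at this
    show run T x (w.map Fin.val) ∈ [y] ↔ (e (m * φ (FreeMonoid.ofList w)) : ℕ) = y
    rw [List.mem_singleton, ← this]
    rfl
  · intro h
    rw [levelV_iff hn]
    -- Choosing `y = φ(v)` and the empty context shows that congruent words have the same value.
    have key : ∀ v w : FreeMonoid (Fin T.length),
        (∀ y < T.length, synCon (fun w : List (Fin T.length) => run T (e 1) (w.map Fin.val) ∈ [y])
          v w) → φ v = φ w := by
      intro v w hvw
      have h1 := (hvw (e (φ v)) (e _).2 1 1).1 (by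
        have := hrun 1 v
        rw [one_mul] at this
        rw [← this]
        simp [numbers])
      have h2 := hrun 1 w
      rw [one_mul] at h2
      have h3 : run T (e 1) (numbers w) = e (φ v) := by simpa [numbers] using h1
      exact e.injective (Fin.ext (h3.symm.trans h2))
    have hsyn : ∀ y < T.length, SyntacticIdentities (exponent T.length) n
        (fun w : List (Fin T.length) => run T (e 1) (w.map Fin.val) ∈ [y]) := fun y hy =>
      (testAll_iff hn hclosed (e 1).2 fun w => Iff.rfl).1 (h (e 1) (e 1).2 y hy)
    have hlift : ∀ (s t : OmegaTerm), (∀ ρ, φ (s.evalPow (exponent T.length) ρ) =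
        φ (t.evalPow (exponent T.length) ρ)) → Satisfies M s t := by
      intro s t hst ρ
      choose r hr using fun i => hφ (ρ i)
      obtain rfl : (fun i => φ (r i)) = ρ := funext hr
      rw [hE.eval_eq, hE.eval_eq, ← map_evalPow, ← map_evalPow, hst]
    exact ⟨hlift _ _ fun ρ => key _ _ fun y hy => (hsyn y hy ρ).2,
      hlift _ _ fun ρ => key _ _ fun y hy => (hsyn y hy ρ).1⟩

end Inputs

/-! ### The tests are primitive recursive -/

section Primitive

variable {α : Type*} [Primcodable α]

theorem primrec_powWord {f : α → ℕ} {g : α → List ℕ} (hf : Primrec f) (hg : Primrec g) :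
    Primrec fun a => powWord (f a) (g a) :=
  Primrec.nat_rec' hf (Primrec.const [])
    (Primrec.list_append.comp (Primrec.snd.comp Primrec.snd) (hg.comp Primrec.fst)).to₂

theorem primrec_getD {t : α → List (List ℕ)} {f : α → ℕ} (ht : Primrec t) (hf : Primrec f) :
    Primrec fun a => (t a).getD (f a) [] := (Primrec.list_getD []).comp ht hf

theorem primrec_prodWord {t : α → List (List ℕ)} {f : α → ℕ} (ht : Primrec t) (hf : Primrec f) :
    Primrec fun a => prodWord (t a) (f a) :=
  Primrec.nat_rec' hf (primrec_getD ht (Primrec.const 1))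
    (Primrec.list_append.comp (Primrec.snd.comp Primrec.snd)
      (primrec_getD (ht.comp Primrec.fst)
        (Primrec.nat_add.comp (Primrec.fst.comp Primrec.snd) (Primrec.const 2)))).to₂

theorem primrec_wrapWord {E : α → ℕ} {t : α → List (List ℕ)} {b : α → List ℕ} {f : α → ℕ}
    (hE : Primrec E) (ht : Primrec t) (hb : Primrec b) (hf : Primrec f) :
    Primrec fun a => wrapWord (E a) (t a) (b a) (f a) := by
  have hm : Primrec fun p : α × ℕ × List ℕ => 2 * p.2.1 :=
    Primrec.nat_mul.comp (Primrec.const 2) (Primrec.fst.comp Primrec.snd)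
  have hadd : ∀ c, Primrec fun p : α × ℕ × List ℕ => 2 * p.2.1 + c := fun c =>
    Primrec.nat_add.comp hm (Primrec.const c)
  have ht' : Primrec fun p : α × ℕ × List ℕ => t p.1 := ht.comp Primrec.fst
  have hE' : Primrec fun p : α × ℕ × List ℕ => E p.1 := hE.comp Primrec.fst
  have hp := primrec_prodWord ht' (hadd 1)
  have hstep := Primrec.list_append.comp
    (Primrec.list_append.comp
      (primrec_powWord hE' (Primrec.list_append.comp hp (primrec_getD ht' (hadd 3))))
      (Primrec.snd.comp Primrec.snd))
    (primrec_powWord hE' (Primrec.list_append.comp (primrec_getD ht' (hadd 4)) hp))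
  exact Primrec.nat_rec' hf hb hstep.to₂

theorem primrec_tuples {β : Type*} [Primcodable β] {W : α → List β} {f : α → ℕ} (hW : Primrec W)
    (hf : Primrec f) : Primrec fun a => tuples (W a) (f a) := by
  have hcons : Primrec₂ fun (p : (α × ℕ × List (List β)) × List β) (w : β) => w :: p.2 :=
    Primrec.list_cons.comp Primrec.snd (Primrec.snd.comp Primrec.fst)
  have hmap : Primrec₂ fun (p : α × ℕ × List (List β)) (v : List β) =>
      (W p.1).map fun w => w :: v :=
    Primrec.list_map (hW.comp (Primrec.fst.comp Primrec.fst)) hcons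
  have hstep : Primrec₂ fun (a : α) (p : ℕ × List (List β)) =>
      p.2.flatMap fun v => (W a).map fun w => w :: v :=
    Primrec.list_flatMap (Primrec.snd.comp Primrec.snd) hmap
  exact Primrec.nat_rec' hf (Primrec.const [[]]) hstep

theorem primrec_shortWords {k L : α → ℕ} (hk : Primrec k) (hL : Primrec L) :
    Primrec fun a => shortWords (k a) (L a) :=
  Primrec.list_flatMap (Primrec.list_range.comp (Primrec.succ.comp hL))
    (primrec_tuples (Primrec.list_range.comp (hk.comp Primrec.fst)) Primrec.snd).to₂

theorem primrec_pow {f g : α → ℕ} (hf : Primrec f) (hg : Primrec g) :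
    Primrec fun a => f a ^ g a :=
  (Primrec.nat_rec' hg (Primrec.const 1)
    (Primrec.nat_mul.comp (Primrec.snd.comp Primrec.snd) (hf.comp Primrec.fst)).to₂).of_eq
    fun a => by induction g a with
      | zero => rfl
      | succ n ih => rw [pow_succ, ← ih]

theorem primrec_factorial : Primrec Nat.factorial :=
  (Primrec.nat_rec' Primrec.id (Primrec.const 1)
    (Primrec.nat_mul.comp (Primrec.succ.comp (Primrec.fst.comp Primrec.snd))
      (Primrec.snd.comp Primrec.snd)).to₂).of_eq
    fun n => by induction n with
      | zero => rfl
      | succ n ih => exact congrArg ((n + 1) * ·) ih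

theorem primrec_exponent {S : α → ℕ} (hS : Primrec S) : Primrec fun a => exponent (S a) :=
  primrec_factorial.comp (Primrec.nat_add.comp (primrec_pow hS hS) (Primrec.const 2))

theorem primrec_entry {T : α → List (List ℕ)} {q b : α → ℕ} (hT : Primrec T) (hq : Primrec q)
    (hb : Primrec b) : Primrec fun a => entry (T a) (q a) (b a) :=
  (Primrec.list_getD 0).comp (primrec_getD hT hq) hb

theorem primrec_run {T : α → List (List ℕ)} {q : α → ℕ} {w : α → List ℕ} (hT : Primrec T)
    (hq : Primrec q) (hw : Primrec w) : Primrec fun a => run (T a) (q a) (w a) :=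
  Primrec.list_foldl hw hq (primrec_entry (hT.comp Primrec.fst) (Primrec.fst.comp Primrec.snd)
    (Primrec.snd.comp Primrec.snd)).to₂

theorem primrecPred_accepted {T : α → List (List ℕ)} {x : α → ℕ} {F : α → List ℕ} {w : α → List ℕ}
    (hT : Primrec T) (hx : Primrec x) (hF : Primrec F) (hw : Primrec w) :
    PrimrecPred fun a => Accepted (T a) (x a) (F a) (w a) :=
  (PrimrecRel.exists_mem_list (R := fun y z : ℕ => y = z) Primrec.eq |>.comp hF
    (primrec_run hT hx hw)).of_eq fun a => by simp [Accepted]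

theorem primrecPred_iff {p q : α → Prop} (hp : PrimrecPred p) (hq : PrimrecPred q) :
    PrimrecPred fun a => p a ↔ q a :=
  ((hp.and hq).or (hp.not.and hq.not)).of_eq fun a => by tauto

theorem primrecPred_testTuple {n S : α → ℕ} {T : α → List (List ℕ)} {x : α → ℕ} {F : α → List ℕ}
    {t : α → List (List ℕ)} (hn : Primrec n) (hS : Primrec S) (hT : Primrec T) (hx : Primrec x)
    (hF : Primrec F) (ht : Primrec t) :
    PrimrecPred fun a => TestTuple (n a) (S a) (T a) (x a) (F a) (t a) := by
  have hE := primrec_exponent hS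
  have hg : ∀ c, Primrec fun a => (t a).getD c [] := fun c => primrec_getD ht (Primrec.const c)
  have hlast : Primrec fun a => (t a).getD (2 * n a + 1) [] :=
    primrec_getD ht (Primrec.succ.comp (Primrec.nat_mul.comp (Primrec.const 2) hn))
  have hctx : ∀ {m : α → List ℕ}, Primrec m →
      PrimrecPred fun a => Accepted (T a) (x a) (F a)
        ((t a).getD 0 [] ++ m a ++ (t a).getD (2 * n a + 1) []) := fun hm =>
    primrecPred_accepted hT hx hF (Primrec.list_append.comp (Primrec.list_append.comp (hg 0) hm)
      hlast)
  have hpred : Primrec fun a => n a - 1 := Primrec.nat_sub.comp hn (Primrec.const 1)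
  have hw : ∀ c d, Primrec fun a => wrapWord (exponent (S a)) (t a)
      (powWord (exponent (S a)) ((t a).getD c [] ++ (t a).getD d [])) (n a - 1) := fun c d =>
    primrec_wrapWord hE ht (primrec_powWord hE (Primrec.list_append.comp (hg c) (hg d))) hpred
  have hp := primrec_powWord hE (hg 1)
  exact (primrecPred_iff (hctx (hw 1 2)) (hctx (hw 2 1))).and
    (primrecPred_iff (hctx hp) (hctx (Primrec.list_append.comp (hg 1) hp)))

theorem primrecPred_forall_mem {β : Type*} [Primcodable β] {l : α → List β} (hl : Primrec l)
    {R : α → β → Prop} (hR : PrimrecPred fun p : β × α => R p.2 p.1) :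
    PrimrecPred fun a => ∀ b ∈ l a, R a b :=
  (PrimrecRel.forall_mem_list (R := fun b a => R a b) hR).comp hl Primrec.id

theorem primrecPred_forall_lt {m : α → ℕ} (hm : Primrec m) {R : α → ℕ → Prop}
    (hR : PrimrecPred fun p : ℕ × α => R p.2 p.1) : PrimrecPred fun a => ∀ b < m a, R a b :=
  (primrecPred_forall_mem (Primrec.list_range.comp hm) hR).of_eq fun a => by simp

theorem primrecPred_exists_lt {m : α → ℕ} (hm : Primrec m) {R : α → ℕ → Prop}
    (hR : PrimrecPred fun p : ℕ × α => R p.2 p.1) : PrimrecPred fun a => ∃ b < m a, R a b :=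
  (primrecPred_forall_lt hm (R := fun a b => ¬ R a b) hR.not).not.of_eq fun a => by simp

/-- The quantifier over words ranges over an explicitly generated finite list, so no unbounded
search occurs. -/
theorem primrecPred_testAll {n k S : α → ℕ} {T : α → List (List ℕ)} {x : α → ℕ} {F : α → List ℕ}
    (hn : Primrec n) (hk : Primrec k) (hS : Primrec S) (hT : Primrec T) (hx : Primrec x)
    (hF : Primrec F) : PrimrecPred fun a => TestAll (n a) (k a) (S a) (T a) (x a) (F a) :=
  primrecPred_forall_mem
    (primrec_tuples (primrec_shortWords hk (primrec_pow hS hS))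
      (Primrec.nat_add.comp (Primrec.nat_mul.comp (Primrec.const 2) hn) (Primrec.const 2)))
    (primrecPred_testTuple (hn.comp Primrec.snd) (hS.comp Primrec.snd) (hT.comp Primrec.snd)
      (hx.comp Primrec.snd) (hF.comp Primrec.snd) Primrec.fst)

theorem primrec_stateBound {T : α → List (List ℕ)} (hT : Primrec T) :
    Primrec fun a => stateBound (T a) :=
  Primrec.succ.comp
    ((Primrec.list_foldr (Primrec.list_flatten.comp hT) (Primrec.const 0)
      (Primrec.nat_add.comp (Primrec.fst.comp Primrec.snd) (Primrec.snd.comp Primrec.snd)).to₂).of_eq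
      fun _ => rfl)

theorem primrecPred_validTable : PrimrecPred ValidTable := by
  have hlen : ∀ {β : Type} [Primcodable β] {T : β → List (List ℕ)}, Primrec T →
      Primrec fun b => (T b).length := fun hT => Primrec.list_length.comp hT
  refine PrimrecPred.and ?_ (PrimrecPred.and ?_ ?_)
  · refine primrecPred_exists_lt (hlen Primrec.id) ?_
    refine primrecPred_forall_lt (hlen Primrec.snd) ?_
    have hT : Primrec fun p : ℕ × ℕ × List (List ℕ) => p.2.2 := Primrec.snd.comp Primrec.snd
    have he : Primrec fun p : ℕ × ℕ × List (List ℕ) => p.2.1 := Primrec.fst.comp Primrec.snd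
    exact (Primrec.eq.comp (primrec_entry hT he Primrec.fst) Primrec.fst).and
      (Primrec.eq.comp (primrec_entry hT Primrec.fst he) Primrec.fst)
  · refine primrecPred_forall_lt (hlen Primrec.id) ?_
    refine primrecPred_forall_lt (hlen Primrec.snd) ?_
    have hT : Primrec fun p : ℕ × ℕ × List (List ℕ) => p.2.2 := Primrec.snd.comp Primrec.snd
    have he : Primrec fun p : ℕ × ℕ × List (List ℕ) => p.2.1 := Primrec.fst.comp Primrec.snd
    exact Primrec.nat_lt.comp (primrec_entry hT he Primrec.fst) (hlen hT)
  · refine primrecPred_forall_lt (hlen Primrec.id) ?_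
    refine primrecPred_forall_lt (hlen Primrec.snd) ?_
    refine primrecPred_forall_lt (hlen (Primrec.snd.comp Primrec.snd)) ?_
    have hT : Primrec fun p : ℕ × ℕ × ℕ × List (List ℕ) => p.2.2.2 :=
      Primrec.snd.comp (Primrec.snd.comp Primrec.snd)
    have hx : Primrec fun p : ℕ × ℕ × ℕ × List (List ℕ) => p.2.2.1 :=
      Primrec.fst.comp (Primrec.snd.comp Primrec.snd)
    have hy : Primrec fun p : ℕ × ℕ × ℕ × List (List ℕ) => p.2.1 := Primrec.fst.comp Primrec.snd
    exact Primrec.eq.comp (primrec_entry hT (primrec_entry hT hx hy) Primrec.fst)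
      (primrec_entry hT hx (primrec_entry hT hy Primrec.fst))

/-- A valid table is the table of some monoid, and the test refers only to the table, so it does not
matter which monoid realizes it. -/
theorem computablePred_table : ComputablePred (fun p : ℕ × List (List ℕ) =>
    1 ≤ p.1 ∧ ∃ (M : Type) (_ : Monoid M), IsTable p.2 M ∧ levelV p.1 M) := by
  have h1 : PrimrecPred fun p : ℕ × List (List ℕ) => 1 ≤ p.1 :=
    Primrec.nat_le.comp (Primrec.const 1) Primrec.fst
  have hlen : Primrec fun p : ℕ × List (List ℕ) => p.2.length :=
    Primrec.list_length.comp Primrec.snd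
  have h2 : PrimrecPred fun p : ℕ × List (List ℕ) => ∀ x < p.2.length, ∀ y < p.2.length,
      TestAll p.1 p.2.length p.2.length p.2 x [y] := by
    refine primrecPred_forall_lt hlen ?_
    refine primrecPred_forall_lt (hlen.comp Primrec.snd) ?_
    have hp : Primrec fun p : ℕ × ℕ × ℕ × List (List ℕ) => p.2.2 := Primrec.snd.comp Primrec.snd
    exact primrecPred_testAll (Primrec.fst.comp hp) (hlen.comp hp) (hlen.comp hp)
      (Primrec.snd.comp hp) (Primrec.fst.comp Primrec.snd)
      (Primrec.list_cons.comp Primrec.fst (Primrec.const []))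
  refine PrimrecPred.computablePred
    ((h1.and ((primrecPred_validTable.comp Primrec.snd).and h2)).of_eq fun p => ?_)
  refine and_congr_right fun hn => ⟨?_, ?_⟩
  · rintro ⟨hv, ht⟩
    obtain ⟨M, i, hM⟩ := hv.exists_monoid
    exact ⟨M, i, hM, (hM.levelV_iff_testAll hn).2 ht⟩
  · rintro ⟨M, i, hM, hV⟩
    exact ⟨hM.validTable, (hM.levelV_iff_testAll hn).1 hV⟩

theorem computablePred_automaton : ComputablePred (fun p : ℕ × ℕ × List (List ℕ) × List ℕ =>
    1 ≤ p.1 ∧ InAlternationLevel p.1 (tableDFA p.2.1 p.2.2.1 p.2.2.2).accepts) := by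
  have h1 : PrimrecPred fun p : ℕ × ℕ × List (List ℕ) × List ℕ => 1 ≤ p.1 :=
    Primrec.nat_le.comp (Primrec.const 1) Primrec.fst
  have hT : Primrec fun p : ℕ × ℕ × List (List ℕ) × List ℕ => p.2.2.1 :=
    Primrec.fst.comp (Primrec.snd.comp Primrec.snd)
  have h2 : PrimrecPred fun p : ℕ × ℕ × List (List ℕ) × List ℕ =>
      TestAll p.1 p.2.1 (stateBound p.2.2.1) p.2.2.1 0 p.2.2.2 :=
    primrecPred_testAll Primrec.fst (Primrec.fst.comp Primrec.snd) (primrec_stateBound hT) hT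
      (Primrec.const 0) (Primrec.snd.comp (Primrec.snd.comp Primrec.snd))
  refine PrimrecPred.computablePred ((h1.and h2).of_eq fun p => ?_)
  exact and_congr_right fun hn => (inAlternationLevel_iff_testAll hn _ _).symm

end Primitive

end TwoVarHierarchy

theorem mainTheorem1 :
    (∀ n : ℕ, 1 ≤ n → ∀ (M : Type u) [Monoid M] [Finite M],
      levelV n M ↔ Aperiodic M ∧ Satisfies M (uTerm n) (vTerm n)) ∧
    ComputablePred (fun p : ℕ × List (List ℕ) =>
      1 ≤ p.1 ∧ ∃ (M : Type) (_ : Monoid M), IsTable p.2 M ∧ levelV p.1 M) ∧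
    ComputablePred (fun p : ℕ × ℕ × List (List ℕ) × List ℕ =>
      1 ≤ p.1 ∧ InAlternationLevel p.1 (tableDFA p.2.1 p.2.2.1 p.2.2.2).accepts) := by
  exact ⟨fun n hn M _ _ => levelV_iff hn M, computablePred_table, computablePred_automaton⟩
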